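/- Let $\beta\in(0,1]$, $H\in(0,1)$, $\eta>0$, $T\ge 0$, $\Delta>0$, and set $\mathfrak c=1/\Gamma(H+\tfrac12)$, $\mathfrak b=\eta^2\mathfrak c^2/(4H)$ and $\mathcal E_\beta(z)=\sum_{n\ge 0} z^n/\Gamma(\beta n+1)$ (the Mittag-Leffler function). On a probability space let $B$ be a standard Brownian motion, with $\mathcal F^B_t=\sigma(B_u:0\le u\le t)$, and let $Y_\beta$ be a random variable independent of $B$ with the one-sided M-Wright distribution, that is, with density $\mathcal M_\beta(u)=\sum_{n\ge0}\frac{(-u)^n}{n!\,\Gamma(-\beta n+1-\beta)}$ on $(0,\infty)$ if $\beta<1$, and $Y_1=1$ almost surely. Let $B^H$ be the Riemann–Liouville fractional Brownian motion with continuous paths, $B^H_t=\mathfrak c\int_0^t(t-u)^{H-1/2}\,\mathrm dB_u$ for $t\ge 0$. Let $\xi_0:[0,\infty)\to(0,\infty)$ be integrable on $[T,T+\Delta]$ and define $$V_t=\xi_0(t)\,\frac{\exp\{\eta\sqrt{Y_\beta}\,B^H_t\}}{\mathbb E[\exp\{\eta\sqrt{Y_\beta}\,B^H_t\}]},\qquad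 \mathrm{VIX}_T=\sqrt{\mathbb E\Big[\tfrac1\Delta\int_T^{T+\Delta}V_s\,\mathrm ds\,\Big|\,\mathcal F^B_T\Big]},\qquad \mathfrak F_T=\mathbb E[\mathrm{VIX}_T\mid\mathcal F^B_0].$$ For $s\in[T,T+\Delta]$ let $\mathcal V_s^T=\int_0^T(s-u)^{H-1/2}\,\mathrm dB_u$ and $$\zeta_T(s)=\sum_{k\ge0}\frac{(\eta\mathfrak c)^k}{k!}\,\frac{\Gamma(1+\frac k2)}{\Gamma(1+\frac{\beta k}2)}\,(\mathcal V_s^T)^k .$$ Then $V$ is integrable with respect to $\mathrm ds\otimes\mathbb P$ on $[T,T+\Delta]\times\Omega$, $\mathrm{VIX}_T$ and $\sqrt{\zeta_T(s)}$ (for every $s\in[T,T+\Delta]$) are integrable, the integrand on the left below is almost surely integrable over $[T,T+\Delta]$, and, almost surely, $$\frac1\Delta\int_T^{T+\Delta}\sqrt{\frac{\xi_0(s)\,\mathcal E_\beta\big(\mathfrak b(s-T)^{2H}\big)}{\mathcal E_\beta\big(\mathfrak b s^{2H}\big)}}\;\mathbb E\big[\sqrt{\zeta_T(s)}\,\big|\,\mathcal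 F_0^B\big]\,\mathrm ds\;\le\;\mathfrak F_T\;\le\;\sqrt{\frac1\Delta\int_T^{T+\Delta}\xi_0(s)\,\mathrm ds}.$$ -/

import Mathlib

open MeasureTheory ProbabilityTheory Filter Set
open scoped NNReal ENNReal Topology

noncomputable section

namespace GreyBergomi

/-! ### Special functions -/

/-- The Mittag-Leffler function on the real line. -/
def mittagLeffler (β z : ℝ) : ℝ :=
  ∑' n : ℕ, z ^ n / Real.Gamma (β * n + 1)

/-- The M-Wright function on the real line. At a pole of the Gamma function Mathlib has
`Real.Gamma = 0`, so the quotient is `0`, in accordance with the convention that the entire function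
`1 / Γ` vanishes there. -/
def mWright (β z : ℝ) : ℝ :=
  ∑' n : ℕ, (-z) ^ n / (n.factorial * Real.Gamma (-β * n + 1 - β))

/-- The one-sided M-Wright distribution: the law on `(0, ∞)` with density `mWright β` if `β < 1`,
and, for `β = 1`, where there is no density, its weak limit, the Dirac mass at `1`
(this is the law with Laplace transform `s ↦ E_1(-s) = exp (-s)`). -/
def mWrightLaw (β : ℝ) : Measure ℝ :=
  if β = 1 then Measure.dirac 1
  else (volume.restrict (Ioi 0)).withDensity fun u => ENNReal.ofReal (mWright β u)

/-! ### Wiener integrals of deterministic functions -/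

/-- A step function `∑ i < n, a i * 1_{(t i, t (i + 1)]}` on the half line. -/
structure StepFun where
  n : ℕ
  t : ℕ → ℝ≥0
  mono : Monotone t
  a : ℕ → ℝ

/-- The values of a step function. -/
def StepFun.eval (φ : StepFun) (u : ℝ) : ℝ :=
  ∑ i ∈ Finset.range φ.n, (Ioc (φ.t i : ℝ) (φ.t (i + 1))).indicator (fun _ => φ.a i) u

variable {Ω : Type*} [MeasurableSpace Ω]

/-- The integral of a step function against the increments of a process. -/
def StepFun.integral (φ : StepFun) (B : ℝ≥0 → Ω → ℝ) (ω : Ω) : ℝ :=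
  ∑ i ∈ Finset.range φ.n, φ.a i * (B (φ.t (i + 1)) ω - B (φ.t i) ω)

/-- The random variable `I` is (a version of) the Wiener integral `∫_0^∞ f(u) dB_u` of the
deterministic function `f ∈ L²(0, ∞)`: there are step functions converging to `f` in `L²(0, ∞)`
whose integrals converge to `I` in `L²(P)`. By the Itô isometry, for a Brownian motion `B` and any
such `f`, there is exactly one such `I` up to almost sure equality. -/
structure IsWienerIntegral (P : Measure Ω) (B : ℝ≥0 → Ω → ℝ) (f : ℝ → ℝ) (I : Ω → ℝ) : Prop where
  memLp_integrand : MemLp f 2 (volume.restrict (Ioi 0))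
  memLp : MemLp I 2 P
  exists_approx : ∃ φ : ℕ → StepFun,
    Tendsto (fun k => eLpNorm (fun u => f u - (φ k).eval u) 2 (volume.restrict (Ioi 0)))
      atTop (𝓝 0) ∧
    Tendsto (fun k => eLpNorm (fun ω => I ω - (φ k).integral B ω) 2 P) atTop (𝓝 0)

/-- The integrand `u ↦ (s - u)^(H - 1/2) 1_{(0, T]}(u)`. -/
def rlKernel (H T s : ℝ) : ℝ → ℝ :=
  (Ioc 0 T).indicator fun u => (s - u) ^ (H - 1 / 2)

/-- `X = ∫_0^T (s - u)^(H - 1/2) dB_u` (almost surely). -/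
def IsVolterraIntegral (P : Measure Ω) (B : ℝ≥0 → Ω → ℝ) (H T s : ℝ) (X : Ω → ℝ) : Prop :=
  IsWienerIntegral P B (rlKernel H T s) X

/-- The constant `1 / Γ(H + 1/2)`. -/
def cConst (H : ℝ) : ℝ := 1 / Real.Gamma (H + 1 / 2)

/-- The constant `η² c² / (4 H)`. -/
def bConst (H η : ℝ) : ℝ := η ^ 2 * cConst H ^ 2 / (4 * H)

/-- `BH` is a Riemann–Liouville fractional Brownian motion driven by `B`: a continuous process with
`BH t = c ∫_0^t (t - s)^(H - 1/2) dB_s` almost surely, for every `t ≥ 0`. (The values of `BH`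
at negative times are irrelevant.) -/
structure IsRiemannLiouvilleFBM (P : Measure Ω) (B : ℝ≥0 → Ω → ℝ) (H : ℝ) (BH : ℝ → Ω → ℝ) :
    Prop where
  measurable : ∀ t, 0 ≤ t → Measurable (BH t)
  continuous_paths : ∀ᵐ ω ∂P, ContinuousOn (fun t => BH t ω) (Ici 0)
  eq_integral : ∀ t, 0 ≤ t → ∃ X : Ω → ℝ,
    IsVolterraIntegral P B H t t X ∧ ∀ᵐ ω ∂P, BH t ω = cConst H * X ω

/-! ### The grey Bergomi variance, the VIX and the VIX future -/

/-- The information `σ(B_u, 0 ≤ u ≤ t)` generated by `B` up to time `t`. -/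
abbrev pastOf (B : ℝ≥0 → Ω → ℝ) (t : ℝ) : MeasurableSpace Ω :=
  ⨆ u : ℝ≥0, ⨆ _ : (u : ℝ) ≤ t, MeasurableSpace.comap (B u) inferInstance

/-- The normalised exponential `exp (η Z - log E[exp (η Z)])`. -/
def normExp (P : Measure Ω) (η : ℝ) (Z : Ω → ℝ) (ω : Ω) : ℝ :=
  Real.exp (η * Z ω - cgf Z P η)

/-- The instantaneous variance `V_t = ξ₀(t) exp (η √Y BH_t - log E[exp (η √Y BH_t)])`. -/
def greyVariance (P : Measure Ω) (ξ₀ : ℝ → ℝ) (η : ℝ) (Y : Ω → ℝ) (BH : ℝ → Ω → ℝ)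
    (t : ℝ) (ω : Ω) : ℝ :=
  ξ₀ t * normExp P η (fun ω' => √(Y ω') * BH t ω') ω

/-- The VIX, `VIX_T = √(E[Δ⁻¹ ∫_T^{T+Δ} V_s ds | F^B_T])`. -/
def vix (P : Measure Ω) (B : ℝ≥0 → Ω → ℝ) (V : ℝ → Ω → ℝ) (Δ T : ℝ) (ω : Ω) : ℝ :=
  √((P[fun ω' => 1 / Δ * ∫ s in T..(T + Δ), V s ω' | pastOf B T]) ω)

/-- The VIX future, `E[VIX_T | F^B_0]`. -/
def vixFuture (P : Measure Ω) (B : ℝ≥0 → Ω → ℝ) (V : ℝ → Ω → ℝ) (Δ T : ℝ) : Ω → ℝ :=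
  P[vix P B V Δ T | pastOf B 0]

/-- The power series `∑ k, (η c)^k / k! * Γ(1 + k/2) / Γ(1 + β k / 2) * x^k`; the random
variable `ζ_T(s)` is its value at `x = ∫_0^T (s - u)^(H - 1/2) dB_u`. -/
def zetaSeries (β H η x : ℝ) : ℝ :=
  ∑' k : ℕ, (η * cConst H) ^ k / k.factorial
    * (Real.Gamma (1 + k / 2) / Real.Gamma (1 + β * k / 2)) * x ^ k

end GreyBergomi

end

noncomputable section

namespace GreyBergomi

variable {Ω : Type*} [MeasurableSpace Ω]

/-! ### Gamma integrals along complex rays -/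

/-! Put `θ = η c` and `f_w(x) = E exp (θ x √Y + θ² w Y / 2)` (`condMGF`). For `s ≥ T` the Volterra
integral defining `BH s` splits at `T` into the past part `𝒱 s` and an independent centred Gaussian
variable of variance `w = (s - T)^(2H) / (2H)`. Integrating out that variable and `Y` gives `E[V_s |
F_T] = N_s := ξ₀ s * f_w(𝒱 s) / E_β(b s^(2H))`. Moreover `f_0(𝒱 s)` is `ζ_T(s)` and `f_w(0) = E_β(b
(s - T)^(2H))`. As `B 0 = 0` almost surely, conditioning on `F_0` is taking the expectation, so both
bounds concern the number `E[VIX_T]`. The upper one is Jensen's inequality together with `E V_s = ξ₀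
s`.

For the lower bound, concavity of the square root in `s` bounds the average of `E √N_s` by
`E[VIX_T]` (`average_le_integral_sqrt_condExp`). It remains to show, for fixed `s`, that `√f_w(0) *
E √f_0(𝒱 s) ≤ E √f_w(𝒱 s)`. The pointwise version may fail at `x < 0`, where `exp (θ x √Y)` and the
weight `exp (θ² w Y / 2)` are negatively correlated. But `𝒱 s` has a symmetric law, so it suffices
to add the values at `x` and `-x`. That symmetrised inequality (`sqrt_integral_exp_tilt`) is a
single-crossing argument: a suitable combination of `exp (± θ x √Y)` has mean zero under the tilted
law and changes sign once, from negative to positive, so removing the increasing weight makes its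
mean nonpositive.

What is needed of `Y` is its moments, `E Y^p = Γ(1 + p) / Γ(1 + β p)`: integer ones give `E exp (a
Y) = E_β(a)`, half-integer ones give the series `ζ`. For `β < 1` they are the Mellin transform of
the M-Wright function. This function is the imaginary part of a contour integral of `z^(β - 1) exp
(z - u z^β)` along a ray on which both exponentials decay. Fubini evaluates the Mellin transform on
`0 < s < 1`, and rapid decay of the function allows analytic continuation to all `s > 0`. -/

theorem integrableOn_rpow_mul_exp_neg_mul {s c : ℝ} (hs : -1 < s) (hc : 0 < c) :
    IntegrableOn (fun x : ℝ => x ^ s * Real.exp (-c * x)) (Ioi 0) := by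
  simpa using integrableOn_rpow_mul_exp_neg_mul_rpow hs one_pos hc

/-- For negative real `z` this is the Gamma integral. Both sides are analytic on the left
half-plane, the left one as the complex moment generating function of the measure `x^(τ - 1) dx`, so
they agree there. -/
theorem integral_rpow_mul_cexp {τ : ℝ} (hτ : 0 < τ) {z : ℂ} (hz : z.re < 0) :
    ∫ x in Ioi (0 : ℝ), ((x ^ (τ - 1) : ℝ) : ℂ) * Complex.exp (z * x)
      = (-z) ^ (-τ : ℂ) * Real.Gamma τ := by
  set d : ℝ → ℝ≥0 := fun x => Real.toNNReal (x ^ (τ - 1)) with hd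
  have hdm : Measurable d := by fun_prop
  set ν : Measure ℝ := (volume.restrict (Ioi 0)).withDensity (fun x => (d x : ℝ≥0∞)) with hν
  have hcoe : ∀ x ∈ Ioi (0 : ℝ), (d x : ℝ) = x ^ (τ - 1) := fun x hx =>
    Real.coe_toNNReal _ (Real.rpow_nonneg (le_of_lt hx) _)
  have hM : ∀ w : ℂ, complexMGF id ν w
      = ∫ x in Ioi (0 : ℝ), ((x ^ (τ - 1) : ℝ) : ℂ) * Complex.exp (w * x) := by
    intro w
    rw [complexMGF, hν, integral_withDensity_eq_integral_smul hdm]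
    refine setIntegral_congr_fun measurableSet_Ioi fun x hx => ?_
    simp only [id]
    rw [← hcoe x hx, NNReal.smul_def, Complex.real_smul]
  have hset : Iio (0 : ℝ) ⊆ integrableExpSet id ν := by
    intro t ht
    rw [integrableExpSet, mem_ofPred_eq, hν, integrable_withDensity_iff_integrable_smul hdm]
    refine (integrableOn_rpow_mul_exp_neg_mul (s := τ - 1) (c := -t) (by linarith)
      (by simpa using ht)).congr_fun (fun x hx => ?_) measurableSet_Ioi
    simp only [id, neg_neg]
    rw [NNReal.smul_def, hcoe x hx, smul_eq_mul]
  have hint : Iio (0 : ℝ) ⊆ interior (integrableExpSet id ν) :=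
    interior_maximal hset isOpen_Iio
  set U : Set ℂ := {w | w.re < 0} with hU
  have hUo : IsOpen U := isOpen_Iio.preimage Complex.continuous_re
  have hUc : IsPreconnected U := (convex_halfSpace_re_lt 0).isPreconnected
  have hA : AnalyticOnNhd ℂ (complexMGF id ν) U :=
    analyticOnNhd_complexMGF.mono fun w hw => hint hw
  have hG : AnalyticOnNhd ℂ (fun w : ℂ => (-w) ^ (-τ : ℂ) * Real.Gamma τ) U := by
    refine DifferentiableOn.analyticOnNhd (fun w hw => ?_) hUo
    refine DifferentiableAt.differentiableWithinAt ?_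
    refine DifferentiableAt.mul_const ?_ _
    refine (differentiableAt_id.neg).cpow_const (Or.inl ?_)
    have hw' : w.re < 0 := hw
    simpa using hw'
  have hreal : ∀ t : ℝ, t < 0 → complexMGF id ν (t : ℂ) = (-(t : ℂ)) ^ (-τ : ℂ) * Real.Gamma τ := by
    intro t ht
    rw [hM]
    have h1 : ∀ x ∈ Ioi (0 : ℝ), ((x ^ (τ - 1) : ℝ) : ℂ) * Complex.exp (t * x)
        = ((x ^ (τ - 1) * Real.exp (-(-t * x)) : ℝ) : ℂ) := by
      intro x _
      push_cast
      simp
    rw [setIntegral_congr_fun measurableSet_Ioi h1, integral_complex_ofReal,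
      Real.integral_rpow_mul_exp_neg_mul_Ioi hτ (by linarith : 0 < -t)]
    have h0 : (0 : ℝ) ≤ -t := by linarith
    rw [one_div, Real.inv_rpow h0, ← Real.rpow_neg h0, Complex.ofReal_mul,
      Complex.ofReal_cpow h0]
    push_cast
    rfl
  -- The real points `-1 - 1/(n + 1)` accumulate at `-1`, which is all the identity theorem needs.
  have hfreq : ∃ᶠ w in 𝓝[≠] (-1 : ℂ), complexMGF id ν w = (-w) ^ (-τ : ℂ) * Real.Gamma τ := by
    have hlim : Tendsto (fun n : ℕ => (((-1 - 1 / ((n : ℝ) + 1) : ℝ)) : ℂ)) atTop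
        (𝓝[≠] (-1 : ℂ)) := by
      refine tendsto_nhdsWithin_iff.2 ⟨?_, Eventually.of_forall fun n => ?_⟩
      · have : Tendsto (fun n : ℕ => (-1 - 1 / ((n : ℝ) + 1) : ℝ)) atTop (𝓝 (-1 - 0)) :=
          tendsto_const_nhds.sub tendsto_one_div_add_atTop_nhds_zero_nat
        have h2 := (Complex.continuous_ofReal.tendsto (-1 - 0 : ℝ)).comp this
        rw [sub_zero] at h2
        simpa [Function.comp_def] using! h2
      · simp only [mem_compl_iff, mem_singleton_iff]
        intro h
        have h3 : (-1 - 1 / ((n : ℝ) + 1) : ℝ) = -1 := by exact_mod_cast h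
        have : (0 : ℝ) < 1 / ((n : ℝ) + 1) := by positivity
        linarith
    refine hlim.frequently (Eventually.of_forall fun n => ?_).frequently
    refine hreal _ ?_
    have : (0 : ℝ) < 1 / ((n : ℝ) + 1) := by positivity
    linarith
  have := hA.eqOn_of_preconnected_of_frequently_eq hG hUc (by simp [hU]) hfreq hz
  rw [← hM]
  exact this

theorem integrableOn_rpow_mul_exp_add_rpow {s c d β : ℝ} (hs : -1 < s) (hc : 0 < c)
    (hd : 0 ≤ d) (hβ : 0 < β) (hβ1 : β < 1) :
    IntegrableOn (fun x : ℝ => x ^ s * Real.exp (-c * x + d * x ^ β)) (Ioi 0) := by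
  -- Chosen so that `D^(1 - β) = 2 (d + 1) / c`: weighted AM-GM for `x^β D^(1 - β)` then bounds `d
  -- x^β` by half of the linear decay plus a constant.
  set D : ℝ := (2 * (d + 1) / c) ^ (1 / (1 - β)) with hD
  have hD0 : 0 < D := by positivity
  have hDp : D ^ (1 - β) = 2 * (d + 1) / c := by
    rw [hD, ← Real.rpow_mul (by positivity), one_div_mul_cancel (by linarith), Real.rpow_one]
  have hbound : ∀ x ∈ Ioi (0 : ℝ), -c * x + d * x ^ β ≤ c / 2 * D + -(c / 2) * x := by
    intro x hx
    have hx0 : (0 : ℝ) ≤ x := le_of_lt hx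
    have h1 := Real.geom_mean_le_arith_mean2_weighted hβ.le (by linarith : 0 ≤ 1 - β) hx0 hD0.le
      (by ring)
    rw [hDp] at h1
    have h2 : x ^ β * (2 * (d + 1) / c) ≤ x + D := by
      refine h1.trans ?_
      nlinarith
    have h3 : (d + 1) * x ^ β ≤ c / 2 * (x + D) := by
      have := mul_le_mul_of_nonneg_left h2 (by positivity : 0 ≤ c / 2)
      calc (d + 1) * x ^ β = c / 2 * (x ^ β * (2 * (d + 1) / c)) := by field_simp
        _ ≤ _ := this
    have h4 : 0 ≤ x ^ β := Real.rpow_nonneg hx0 _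
    linarith
  refine Integrable.mono' ((integrableOn_rpow_mul_exp_neg_mul hs (half_pos hc)).const_mul
    (Real.exp (c / 2 * D))) (by fun_prop) ?_
  refine (ae_restrict_iff' measurableSet_Ioi).2 (Eventually.of_forall fun x hx => ?_)
  have hx0 : (0 : ℝ) ≤ x ^ s := Real.rpow_nonneg (le_of_lt hx) _
  rw [Real.norm_of_nonneg (by positivity)]
  calc x ^ s * Real.exp (-c * x + d * x ^ β)
      ≤ x ^ s * Real.exp (c / 2 * D + -(c / 2) * x) :=
        mul_le_mul_of_nonneg_left (Real.exp_le_exp.2 (hbound x hx)) hx0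
    _ = _ := by rw [Real.exp_add]; ring

/-- `-e^{iθ} = e^{i(θ - π)}` with `θ - π` in `(-π, 0]`, so the principal branch of the power is the
expected one. -/
theorem ray_cpow {θ : ℝ} (h1 : 0 < θ) (h2 : θ ≤ Real.pi) (τ : ℝ) :
    (-Complex.exp (θ * Complex.I)) ^ (-τ : ℂ)
      = Complex.exp (((Real.pi - θ) * τ : ℝ) * Complex.I) := by
  have h3 : -Complex.exp (θ * Complex.I) = Complex.exp ((θ - Real.pi : ℝ) * Complex.I) := by
    push_cast
    rw [sub_mul, Complex.exp_sub, Complex.exp_pi_mul_I, div_neg, div_one]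
  rw [h3, Complex.cpow_def_of_ne_zero (Complex.exp_ne_zero _), Complex.log_exp]
  · congr 1; push_cast; ring
  · simp; linarith
  · simp; linarith [Real.pi_pos]

/-- The left side is the integral of `z^(τ - 1) e^z` along the ray of angle `θ`; its value does not
depend on the angle. -/
theorem integral_ray {θ : ℝ} (h1 : Real.pi / 2 < θ) (h2 : θ ≤ Real.pi) {τ : ℝ} (hτ : 0 < τ) :
    Complex.exp ((θ * τ : ℝ) * Complex.I) *
      ∫ x in Ioi (0 : ℝ), ((x ^ (τ - 1) : ℝ) : ℂ)
        * Complex.exp (Complex.exp (θ * Complex.I) * x)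
      = Complex.exp ((Real.pi * τ : ℝ) * Complex.I) * Real.Gamma τ := by
  have hre : (Complex.exp (θ * Complex.I)).re < 0 := by
    rw [Complex.exp_ofReal_mul_I_re]
    exact Real.cos_neg_of_pi_div_two_lt_of_lt h1 (by linarith [Real.pi_pos])
  rw [integral_rpow_mul_cexp hτ hre, ray_cpow (by linarith [Real.pi_pos]) h2, ← mul_assoc,
    ← Complex.exp_add]
  congr 2
  push_cast; ring

/-- Euler's reflection formula, for the entire function `1 / Γ`. -/
theorem sin_mul_Gamma {τ : ℝ} (hτ : 0 < τ) :
    Real.sin (Real.pi * τ) * Real.Gamma τ = Real.pi / Real.Gamma (1 - τ) := by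
  have h := Real.Gamma_mul_Gamma_one_sub τ
  have hG : Real.Gamma τ ≠ 0 := (Real.Gamma_pos_of_pos hτ).ne'
  -- Passing to the reciprocal covers positive integers `τ` too: there `Real.Gamma (1 - τ)` has the
  -- default value `0`, and both sides vanish.
  have h2 : (Real.Gamma (1 - τ))⁻¹ = Real.Gamma τ * (Real.sin (Real.pi * τ) / Real.pi) := by
    have : Real.Gamma (1 - τ) = (Real.pi / Real.sin (Real.pi * τ)) / Real.Gamma τ := by
      rw [← h]; field_simp
    rw [this, inv_div, div_div_eq_mul_div, mul_div_assoc]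
  rw [div_eq_mul_inv, h2]
  field_simp

/-! ### A ray representation of the M-Wright function -/

/-- The point `e^{iθ}` of the unit circle. -/
def unitRay (θ : ℝ) : ℂ := Complex.exp (θ * Complex.I)

theorem unitRay_add (a b : ℝ) : unitRay (a + b) = unitRay a * unitRay b := by
  rw [unitRay, unitRay, unitRay, ← Complex.exp_add]; push_cast; ring_nf

theorem unitRay_pow (a : ℝ) (n : ℕ) : unitRay a ^ n = unitRay (a * n) := by
  rw [unitRay, unitRay, ← Complex.exp_nat_mul]; push_cast; ring_nf

theorem norm_unitRay (θ : ℝ) : ‖unitRay θ‖ = 1 := Complex.norm_exp_ofReal_mul_I θ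

theorem unitRay_re (θ : ℝ) : (unitRay θ).re = Real.cos θ := Complex.exp_ofReal_mul_I_re θ

theorem unitRay_im (θ : ℝ) : (unitRay θ).im = Real.sin θ := Complex.exp_ofReal_mul_I_im θ

/-- The integrand of the Hankel type representation of the M-Wright function along the ray of
angle `θ`. -/
def rayIntegrand (β θ u x : ℝ) : ℂ :=
  unitRay (θ * β) * ((x ^ (β - 1) : ℝ) : ℂ)
    * Complex.exp (unitRay θ * x - u * (unitRay (θ * β) * ((x ^ β : ℝ) : ℂ)))

def rayIntegral (β θ u : ℝ) : ℂ := ∫ x in Ioi (0 : ℝ), rayIntegrand β θ u x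

theorem norm_rayIntegrand (β θ u : ℝ) {x : ℝ} (hx : 0 < x) :
    ‖rayIntegrand β θ u x‖
      = x ^ (β - 1) * Real.exp (Real.cos θ * x - u * Real.cos (θ * β) * x ^ β) := by
  rw [rayIntegrand, norm_mul, norm_mul, norm_unitRay, one_mul, Complex.norm_exp,
    Complex.norm_of_nonneg (Real.rpow_nonneg hx.le _)]
  congr 2
  simp [Complex.sub_re, Complex.mul_re, unitRay_re]
  ring

theorem measurable_rayIntegrand (β θ : ℝ) :
    Measurable (Function.uncurry (rayIntegrand β θ)) := by
  unfold rayIntegrand Function.uncurry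
  fun_prop

/-- Expand `exp (-u z^β)` and integrate term by term with `integral_ray` at `τ = β (n + 1)`. The
norms of the terms sum to `x^(β - 1) exp (cos θ x + u x^β)`, integrable because `cos θ < 0` and `β <
1`. -/
theorem hasSum_rayIntegral {β θ u : ℝ} (hβ : 0 < β) (hβ1 : β < 1) (h1 : Real.pi / 2 < θ)
    (h2 : θ ≤ Real.pi) (hu : 0 ≤ u) :
    HasSum (fun n : ℕ => (((-u) ^ n / n.factorial : ℝ) : ℂ)
      * (unitRay (Real.pi * (β * (n + 1))) * Real.Gamma (β * (n + 1)))) (rayIntegral β θ u) := by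
  have hc : Real.cos θ < 0 := Real.cos_neg_of_pi_div_two_lt_of_lt h1 (by linarith [Real.pi_pos])
  set F : ℕ → ℝ → ℂ := fun n x => (((-u) ^ n / n.factorial : ℝ) : ℂ) *
    (unitRay (θ * (β * (n + 1))) * (((x ^ (β * (n + 1) - 1) : ℝ) : ℂ)
      * Complex.exp (unitRay θ * x))) with hF
  have hFx : ∀ n : ℕ, ∀ x ∈ Ioi (0 : ℝ), F n x = unitRay (θ * β) * ((x ^ (β - 1) : ℝ) : ℂ)
      * Complex.exp (unitRay θ * x) *
        ((-(u * (unitRay (θ * β) * ((x ^ β : ℝ) : ℂ)))) ^ n / n.factorial) := by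
    intro n x hx
    have e1 : x ^ (β * (n + 1) - 1) = x ^ (β - 1) * (x ^ β) ^ n := by
      rw [← Real.rpow_natCast, ← Real.rpow_mul (le_of_lt hx), ← Real.rpow_add hx]
      congr 1; ring
    have e2 : unitRay (θ * (β * (n + 1))) = unitRay (θ * β) * unitRay (θ * β) ^ n := by
      rw [unitRay_pow, ← unitRay_add]; congr 1; ring
    simp only [hF]
    rw [e1, e2]
    push_cast
    rw [neg_pow (u : ℂ), neg_pow (_ * _), mul_pow, mul_pow]
    ring
  have hint : ∀ n, ∫ x in Ioi (0 : ℝ), F n x = (((-u) ^ n / n.factorial : ℝ) : ℂ)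
      * (unitRay (Real.pi * (β * (n + 1))) * Real.Gamma (β * (n + 1))) := by
    intro n
    have hτ : 0 < β * ((n : ℝ) + 1) := by positivity
    have := integral_ray h1 h2 hτ
    simp only [hF]
    rw [integral_const_mul, integral_const_mul]
    exact congrArg _ this
  have hnorm : ∀ n : ℕ, ∀ x ∈ Ioi (0 : ℝ), ‖F n x‖
      = x ^ (β - 1) * Real.exp (Real.cos θ * x) * ((u * x ^ β) ^ n / n.factorial) := by
    intro n x hx
    have hx0 : (0 : ℝ) ≤ x := le_of_lt hx
    rw [hFx n x hx, norm_mul, norm_mul, norm_mul, norm_unitRay, one_mul, Complex.norm_exp,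
      Complex.norm_of_nonneg (Real.rpow_nonneg hx0 _), norm_div, norm_pow, norm_neg, norm_mul,
      norm_mul, norm_unitRay, one_mul, Complex.norm_of_nonneg (Real.rpow_nonneg hx0 _),
      Complex.norm_of_nonneg hu]
    simp [Complex.mul_re, unitRay_re]
  have hexp : ∀ y : ℝ, HasSum (fun n : ℕ => y ^ n / n.factorial) (Real.exp y) := by
    intro y
    rw [Real.exp_eq_exp_ℝ]
    exact NormedSpace.expSeries_div_hasSum_exp y
  have key : HasSum (fun n => ∫ x in Ioi (0 : ℝ), F n x) (rayIntegral β θ u) := by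
    refine hasSum_integral_of_dominated_convergence (fun n x => x ^ (β - 1)
      * Real.exp (Real.cos θ * x) * ((u * x ^ β) ^ n / n.factorial)) (fun n => ?_) (fun n => ?_)
      ?_ ?_ ?_
    · exact Measurable.aestronglyMeasurable (by simp only [hF]; fun_prop)
    · exact (ae_restrict_iff' measurableSet_Ioi).2 (Eventually.of_forall fun x hx =>
        (hnorm n x hx).le)
    · exact Eventually.of_forall fun x => (hexp _).summable.mul_left _
    · have : ∀ x : ℝ, ∑' n : ℕ, x ^ (β - 1) * Real.exp (Real.cos θ * x)
          * ((u * x ^ β) ^ n / n.factorial)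
          = x ^ (β - 1) * Real.exp (-(-Real.cos θ) * x + u * x ^ β) := by
        intro x
        rw [tsum_mul_left, (hexp _).tsum_eq, neg_neg, Real.exp_add, mul_assoc]
      simp_rw [this]
      exact integrableOn_rpow_mul_exp_add_rpow (by linarith) (by linarith) hu hβ hβ1
    · refine (ae_restrict_iff' measurableSet_Ioi).2 (Eventually.of_forall fun x hx => ?_)
      simp_rw [hFx _ x hx]
      have e : rayIntegrand β θ u x = unitRay (θ * β) * ((x ^ (β - 1) : ℝ) : ℂ)
          * Complex.exp (unitRay θ * x) *
            Complex.exp (-(u * (unitRay (θ * β) * ((x ^ β : ℝ) : ℂ)))) := by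
        rw [rayIntegrand, sub_eq_add_neg (unitRay θ * x), Complex.exp_add, ← mul_assoc]
      have hs : HasSum (fun n : ℕ => (-(u * (unitRay (θ * β) * ((x ^ β : ℝ) : ℂ)))) ^ n
          / (n.factorial : ℂ)) (Complex.exp (-(u * (unitRay (θ * β) * ((x ^ β : ℝ) : ℂ))))) := by
        rw [Complex.exp_eq_exp_ℂ]
        exact NormedSpace.expSeries_div_hasSum_exp _
      rw [e]
      exact hs.mul_left _
  simpa only [hint] using key

/-- Taking imaginary parts of the series leaves `sin (π τ) Γ(τ)` with `τ = β (n + 1)`, which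
reflection turns into `π / Γ(1 - τ)`, the M-Wright coefficient. -/
theorem pi_mul_mWright {β θ u : ℝ} (hβ : 0 < β) (hβ1 : β < 1) (h1 : Real.pi / 2 < θ)
    (h2 : θ ≤ Real.pi) (hu : 0 ≤ u) : Real.pi * mWright β u = (rayIntegral β θ u).im := by
  have h := Complex.imCLM.hasSum (hasSum_rayIntegral hβ hβ1 h1 h2 hu)
  rw [mWright, ← tsum_mul_left]
  refine Eq.trans (tsum_congr fun n => ?_) h.tsum_eq
  have hτ : 0 < β * ((n : ℝ) + 1) := by positivity
  have h3 := sin_mul_Gamma hτ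
  simp only [Complex.imCLM_apply]
  rw [Complex.im_ofReal_mul, Complex.im_mul_ofReal, unitRay_im, h3,
    show -β * n + 1 - β = 1 - β * (n + 1) by ring]
  rw [div_mul_div_comm, mul_div_assoc', mul_comm Real.pi]

/-! ### The Mellin transform of the M-Wright function -/

theorem unitRay_mul_cpow {φ : ℝ} (h1 : -Real.pi < φ) (h2 : φ ≤ Real.pi) {r : ℝ} (hr : 0 < r)
    (s : ℝ) : (unitRay φ * r) ^ (-s : ℂ) = unitRay (-(φ * s)) * ((r ^ (-s) : ℝ) : ℂ) := by
  have h : unitRay φ * r = Complex.exp ((Real.log r : ℝ) + (φ : ℝ) * Complex.I) := by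
    rw [Complex.exp_add, ← Complex.ofReal_exp, Real.exp_log hr, unitRay, mul_comm]
  rw [h, Complex.cpow_def_of_ne_zero (Complex.exp_ne_zero _), Complex.log_exp (by simpa using h1)
    (by simpa using h2), Real.rpow_def_of_pos hr, unitRay, Complex.ofReal_exp, ← Complex.exp_add]
  congr 1; push_cast; ring

/-- The angle `θ` is admissible: both `e^{iθ x}` and `e^{-u e^{iθβ} x^β}` decay. -/
structure IsAdmissible (β θ : ℝ) : Prop where
  pos : 0 < β
  lt_one : β < 1
  pi_div_two_lt : Real.pi / 2 < θ
  le_pi : θ ≤ Real.pi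
  mul_lt : θ * β < Real.pi / 2

theorem exists_isAdmissible {β : ℝ} (hβ : 0 < β) (hβ1 : β < 1) : ∃ θ, IsAdmissible β θ := by
  -- The angle is `π / (1 + β)`: it exceeds `π / 2` and its product with `β` stays below `π / 2`,
  -- both because `β < 1`.
  refine ⟨Real.pi / 2 * (2 / (1 + β)), hβ, hβ1, ?_, ?_, ?_⟩
  · have : 1 < 2 / (1 + β) := by rw [lt_div_iff₀ (by linarith)]; linarith
    nlinarith [Real.pi_pos]
  · have : 2 / (1 + β) ≤ 2 := by rw [div_le_iff₀ (by linarith)]; linarith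
    nlinarith [Real.pi_pos]
  · have : 2 / (1 + β) * β < 1 := by
      rw [div_mul_eq_mul_div, div_lt_one (by linarith)]; linarith
    nlinarith [Real.pi_pos]

theorem IsAdmissible.cos_neg {β θ : ℝ} (h : IsAdmissible β θ) : Real.cos θ < 0 :=
  Real.cos_neg_of_pi_div_two_lt_of_lt h.pi_div_two_lt (by linarith [Real.pi_pos, h.le_pi])

theorem IsAdmissible.angle_pos {β θ : ℝ} (h : IsAdmissible β θ) : 0 < θ * β :=
  mul_pos (by linarith [Real.pi_pos, h.pi_div_two_lt]) h.pos

theorem IsAdmissible.cos_pos {β θ : ℝ} (h : IsAdmissible β θ) : 0 < Real.cos (θ * β) :=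
  Real.cos_pos_of_mem_Ioo ⟨by linarith [Real.pi_pos, h.angle_pos], h.mul_lt⟩

theorem IsAdmissible.integral_rpow_mul_cexp_neg {β θ : ℝ} (h : IsAdmissible β θ) {s r : ℝ}
    (hs : 0 < s) (hr : 0 < r) :
    ∫ u in Ioi (0 : ℝ), ((u ^ (s - 1) : ℝ) : ℂ) * Complex.exp (-(unitRay (θ * β) * r) * u)
      = unitRay (-(θ * β * s)) * ((r ^ (-s) : ℝ) : ℂ) * Real.Gamma s := by
  rw [integral_rpow_mul_cexp hs, neg_neg, unitRay_mul_cpow (by linarith [Real.pi_pos, h.angle_pos])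
    (by linarith [Real.pi_pos, h.mul_lt]) hr]
  rw [Complex.neg_re, Complex.re_mul_ofReal, unitRay_re]
  have := mul_pos h.cos_pos hr
  linarith

/-- Integrating in `u` first gives `Γ(s) (z^β)^(-s)`, and what remains is a ray integral with
exponent `τ = β (1 - s)`. The condition `s < 1` makes it converge at the origin. -/
theorem IsAdmissible.integral_rpow_mul_rayIntegral {β θ : ℝ} (h : IsAdmissible β θ) {s : ℝ}
    (hs : 0 < s) (hs1 : s < 1) :
    IntegrableOn (fun u : ℝ => ((u ^ (s - 1) : ℝ) : ℂ) * rayIntegral β θ u) (Ioi 0) ∧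
    ∫ u in Ioi (0 : ℝ), ((u ^ (s - 1) : ℝ) : ℂ) * rayIntegral β θ u
      = Real.Gamma s * (unitRay (Real.pi * (β * (1 - s))) * Real.Gamma (β * (1 - s))) := by
  have hβ := h.pos
  have ha := h.cos_pos
  have hc := h.cos_neg
  have hτ : 0 < β * (1 - s) := mul_pos hβ (by linarith)
  set G : ℝ → ℝ → ℂ := fun u x => ((u ^ (s - 1) : ℝ) : ℂ) * rayIntegrand β θ u x with hG
  have hGm : Measurable (Function.uncurry G) := by
    have := measurable_rayIntegrand β θ
    have h2 : Measurable fun p : ℝ × ℝ => rayIntegrand β θ p.1 p.2 := this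
    simp only [hG, Function.uncurry_def]
    fun_prop
  have hGx : ∀ x ∈ Ioi (0 : ℝ), ∀ u, G u x = unitRay (θ * β) * ((x ^ (β - 1) : ℝ) : ℂ)
      * Complex.exp (unitRay θ * x) * (((u ^ (s - 1) : ℝ) : ℂ)
        * Complex.exp (-(unitRay (θ * β) * ((x ^ β : ℝ) : ℂ)) * u)) := by
    intro x _ u
    simp only [hG]
    rw [rayIntegrand, sub_eq_add_neg (unitRay θ * x), Complex.exp_add]
    ring_nf
  have hnorm : ∀ x ∈ Ioi (0 : ℝ), ∀ u ∈ Ioi (0 : ℝ), ‖G u x‖ = x ^ (β - 1)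
      * Real.exp (Real.cos θ * x)
        * (u ^ (s - 1) * Real.exp (-(Real.cos (θ * β) * x ^ β) * u)) := by
    intro x hx u hu
    simp only [hG]
    rw [norm_mul, norm_rayIntegrand _ _ _ hx,
      Complex.norm_of_nonneg (Real.rpow_nonneg (le_of_lt hu) _),
      sub_eq_add_neg (Real.cos θ * x), Real.exp_add]
    ring_nf
  have hxb : ∀ x ∈ Ioi (0 : ℝ), 0 < x ^ β := fun x hx => Real.rpow_pos_of_pos hx _
  have hint : Integrable (Function.uncurry G)
      ((volume.restrict (Ioi 0)).prod (volume.restrict (Ioi 0))) := by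
    rw [integrable_prod_iff' hGm.aestronglyMeasurable]
    constructor
    · refine (ae_restrict_iff' measurableSet_Ioi).2 (Eventually.of_forall fun x hx => ?_)
      have h1 := (integrableOn_rpow_mul_exp_neg_mul (s := s - 1) (by linarith)
        (mul_pos ha (hxb x hx))).const_mul (x ^ (β - 1) * Real.exp (Real.cos θ * x))
      refine Integrable.mono' h1 ?_ ((ae_restrict_iff' measurableSet_Ioi).2
        (Eventually.of_forall fun u hu => (hnorm x hx u hu).le))
      exact (hGm.comp (measurable_id.prodMk measurable_const)).aestronglyMeasurable
    · have h1 : IntegrableOn (fun x : ℝ => Real.cos (θ * β) ^ (-s) * Real.Gamma s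
          * (x ^ (β * (1 - s) - 1) * Real.exp (-(-Real.cos θ) * x))) (Ioi 0) :=
        (integrableOn_rpow_mul_exp_neg_mul (by linarith) (by linarith)).const_mul _
      refine h1.congr_fun (fun x hx => ?_) measurableSet_Ioi
      have h2 := Real.integral_rpow_mul_exp_neg_mul_Ioi hs (mul_pos ha (hxb x hx))
      simp only [Function.uncurry_apply_pair]
      rw [setIntegral_congr_fun measurableSet_Ioi (hnorm x hx), integral_const_mul]
      simp only [neg_mul] at h2 ⊢
      rw [h2, one_div, Real.inv_rpow (mul_pos ha (hxb x hx)).le,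
        Real.mul_rpow ha.le (hxb x hx).le, ← Real.rpow_mul (le_of_lt hx), mul_inv,
        Real.rpow_neg ha.le, ← Real.rpow_neg (le_of_lt hx), neg_neg,
        show β * (1 - s) - 1 = (β - 1) + -(β * s) by ring, Real.rpow_add hx]
      ring
  have hswap := integral_integral_swap hint
  have h3 : ∀ u, ∫ x in Ioi (0 : ℝ), G u x = ((u ^ (s - 1) : ℝ) : ℂ) * rayIntegral β θ u := by
    intro u
    simp only [hG]
    rw [integral_const_mul, rayIntegral]
  refine ⟨?_, ?_⟩
  · have := hint.integral_prod_left
    simp only [Function.uncurry_apply_pair, h3] at this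
    exact this
  simp_rw [h3] at hswap
  rw [hswap]
  have h4 : ∀ x ∈ Ioi (0 : ℝ), ∫ u in Ioi (0 : ℝ), G u x
      = Real.Gamma s * unitRay (θ * (β * (1 - s))) * (((x ^ (β * (1 - s) - 1) : ℝ) : ℂ)
        * Complex.exp (unitRay θ * x)) := by
    intro x hx
    simp_rw [hGx x hx]
    rw [integral_const_mul, h.integral_rpow_mul_cexp_neg hs (hxb x hx),
      ← Real.rpow_mul (le_of_lt hx),
      show β * (1 - s) - 1 = (β - 1) + β * -s by ring, Real.rpow_add hx,
      show θ * (β * (1 - s)) = θ * β + -(θ * β * s) by ring, unitRay_add]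
    push_cast
    ring
  rw [setIntegral_congr_fun measurableSet_Ioi h4, integral_const_mul]
  have := integral_ray h.pi_div_two_lt h.le_pi hτ
  rw [mul_assoc]
  exact congrArg _ this

/-! ### Decay and continuity of the M-Wright function. -/

theorem norm_exp_sub_sum_le_of_re_nonpos (K : ℕ) {z : ℂ} (hz : z.re ≤ 0) :
    ‖Complex.exp z - ∑ k ∈ Finset.range K, z ^ k / k.factorial‖
      ≤ (Real.exp 1 + 1 + K) * ‖z‖ ^ K := by
  have hp : 0 ≤ ‖z‖ ^ K := by positivity
  have he := Real.exp_pos 1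
  rcases le_total ‖z‖ 1 with h1 | h1
  · calc _ ≤ ‖z‖ ^ K * Real.exp ‖z‖ := Complex.norm_exp_sub_sum_le_norm_mul_exp z K
      _ ≤ ‖z‖ ^ K * Real.exp 1 := by gcongr
      _ ≤ _ := by nlinarith [(Nat.cast_nonneg K : (0 : ℝ) ≤ K)]
  · have h2 : ‖Complex.exp z‖ ≤ 1 := by
      rw [Complex.norm_exp]; exact Real.exp_le_one_iff.2 hz
    have h3 : ‖∑ k ∈ Finset.range K, z ^ k / (k.factorial : ℂ)‖ ≤ K * ‖z‖ ^ K := by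
      refine (norm_sum_le _ _).trans ?_
      calc ∑ k ∈ Finset.range K, ‖z ^ k / (k.factorial : ℂ)‖
          ≤ ∑ k ∈ Finset.range K, ‖z‖ ^ K := by
            refine Finset.sum_le_sum fun k hk => ?_
            rw [norm_div, norm_pow, Complex.norm_natCast]
            refine (div_le_self (by positivity) ?_).trans
              (pow_le_pow_right₀ h1 (Finset.mem_range.1 hk).le)
            exact_mod_cast Nat.factorial_pos k
        _ = K * ‖z‖ ^ K := by simp
    have h4 : 1 ≤ ‖z‖ ^ K := one_le_pow₀ h1
    refine (norm_sub_le _ _).trans ?_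
    nlinarith

/-- The point is that the value is real: after the substitution `y = x^β` the phase of the
integrand, `θ (β + k)`, is cancelled exactly by that of the Gamma integral. -/
theorem IsAdmissible.integral_mul_pow {β θ : ℝ} (h : IsAdmissible β θ) (k : ℕ) {u : ℝ}
    (hu : 0 < u) :
    ∫ x in Ioi (0 : ℝ), unitRay (θ * β) * ((x ^ (β - 1) : ℝ) : ℂ)
      * Complex.exp (-(u * (unitRay (θ * β) * ((x ^ β : ℝ) : ℂ)))) * (unitRay θ * x) ^ k
      = ((β⁻¹ * (u ^ (-(k / β + 1)) * Real.Gamma (k / β + 1)) : ℝ) : ℂ) := by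
  have hβ := h.pos
  have hs : 0 < (k : ℝ) / β + 1 := by positivity
  have h1 := integral_comp_rpow_Ioi (fun y : ℝ => unitRay (θ * (β + k))
    * (((y ^ ((k : ℝ) / β + 1 - 1) : ℝ) : ℂ) * Complex.exp (-(unitRay (θ * β) * u) * y)))
    h.pos.ne'
  rw [integral_const_mul, h.integral_rpow_mul_cexp_neg hs hu, ← mul_assoc, ← mul_assoc,
    ← unitRay_add, show θ * (β + k) + -(θ * β * (k / β + 1)) = 0 by field_simp; ring] at h1
  have h2 : ∀ x ∈ Ioi (0 : ℝ), unitRay (θ * β) * ((x ^ (β - 1) : ℝ) : ℂ)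
      * Complex.exp (-(u * (unitRay (θ * β) * ((x ^ β : ℝ) : ℂ)))) * (unitRay θ * x) ^ k
      = ((β⁻¹ : ℝ) : ℂ) * ((|β| * x ^ (β - 1)) • (unitRay (θ * (β + k))
        * ((((x ^ β) ^ ((k : ℝ) / β + 1 - 1) : ℝ) : ℂ)
          * Complex.exp (-(unitRay (θ * β) * u) * ((x ^ β : ℝ) : ℂ))))) := by
    intro x hx
    have e1 : (x ^ β) ^ ((k : ℝ) / β + 1 - 1) = x ^ k := by
      rw [← Real.rpow_mul (le_of_lt hx), add_sub_cancel_right, mul_div_cancel₀ _ hβ.ne',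
        Real.rpow_natCast]
    have hβc : (β : ℂ) ≠ 0 := by exact_mod_cast hβ.ne'
    rw [e1, abs_of_pos hβ, Complex.real_smul, mul_add, unitRay_add, mul_pow, unitRay_pow]
    push_cast
    field_simp
  rw [setIntegral_congr_fun measurableSet_Ioi h2, integral_const_mul, h1]
  simp [unitRay]

/-- Subtracting from `exp (e^{iθ} x)` its first `K` Taylor terms does not change the imaginary part
of the ray integral, since those terms integrate to real numbers. The remainder is of size `x^K`,
and its integral against the decaying factor produces the power of `u`. As `K` is arbitrary, the
decay beats every power. -/
theorem IsAdmissible.exists_abs_mWright_le {β θ : ℝ} (h : IsAdmissible β θ) (K : ℕ) :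
    ∃ C, ∀ u, 0 < u → |mWright β u| ≤ C * u ^ (-(K / β + 1)) := by
  have hβ := h.pos
  have ha := h.cos_pos
  have hc := h.cos_neg
  refine ⟨(Real.exp 1 + 1 + K) * (Real.cos (θ * β) ^ (-(K / β + 1)) * (1 / β)
    * Real.Gamma (K / β + 1)) / Real.pi, fun u hu => ?_⟩
  set A : ℝ → ℂ := fun x => unitRay (θ * β) * ((x ^ (β - 1) : ℝ) : ℂ)
      * Complex.exp (-(u * (unitRay (θ * β) * ((x ^ β : ℝ) : ℂ)))) with hA
  have hAm : Measurable A := by simp only [hA]; fun_prop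
  have hAn : ∀ x ∈ Ioi (0 : ℝ), ‖A x‖
      = x ^ (β - 1) * Real.exp (-(u * Real.cos (θ * β)) * x ^ β) := by
    intro x hx
    simp only [hA]
    rw [norm_mul, norm_mul, norm_unitRay, one_mul,
      Complex.norm_of_nonneg (Real.rpow_nonneg (le_of_lt hx) _), Complex.norm_exp]
    congr 2
    simp [Complex.mul_re, unitRay_re, mul_assoc]
  have hwn : ∀ x ∈ Ioi (0 : ℝ), ‖unitRay θ * (x : ℂ)‖ = x := by
    intro x hx
    rw [norm_mul, norm_unitRay, one_mul, Complex.norm_of_nonneg (le_of_lt hx)]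
  have hpi : ∀ k : ℕ, IntegrableOn (fun x : ℝ => x ^ (β - 1)
      * Real.exp (-(u * Real.cos (θ * β)) * x ^ β) * x ^ k) (Ioi 0) := by
    intro k
    have h1 : -1 < β - 1 + k := by
      have : (0 : ℝ) ≤ k := Nat.cast_nonneg k
      linarith
    refine (integrableOn_rpow_mul_exp_neg_mul_rpow h1 hβ (mul_pos hu ha)).congr_fun
      (fun x hx => ?_) measurableSet_Ioi
    simp only
    rw [Real.rpow_add hx, Real.rpow_natCast]
    ring
  have hpow : ∀ k : ℕ, IntegrableOn (fun x : ℝ => A x * (unitRay θ * x) ^ k) (Ioi 0) := by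
    intro k
    refine Integrable.mono' (hpi k) (by fun_prop) ((ae_restrict_iff' measurableSet_Ioi).2
      (Eventually.of_forall fun x hx => ?_))
    rw [norm_mul, norm_pow, hAn x hx, hwn x hx]
  have hray : IntegrableOn (rayIntegrand β θ u) (Ioi 0) := by
    refine Integrable.mono' (hpi 0)
      ((measurable_rayIntegrand β θ).comp measurable_prodMk_left).aestronglyMeasurable
      ((ae_restrict_iff' measurableSet_Ioi).2 (Eventually.of_forall fun x hx => ?_))
    rw [norm_rayIntegrand _ _ _ hx, pow_zero, mul_one]
    refine mul_le_mul_of_nonneg_left (Real.exp_le_exp.2 ?_) (Real.rpow_nonneg (le_of_lt hx) _)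
    have := mul_neg_of_neg_of_pos hc hx
    linarith
  have hsumI : IntegrableOn (fun x : ℝ => ∑ k ∈ Finset.range K,
      (k.factorial : ℂ)⁻¹ * (A x * (unitRay θ * x) ^ k)) (Ioi 0) :=
    integrable_finsetSum _ fun k _ => (hpow k).const_mul _
  have hsum_im : (∫ x in Ioi (0 : ℝ), ∑ k ∈ Finset.range K,
      (k.factorial : ℂ)⁻¹ * (A x * (unitRay θ * x) ^ k)).im = 0 := by
    rw [integral_finsetSum _ fun k _ => (hpow k).const_mul _, Complex.im_sum]
    refine Finset.sum_eq_zero fun k _ => ?_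
    rw [integral_const_mul, h.integral_mul_pow k hu]
    rw [show ((k.factorial : ℂ)⁻¹) = (((k.factorial : ℝ)⁻¹ : ℝ) : ℂ) by push_cast; rfl,
      ← Complex.ofReal_mul, Complex.ofReal_im]
  have hM : Real.pi * mWright β u = (∫ x in Ioi (0 : ℝ), (rayIntegrand β θ u x
      - ∑ k ∈ Finset.range K, (k.factorial : ℂ)⁻¹ * (A x * (unitRay θ * x) ^ k))).im := by
    rw [integral_sub hray hsumI, Complex.sub_im, hsum_im, sub_zero,
      pi_mul_mWright h.pos h.lt_one h.pi_div_two_lt h.le_pi hu.le, rayIntegral]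
  have hbd : ∀ x ∈ Ioi (0 : ℝ), ‖rayIntegrand β θ u x
      - ∑ k ∈ Finset.range K, (k.factorial : ℂ)⁻¹ * (A x * (unitRay θ * x) ^ k)‖
      ≤ (Real.exp 1 + 1 + K) * (x ^ (β - 1)
        * Real.exp (-(u * Real.cos (θ * β)) * x ^ β) * x ^ K) := by
    intro x hx
    have e : rayIntegrand β θ u x
        - ∑ k ∈ Finset.range K, (k.factorial : ℂ)⁻¹ * (A x * (unitRay θ * x) ^ k)
        = A x * (Complex.exp (unitRay θ * x)
          - ∑ k ∈ Finset.range K, (unitRay θ * x) ^ k / k.factorial) := by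
      rw [mul_sub, Finset.mul_sum, rayIntegrand, sub_eq_add_neg (unitRay θ * x), Complex.exp_add]
      congr 1
      · simp only [hA]; ring
      · exact Finset.sum_congr rfl fun k _ => by ring
    have hre : (unitRay θ * x).re ≤ 0 := by
      rw [Complex.re_mul_ofReal, unitRay_re]
      exact (mul_neg_of_neg_of_pos hc hx).le
    have h2 := norm_exp_sub_sum_le_of_re_nonpos K hre
    rw [hwn x hx] at h2
    rw [e, norm_mul, hAn x hx]
    have h3 : 0 ≤ x ^ (β - 1) * Real.exp (-(u * Real.cos (θ * β)) * x ^ β) :=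
      mul_nonneg (Real.rpow_nonneg (le_of_lt hx) _) (Real.exp_pos _).le
    calc _ ≤ _ := mul_le_mul_of_nonneg_left h2 h3
      _ = _ := by ring
  have hval : ∫ x in Ioi (0 : ℝ), x ^ (β - 1)
      * Real.exp (-(u * Real.cos (θ * β)) * x ^ β) * x ^ K
      = (u * Real.cos (θ * β)) ^ (-(K / β + 1)) * (1 / β) * Real.Gamma (K / β + 1) := by
    have h1 : -1 < β - 1 + K := by
      have : (0 : ℝ) ≤ K := Nat.cast_nonneg K
      linarith
    have := integral_rpow_mul_exp_neg_mul_rpow hβ h1 (mul_pos hu ha)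
    rw [show (β - 1 + K + 1) / β = K / β + 1 by field_simp; ring,
      show -(β - 1 + K + 1) / β = -(K / β + 1) by field_simp; ring] at this
    rw [← this]
    refine setIntegral_congr_fun measurableSet_Ioi fun x hx => ?_
    rw [Real.rpow_add hx, Real.rpow_natCast]
    ring
  have h5 : Real.pi * |mWright β u| ≤ (Real.exp 1 + 1 + K)
      * ((u * Real.cos (θ * β)) ^ (-(K / β + 1)) * (1 / β) * Real.Gamma (K / β + 1)) := by
    rw [← abs_of_pos Real.pi_pos, ← abs_mul, hM]
    refine (Complex.abs_im_le_norm _).trans ((norm_integral_le_integral_norm _).trans ?_)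
    rw [← hval, ← integral_const_mul]
    refine setIntegral_mono_on (hray.sub hsumI).norm ((hpi K).const_mul _) measurableSet_Ioi hbd
  rw [Real.mul_rpow hu.le ha.le] at h5
  rw [div_mul_eq_mul_div, le_div_iff₀ Real.pi_pos]
  calc _ = Real.pi * |mWright β u| := mul_comm _ _
    _ ≤ _ := h5
    _ = _ := by ring

theorem IsAdmissible.exists_abs_mWright_le_const {β θ : ℝ} (h : IsAdmissible β θ) :
    ∃ C, ∀ u, 0 < u → |mWright β u| ≤ C := by
  have hβ := h.pos
  have hc := h.cos_neg
  have hI : IntegrableOn (fun x : ℝ => x ^ (β - 1) * Real.exp (-(-Real.cos θ) * x)) (Ioi 0) :=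
    integrableOn_rpow_mul_exp_neg_mul (by linarith) (by linarith)
  refine ⟨(∫ x in Ioi (0 : ℝ), x ^ (β - 1) * Real.exp (-(-Real.cos θ) * x)) / Real.pi,
    fun u hu => ?_⟩
  rw [le_div_iff₀ Real.pi_pos, mul_comm, ← abs_of_pos Real.pi_pos, ← abs_mul,
    pi_mul_mWright h.pos h.lt_one h.pi_div_two_lt h.le_pi hu.le]
  refine (Complex.abs_im_le_norm _).trans ?_
  refine norm_integral_le_of_norm_le hI ((ae_restrict_iff' measurableSet_Ioi).2
    (Eventually.of_forall fun x hx => ?_))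
  rw [norm_rayIntegrand _ _ _ hx]
  refine mul_le_mul_of_nonneg_left (Real.exp_le_exp.2 ?_) (Real.rpow_nonneg (le_of_lt hx) _)
  have := mul_pos (mul_pos hu h.cos_pos) (Real.rpow_pos_of_pos hx β)
  linarith

theorem IsAdmissible.continuousOn_mWright {β θ : ℝ} (h : IsAdmissible β θ) :
    ContinuousOn (mWright β) (Ioi 0) := by
  have hβ := h.pos
  have hc := h.cos_neg
  have hI : IntegrableOn (fun x : ℝ => x ^ (β - 1) * Real.exp (-(-Real.cos θ) * x)) (Ioi 0) :=
    integrableOn_rpow_mul_exp_neg_mul (by linarith) (by linarith)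
  have hJ : ContinuousOn (rayIntegral β θ) (Ioi 0) := by
    refine continuousOn_of_dominated (bound := fun x : ℝ => x ^ (β - 1)
      * Real.exp (-(-Real.cos θ) * x)) (fun u _ => ?_) (fun u hu => ?_) hI ?_
    · exact ((measurable_rayIntegrand β θ).comp measurable_prodMk_left).aestronglyMeasurable
    · refine (ae_restrict_iff' measurableSet_Ioi).2 (Eventually.of_forall fun x hx => ?_)
      rw [norm_rayIntegrand _ _ _ hx]
      refine mul_le_mul_of_nonneg_left (Real.exp_le_exp.2 ?_) (Real.rpow_nonneg (le_of_lt hx) _)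
      have := mul_pos (mul_pos hu h.cos_pos) (Real.rpow_pos_of_pos hx β)
      linarith
    · refine Eventually.of_forall fun x => Continuous.continuousOn ?_
      unfold rayIntegrand
      fun_prop
  have h2 : ContinuousOn (fun u => (rayIntegral β θ u).im / Real.pi) (Ioi 0) :=
    (Complex.continuous_im.comp_continuousOn hJ).div_const _
  refine h2.congr fun u hu => ?_
  rw [eq_div_iff Real.pi_ne_zero, mul_comm]
  exact pi_mul_mWright h.pos h.lt_one h.pi_div_two_lt h.le_pi (le_of_lt hu)

/-! ### Analytic continuation of the Mellin transform. -/

theorem IsAdmissible.mellin_mWright_of_lt_one {β θ : ℝ} (h : IsAdmissible β θ) {s : ℝ}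
    (hs : 0 < s) (hs1 : s < 1) :
    ∫ u in Ioi (0 : ℝ), u ^ (s - 1) * mWright β u
      = Real.Gamma s / Real.Gamma (1 + β * (s - 1)) := by
  obtain ⟨hi, hv⟩ := h.integral_rpow_mul_rayIntegral hs hs1
  have hτ : 0 < β * (1 - s) := mul_pos h.pos (by linarith)
  have h1 : ∫ u in Ioi (0 : ℝ), Real.pi * (u ^ (s - 1) * mWright β u)
      = (∫ u in Ioi (0 : ℝ), ((u ^ (s - 1) : ℝ) : ℂ) * rayIntegral β θ u).im := by
    have h2 := integral_im hi
    simp only [RCLike.im_to_complex] at h2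
    rw [← h2]
    refine setIntegral_congr_fun measurableSet_Ioi fun u hu => ?_
    rw [Complex.im_ofReal_mul, ← pi_mul_mWright h.pos h.lt_one h.pi_div_two_lt h.le_pi
      (le_of_lt hu)]
    ring
  rw [hv, integral_const_mul, Complex.im_ofReal_mul, Complex.im_mul_ofReal, unitRay_im,
    sin_mul_Gamma hτ, show 1 - β * (1 - s) = 1 + β * (s - 1) by ring] at h1
  have h3 := Real.pi_ne_zero
  have h4 : ∀ a b g : ℝ, Real.pi * a = g * (Real.pi / b) → a = g / b := by
    intro a b g h
    have : Real.pi * a = Real.pi * (g / b) := by rw [h]; ring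
    exact mul_left_cancel₀ h3 this
  exact h4 _ _ _ h1

/-- Boundedness near `0` and rapid decay at infinity make the Mellin transform converge and be
holomorphic on the whole right half-plane. -/
theorem mellinConvergent_mWright {β : ℝ} (hβ : 0 < β) (hβ1 : β < 1) {s : ℂ} (hs : 0 < s.re) :
    MellinConvergent (fun u => (mWright β u : ℂ)) s ∧
      DifferentiableAt ℂ (mellin (fun u => (mWright β u : ℂ))) s := by
  obtain ⟨θ, h⟩ := exists_isAdmissible hβ hβ1
  have hloc : LocallyIntegrableOn (fun u => (mWright β u : ℂ)) (Ioi 0) :=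
    (Complex.continuous_ofReal.comp_continuousOn h.continuousOn_mWright).locallyIntegrableOn
      measurableSet_Ioi
  -- With `K > β Re s` the decay exponent `K / β + 1` exceeds `Re s`.
  obtain ⟨K, hK⟩ := exists_nat_gt (β * s.re)
  have hKs : s.re < K / β + 1 := by
    have : s.re < K / β := by rw [lt_div_iff₀ hβ, mul_comm]; exact hK
    linarith
  obtain ⟨C, hC⟩ := h.exists_abs_mWright_le K
  obtain ⟨C', hC'⟩ := h.exists_abs_mWright_le_const
  have htop : (fun u => (mWright β u : ℂ)) =O[atTop] (fun u : ℝ => u ^ (-((K : ℝ) / β + 1))) := by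
    refine Asymptotics.IsBigO.of_bound C ?_
    filter_upwards [eventually_gt_atTop 0] with u hu
    rw [Complex.norm_real, Real.norm_eq_abs, Real.norm_of_nonneg (Real.rpow_nonneg hu.le _)]
    exact hC u hu
  have hbot : (fun u => (mWright β u : ℂ)) =O[𝓝[>] 0] (fun u : ℝ => u ^ (-(0 : ℝ))) := by
    refine Asymptotics.IsBigO.of_bound C' ?_
    filter_upwards [self_mem_nhdsWithin] with u hu
    rw [Complex.norm_real, Real.norm_eq_abs, neg_zero, Real.rpow_zero]
    simpa using hC' u hu
  exact ⟨mellinConvergent_of_isBigO_rpow hloc htop hKs hbot hs,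
    mellin_differentiableAt_of_isBigO_rpow hloc htop hKs hbot hs⟩

/-- The moments of the M-Wright function. -/
theorem integral_rpow_mul_mWright {β p : ℝ} (hβ : 0 < β) (hβ1 : β < 1) (hp : -1 < p) :
    IntegrableOn (fun u : ℝ => u ^ p * mWright β u) (Ioi 0) ∧
    ∫ u in Ioi (0 : ℝ), u ^ p * mWright β u
      = Real.Gamma (1 + p) / Real.Gamma (1 + β * p) := by
  obtain ⟨θ, h⟩ := exists_isAdmissible hβ hβ1
  set f : ℝ → ℂ := fun u => (mWright β u : ℂ) with hf
  set g : ℂ → ℂ := fun s => Complex.Gamma s * (Complex.Gamma (1 + β * (s - 1)))⁻¹ with hg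
  set U : Set ℂ := {s | 0 < s.re} with hU
  have hUo : IsOpen U := isOpen_Ioi.preimage Complex.continuous_re
  have hUc : IsPreconnected U := (convex_halfSpace_re_gt 0).isPreconnected
  have hA : AnalyticOnNhd ℂ (mellin f) U := DifferentiableOn.analyticOnNhd
    (fun s hs => (mellinConvergent_mWright hβ hβ1 hs).2.differentiableWithinAt) hUo
  have hG : AnalyticOnNhd ℂ g U := by
    refine DifferentiableOn.analyticOnNhd (fun s hs => ?_) hUo
    refine DifferentiableAt.differentiableWithinAt ?_
    refine DifferentiableAt.mul (Complex.differentiableAt_Gamma s fun m hm => ?_) ?_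
    · have h1 : 0 < s.re := hs
      rw [hm] at h1
      simp only [Complex.neg_re, Complex.natCast_re] at h1
      have : (0 : ℝ) ≤ m := Nat.cast_nonneg m
      linarith
    · have h1 := Complex.differentiable_one_div_Gamma
      exact h1.differentiableAt.comp s (by fun_prop)
  have hcast : ∀ s : ℝ, ∀ u ∈ Ioi (0 : ℝ), ((u : ℂ) ^ ((s : ℂ) - 1)) • f u
      = ((u ^ (s - 1) * mWright β u : ℝ) : ℂ) := by
    intro s u hu
    rw [Complex.ofReal_mul, Complex.ofReal_cpow (le_of_lt hu)]
    simp [hf]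
  have hmel : ∀ s : ℝ, mellin f s
      = ((∫ u in Ioi (0 : ℝ), u ^ (s - 1) * mWright β u : ℝ) : ℂ) := by
    intro s
    rw [mellin, setIntegral_congr_fun measurableSet_Ioi (hcast s), integral_complex_ofReal]
  have hgreal : ∀ s : ℝ, g s = ((Real.Gamma s / Real.Gamma (1 + β * (s - 1)) : ℝ) : ℂ) := by
    intro s
    simp only [hg]
    rw [show (1 : ℂ) + β * (s - 1) = ((1 + β * (s - 1) : ℝ) : ℂ) by push_cast; rfl,
      Complex.Gamma_ofReal, Complex.Gamma_ofReal]
    push_cast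
    rfl
  -- The formula holds on the real interval `(0, 1)`, which accumulates at its midpoint `1/2`; both
  -- sides are analytic on `Re s > 0`.
  have hfreq : ∃ᶠ s in 𝓝[≠] ((1 / 2 : ℝ) : ℂ), mellin f s = g s := by
    have hlim : Tendsto (fun t : ℝ => (t : ℂ)) (𝓝[≠] (1 / 2)) (𝓝[≠] ((1 / 2 : ℝ) : ℂ)) := by
      refine tendsto_nhdsWithin_iff.2 ⟨?_, ?_⟩
      · exact (Complex.continuous_ofReal.tendsto _).mono_left nhdsWithin_le_nhds
      · filter_upwards [self_mem_nhdsWithin] with t ht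
        simpa only [mem_compl_iff, mem_singleton_iff, Complex.ofReal_inj] using ht
    have hev : ∀ᶠ t : ℝ in 𝓝[≠] (1 / 2), mellin f t = g t := by
      have : ∀ᶠ t : ℝ in 𝓝 (1 / 2), t ∈ Ioo (0 : ℝ) 1 := Ioo_mem_nhds (by norm_num) (by norm_num)
      filter_upwards [nhdsWithin_le_nhds this] with t ht
      rw [hmel, hgreal, h.mellin_mWright_of_lt_one ht.1 ht.2]
    exact hlim.frequently hev.frequently
  have hmem : ∀ s : ℝ, 0 < s → (s : ℂ) ∈ U := fun s hs => by
    change 0 < ((s : ℂ)).re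
    simpa using hs
  have heq := hA.eqOn_of_preconnected_of_frequently_eq hG hUc (hmem _ one_half_pos) hfreq
    (hmem (1 + p) (by linarith))
  rw [hmel, hgreal] at heq
  have hconv := (mellinConvergent_mWright hβ hβ1 (hmem (1 + p) (by linarith))).1
  have h2 : IntegrableOn (fun u : ℝ => ((u ^ (1 + p - 1) * mWright β u : ℝ) : ℂ)) (Ioi 0) :=
    hconv.congr_fun (hcast (1 + p)) measurableSet_Ioi
  simp only [add_sub_cancel_left] at heq h2
  exact ⟨by simpa [IntegrableOn] using h2.re, by exact_mod_cast heq⟩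

/-! ### The M-Wright distribution -/

/-- Nonnegativity comes from comparing masses. The law truncates the density at zero, so its being a
probability measure says that the positive part integrates to `1`. The zeroth moment says that the
signed integral is also `1`, hence the negative part vanishes almost everywhere. -/
theorem mWright_nonneg_ae {β : ℝ} (hβ : 0 < β) (hβ1 : β < 1)
    [IsProbabilityMeasure (mWrightLaw β)] :
    ∀ᵐ u ∂(volume.restrict (Ioi (0 : ℝ))), 0 ≤ mWright β u := by
  obtain ⟨hi, hv⟩ := integral_rpow_mul_mWright hβ hβ1 (p := 0) (by norm_num)
  simp only [Real.rpow_zero, one_mul, mul_zero, add_zero, Real.Gamma_one, div_one] at hi hv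
  have h1 : ∫⁻ u in Ioi (0 : ℝ), ENNReal.ofReal (mWright β u) = 1 := by
    have := measure_univ (μ := mWrightLaw β)
    rwa [mWrightLaw, if_neg hβ1.ne, withDensity_apply _ MeasurableSet.univ,
      Measure.restrict_univ] at this
  have h2 := integral_eq_lintegral_pos_part_sub_lintegral_neg_part hi
  rw [hv, h1] at h2
  have hfin : ∫⁻ u in Ioi (0 : ℝ), ENNReal.ofReal (-mWright β u) ≠ ⊤ := by
    have := hi.neg.lintegral_lt_top
    simpa using this.ne
  have h3 : ∫⁻ u in Ioi (0 : ℝ), ENNReal.ofReal (-mWright β u) = 0 := by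
    have : (∫⁻ u in Ioi (0 : ℝ), ENNReal.ofReal (-mWright β u)).toReal = 0 := by
      simp only [ENNReal.toReal_one] at h2
      linarith
    exact (ENNReal.toReal_eq_zero_iff _).1 this |>.resolve_right hfin
  have hm : AEMeasurable (fun u => ENNReal.ofReal (-mWright β u)) (volume.restrict (Ioi (0 : ℝ))) :=
    hi.aestronglyMeasurable.aemeasurable.neg.ennreal_ofReal
  filter_upwards [(lintegral_eq_zero_iff' hm).1 h3] with u hu
  simpa using hu

theorem mWrightLaw_ae_pos {β : ℝ} : ∀ᵐ y ∂(mWrightLaw β), 0 < y := by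
  rw [mWrightLaw]
  split_ifs with h
  · rw [ae_dirac_iff measurableSet_Ioi]; norm_num
  · exact (withDensity_absolutelyContinuous _ _).ae_le (ae_restrict_mem measurableSet_Ioi)

/-- The moments of the M-Wright distribution. -/
theorem integral_rpow_mWrightLaw {β p : ℝ} (hβ : 0 < β) (hβ1 : β ≤ 1)
    [IsProbabilityMeasure (mWrightLaw β)] (hp : 0 ≤ p) :
    Integrable (fun y : ℝ => y ^ p) (mWrightLaw β) ∧
    ∫ y, y ^ p ∂(mWrightLaw β) = Real.Gamma (1 + p) / Real.Gamma (1 + β * p) := by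
  rcases hβ1.eq_or_lt with rfl | hlt
  · rw [mWrightLaw, if_pos rfl]
    refine ⟨integrable_dirac (by simp), ?_⟩
    rw [integral_dirac, Real.one_rpow, one_mul,
      div_self (Real.Gamma_pos_of_pos (by linarith)).ne']
  · have hnn := mWright_nonneg_ae hβ hlt
    obtain ⟨hi, hv⟩ := integral_rpow_mul_mWright hβ hlt (p := p) (by linarith)
    obtain ⟨hi0, -⟩ := integral_rpow_mul_mWright hβ hlt (p := 0) (by norm_num)
    simp only [Real.rpow_zero, one_mul] at hi0
    have hm : AEMeasurable (fun u => (mWright β u).toNNReal) (volume.restrict (Ioi (0 : ℝ))) :=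
      hi0.aestronglyMeasurable.aemeasurable.real_toNNReal
    have hlaw : mWrightLaw β = (volume.restrict (Ioi 0)).withDensity
        fun u => ((mWright β u).toNNReal : ℝ≥0∞) := by
      rw [mWrightLaw, if_neg hlt.ne]; rfl
    have hae : (fun u => (mWright β u).toNNReal • u ^ p)
        =ᵐ[volume.restrict (Ioi (0 : ℝ))] fun u => u ^ p * mWright β u := by
      filter_upwards [hnn] with u hu
      rw [NNReal.smul_def, Real.coe_toNNReal _ hu, smul_eq_mul, mul_comm]
    rw [hlaw]
    refine ⟨(integrable_withDensity_iff_integrable_smul₀ hm).2 (hi.congr hae.symm), ?_⟩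
    rw [integral_withDensity_eq_integral_smul₀ hm, integral_congr_ae hae, hv]

/-! ### Exponential moments of the M-Wright distribution -/

/-- Keep only `t > R` in the Gamma integral, where `t^x ≥ R^x`. -/
theorem rpow_mul_exp_neg_le_Gamma {R x : ℝ} (hR : 0 < R) (hx : 0 ≤ x) :
    R ^ x * Real.exp (-R) ≤ Real.Gamma (x + 1) := by
  rw [Real.Gamma_eq_integral (by linarith), add_sub_cancel_right, ← integral_exp_neg_Ioi R,
    ← integral_const_mul]
  have hI : IntegrableOn (fun t : ℝ => Real.exp (-t) * t ^ x) (Ioi 0) := by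
    simpa using Real.GammaIntegral_convergent (s := x + 1) (by linarith)
  refine (setIntegral_mono_on ((integrableOn_exp_neg_Ioi R).const_mul _)
    (hI.mono_set (Ioi_subset_Ioi hR.le)) measurableSet_Ioi fun t ht => ?_).trans
    (setIntegral_mono_set hI ?_ (Ioi_subset_Ioi hR.le).eventuallyLE)
  · rw [mul_comm]
    exact mul_le_mul_of_nonneg_left (Real.rpow_le_rpow hR.le (le_of_lt ht) hx) (Real.exp_pos _).le
  · refine (ae_restrict_iff' measurableSet_Ioi).2 (Eventually.of_forall fun t ht => ?_)
    exact mul_nonneg (Real.exp_pos _).le (Real.rpow_nonneg (le_of_lt ht) _)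

theorem summable_mittagLeffler {β a : ℝ} (hβ : 0 < β) (ha : 0 ≤ a) :
    Summable fun n : ℕ => a ^ n / Real.Gamma (β * n + 1) := by
  -- Here `R^β = 2 (a + 1)`, so the Gamma lower bound dominates the terms by `e^R 2^(-n)`.
  set R : ℝ := (2 * (a + 1)) ^ (1 / β) with hR
  have hR0 : 0 < R := by positivity
  have hRβ : R ^ β = 2 * (a + 1) := by
    rw [hR, ← Real.rpow_mul (by positivity), one_div_mul_cancel hβ.ne', Real.rpow_one]
  have hgeom : Summable fun n : ℕ => Real.exp R * (1 / 2 : ℝ) ^ n :=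
    (summable_geometric_of_lt_one (by norm_num) (by norm_num)).mul_left _
  refine Summable.of_nonneg_of_le (fun n => ?_) (fun n => ?_) hgeom
  · have : 0 < Real.Gamma (β * n + 1) := Real.Gamma_pos_of_pos (by positivity)
    positivity
  · have h1 := rpow_mul_exp_neg_le_Gamma hR0 (by positivity : 0 ≤ β * (n : ℝ))
    rw [Real.rpow_mul hR0.le, hRβ, Real.rpow_natCast] at h1
    have hG : 0 < Real.Gamma (β * n + 1) := Real.Gamma_pos_of_pos (by positivity)
    rw [div_le_iff₀ hG]
    calc a ^ n ≤ (a + 1) ^ n := pow_le_pow_left₀ ha (by linarith) n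
      _ = Real.exp R * (1 / 2) ^ n * ((2 * (a + 1)) ^ n * Real.exp (-R)) := by
          rw [mul_pow, Real.exp_neg, div_pow, one_pow]
          field_simp
      _ ≤ _ := mul_le_mul_of_nonneg_left h1 (by positivity)

theorem one_le_mittagLeffler {β a : ℝ} (hβ : 0 < β) (ha : 0 ≤ a) : 1 ≤ mittagLeffler β a := by
  have h := (summable_mittagLeffler hβ ha).le_tsum 0 (fun n _ => by
    have : 0 < Real.Gamma (β * n + 1) := Real.Gamma_pos_of_pos (by positivity)
    positivity)
  simpa [mittagLeffler] using h

theorem hasSum_exp (y : ℝ) : HasSum (fun n : ℕ => y ^ n / n.factorial) (Real.exp y) := by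
  rw [Real.exp_eq_exp_ℝ]
  exact NormedSpace.expSeries_div_hasSum_exp y

/-- The `n`-th moment is `n! / Γ(β n + 1)`, so the exponential series integrates termwise to the
Mittag-Leffler series. -/
theorem integral_exp_mWrightLaw {β a : ℝ} (hβ : 0 < β) (hβ1 : β ≤ 1)
    [IsProbabilityMeasure (mWrightLaw β)] (ha : 0 ≤ a) :
    ∫ y, Real.exp (a * y) ∂(mWrightLaw β) = mittagLeffler β a := by
  have hmom : ∀ n : ℕ, Integrable (fun y : ℝ => y ^ n) (mWrightLaw β) ∧
      ∫ y, y ^ n ∂(mWrightLaw β) = n.factorial / Real.Gamma (β * n + 1) := by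
    intro n
    have := integral_rpow_mWrightLaw hβ hβ1 (p := n) (Nat.cast_nonneg n)
    simp only [Real.rpow_natCast] at this
    rwa [add_comm 1 (n : ℝ), Real.Gamma_nat_eq_factorial, add_comm 1 (β * n)] at this
  have hnorm : ∀ n : ℕ, ∫ y, ‖(a * y) ^ n / n.factorial‖ ∂(mWrightLaw β)
      = a ^ n / Real.Gamma (β * n + 1) := by
    intro n
    have : ∀ᵐ y ∂(mWrightLaw β), ‖(a * y) ^ n / (n.factorial : ℝ)‖
        = a ^ n / n.factorial * y ^ n := by
      filter_upwards [mWrightLaw_ae_pos] with y hy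
      rw [Real.norm_of_nonneg (by positivity), mul_pow]
      ring
    rw [integral_congr_ae this, integral_const_mul, (hmom n).2]
    field_simp
  have hint : ∀ n : ℕ, ∫ y, (a * y) ^ n / n.factorial ∂(mWrightLaw β)
      = a ^ n / Real.Gamma (β * n + 1) := by
    intro n
    rw [← hnorm n]
    refine integral_congr_ae ?_
    filter_upwards [mWrightLaw_ae_pos] with y hy
    rw [Real.norm_of_nonneg (by positivity)]
  have hI : ∀ n : ℕ, Integrable (fun y : ℝ => (a * y) ^ n / n.factorial) (mWrightLaw β) := by
    intro n
    simp_rw [mul_pow]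
    exact ((hmom n).1.const_mul _).div_const _
  have := hasSum_integral_of_summable_integral_norm hI
    (by simp_rw [hnorm]; exact summable_mittagLeffler hβ ha)
  simp_rw [hint, (hasSum_exp _).tsum_eq] at this
  exact this.tsum_eq.symm

theorem integrable_exp_mWrightLaw {β : ℝ} (hβ : 0 < β) (hβ1 : β ≤ 1)
    [IsProbabilityMeasure (mWrightLaw β)] (x a : ℝ) :
    Integrable (fun y => Real.exp (x * √y + a * y)) (mWrightLaw β) := by
  have h1 : Integrable (fun y => Real.exp ((|x| + |a|) * y)) (mWrightLaw β) := by
    -- A nonintegrable function has Bochner integral `0`, whereas this integral is a Mittag-Leffler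
    -- value, at least `1`.
    refine Integrable.of_integral_ne_zero ?_
    rw [integral_exp_mWrightLaw hβ hβ1 (by positivity)]
    have := one_le_mittagLeffler hβ (by positivity : 0 ≤ |x| + |a|)
    linarith
  refine Integrable.mono' (h1.const_mul (Real.exp |x|)) (by fun_prop) ?_
  filter_upwards [mWrightLaw_ae_pos] with y hy
  rw [Real.norm_of_nonneg (Real.exp_pos _).le, ← Real.exp_add, Real.exp_le_exp]
  have h2 : √y ≤ 1 + y := by
    rw [Real.sqrt_le_left (by linarith)]
    nlinarith
  have h3 : x * √y ≤ |x| * (1 + y) :=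
    (mul_le_mul_of_nonneg_right (le_abs_self x) (Real.sqrt_nonneg y)).trans
      (mul_le_mul_of_nonneg_left h2 (abs_nonneg x))
  have h4 : a * y ≤ |a| * y := mul_le_mul_of_nonneg_right (le_abs_self a) hy.le
  linarith

/-- The Gamma quotients are the moments of order `k / 2`, that is, the moments of `√Y`. -/
theorem zetaSeries_eq_integral {β : ℝ} (hβ : 0 < β) (hβ1 : β ≤ 1)
    [IsProbabilityMeasure (mWrightLaw β)] (H η x : ℝ) :
    zetaSeries β H η x = ∫ y, Real.exp (η * cConst H * x * √y) ∂(mWrightLaw β) := by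
  set r : ℝ := η * cConst H * x with hr
  have hsq : ∀ k : ℕ, ∀ᵐ y ∂(mWrightLaw β), √y ^ k = y ^ ((k : ℝ) / 2) := by
    intro k
    filter_upwards [mWrightLaw_ae_pos] with y hy
    rw [Real.sqrt_eq_rpow, ← Real.rpow_natCast, ← Real.rpow_mul hy.le]
    congr 1; ring
  have hint : ∀ k : ℕ, ∫ y, (r * √y) ^ k / k.factorial ∂(mWrightLaw β)
      = (η * cConst H) ^ k / k.factorial
        * (Real.Gamma (1 + k / 2) / Real.Gamma (1 + β * k / 2)) * x ^ k := by
    intro k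
    have : ∀ᵐ y ∂(mWrightLaw β), (r * √y) ^ k / (k.factorial : ℝ)
        = r ^ k / k.factorial * y ^ ((k : ℝ) / 2) := by
      filter_upwards [hsq k] with y hy
      rw [mul_pow, hy]; ring
    rw [integral_congr_ae this, integral_const_mul,
      (integral_rpow_mWrightLaw hβ hβ1 (by positivity)).2, hr, mul_pow, mul_div_assoc β]
    ring
  have key : HasSum (fun k : ℕ => ∫ y, (r * √y) ^ k / k.factorial ∂(mWrightLaw β))
      (∫ y, Real.exp (r * √y) ∂(mWrightLaw β)) := by
    refine hasSum_integral_of_dominated_convergence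
      (fun k y => (|r| * √y) ^ k / k.factorial) (fun k => ?_) (fun k => ?_) ?_ ?_ ?_
    · exact Measurable.aestronglyMeasurable (by fun_prop)
    · refine Eventually.of_forall fun y => ?_
      rw [norm_div, norm_pow, norm_mul, Real.norm_eq_abs, Real.norm_of_nonneg (Real.sqrt_nonneg y),
        Real.norm_of_nonneg (by positivity)]
    · exact Eventually.of_forall fun y => (hasSum_exp _).summable
    · simp_rw [(hasSum_exp _).tsum_eq]
      simpa using integrable_exp_mWrightLaw hβ hβ1 |r| 0
    · exact Eventually.of_forall fun y => hasSum_exp _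
  simp_rw [hint] at key
  exact key.tsum_eq

/-! ### Exponential tilting and square roots -/

/-- A two-sided exponential which at the origin is at most `c` crosses the level `c` at most once
on the half line. -/
theorem exists_sign_change {x k l c : ℝ} (hk : 0 ≤ k) (hl : 0 ≤ l) (h0 : k + l ≤ c) :
    (∀ z, 0 ≤ z → k * Real.exp (x * z) + l * Real.exp (-x * z) ≤ c) ∨
    ∃ z₀, 0 ≤ z₀ ∧ (∀ z, 0 ≤ z → z < z₀ → k * Real.exp (x * z) + l * Real.exp (-x * z) ≤ c) ∧
      ∀ z, z₀ < z → c ≤ k * Real.exp (x * z) + l * Real.exp (-x * z) := by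
  set φ : ℝ → ℝ := fun z => k * Real.exp (x * z) + l * Real.exp (-x * z) with hφ
  have hconv : ConvexOn ℝ univ φ := by
    have h1 : ∀ r : ℝ, ConvexOn ℝ univ fun z : ℝ => Real.exp (r * z) := fun r =>
      convexOn_exp.comp_linearMap (LinearMap.mul ℝ ℝ r)
    exact ((h1 x).smul hk).add ((h1 (-x)).smul hl)
  have hφ0 : φ 0 ≤ c := by simpa [hφ] using h0
  by_cases hS : ∃ z, 0 ≤ z ∧ c < φ z
  · right
    set S : Set ℝ := {z | 0 ≤ z ∧ c < φ z} with hSdef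
    have hne : S.Nonempty := hS
    have hbdd : BddBelow S := ⟨0, fun z hz => hz.1⟩
    refine ⟨sInf S, le_csInf hne fun z hz => hz.1, fun z hz0 hz => ?_, fun z hz => ?_⟩
    · by_contra hcon
      exact absurd (csInf_le hbdd (show z ∈ S from ⟨hz0, not_le.1 hcon⟩)) (not_le.2 hz)
    · obtain ⟨s, hs, hsz⟩ := exists_lt_of_csInf_lt hne hz
      -- A convex function exceeding `c` at `s` between `0` and `z` must do so at an endpoint, and
      -- `0` is excluded.
      have h2 := hconv.le_max_of_mem_Icc (mem_univ 0) (mem_univ z) ⟨hs.1, hsz.le⟩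
      rcases le_max_iff.1 h2 with h3 | h3
      · exact absurd (h3.trans hφ0) (not_le.2 hs.2)
      · exact hs.2.le.trans h3
  · left
    intro z hz
    by_contra hcon
    exact hS ⟨z, hz, not_le.1 hcon⟩

/-- The graph of the square root lies below its tangent at `u`. -/
theorem sqrt_le_sqrt_add {g u : ℝ} (hg : 0 ≤ g) (hu : 0 < u) :
    √g ≤ √u + (g / √u - √u) / 2 := by
  have hp : 0 < √u := Real.sqrt_pos.2 hu
  have h1 : √u + (g / √u - √u) / 2 = ((√u) ^ 2 + (√g) ^ 2) / (2 * √u) := by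
    rw [Real.sq_sqrt hg]; field_simp; ring
  rw [h1, le_div_iff₀ (by positivity)]
  nlinarith [sq_nonneg (√u - √g)]

/-- Let `ν` be the law tilted by `exp (a Z²)`, and let `p²`, `q²` be the `ν`-means of `exp (± x Z)`.
Tangent lines at `p²` and `q²` reduce the claim to `g₁ / p + g₂ / q ≤ p + q`. The function `exp (x
z) / p + exp (-x z) / q - (p + q)` has `ν`-mean zero by the choice of `p`, `q`. It is convex and
nonpositive at the origin, so on the half line it changes sign at most once, upwards, and untilting
lowers its mean. -/
theorem sqrt_integral_exp_tilt {α : Type*} [MeasurableSpace α] {μ : Measure α}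
    [IsProbabilityMeasure μ] {Z : α → ℝ} (hZ : ∀ᵐ y ∂μ, 0 ≤ Z y)
    (hI : ∀ x a : ℝ, Integrable (fun y => Real.exp (x * Z y + a * Z y ^ 2)) μ)
    {a : ℝ} (ha : 0 ≤ a) (x : ℝ) :
    √(∫ y, Real.exp (a * Z y ^ 2) ∂μ)
        * (√(∫ y, Real.exp (x * Z y) ∂μ) + √(∫ y, Real.exp (-x * Z y) ∂μ))
      ≤ √(∫ y, Real.exp (x * Z y + a * Z y ^ 2) ∂μ)
        + √(∫ y, Real.exp (-x * Z y + a * Z y ^ 2) ∂μ) := by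
  have hIx : ∀ x : ℝ, Integrable (fun y => Real.exp (x * Z y)) μ := fun x => by simpa using hI x 0
  have hIa : Integrable (fun y => Real.exp (a * Z y ^ 2)) μ := by simpa using hI 0 a
  set A := ∫ y, Real.exp (a * Z y ^ 2) ∂μ with hA
  set f₁ := ∫ y, Real.exp (x * Z y + a * Z y ^ 2) ∂μ with hf₁
  set f₂ := ∫ y, Real.exp (-x * Z y + a * Z y ^ 2) ∂μ with hf₂
  set g₁ := ∫ y, Real.exp (x * Z y) ∂μ with hg₁
  set g₂ := ∫ y, Real.exp (-x * Z y) ∂μ with hg₂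
  have hA0 : 0 < A := integral_exp_pos hIa
  have hu₁ : 0 < f₁ / A := div_pos (integral_exp_pos (hI _ _)) hA0
  have hu₂ : 0 < f₂ / A := div_pos (integral_exp_pos (hI _ _)) hA0
  have hg₁0 : 0 ≤ g₁ := (integral_exp_pos (hIx _)).le
  have hg₂0 : 0 ≤ g₂ := (integral_exp_pos (hIx _)).le
  set p := √(f₁ / A) with hp
  set q := √(f₂ / A) with hq
  have hp0 : 0 < p := Real.sqrt_pos.2 hu₁
  have hq0 : 0 < q := Real.sqrt_pos.2 hu₂
  have hf₁p : f₁ = A * p ^ 2 := by rw [hp, Real.sq_sqrt hu₁.le]; field_simp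
  have hf₂q : f₂ = A * q ^ 2 := by rw [hq, Real.sq_sqrt hu₂.le]; field_simp
  have hcomb : ∀ k l : ℝ, ∫ y, Real.exp (a * Z y ^ 2)
      * (k * Real.exp (x * Z y) + l * Real.exp (-x * Z y)) ∂μ = k * f₁ + l * f₂ := by
    intro k l
    rw [hf₁, hf₂, ← integral_const_mul, ← integral_const_mul,
      ← integral_add ((hI _ _).const_mul _) ((hI _ _).const_mul _)]
    refine integral_congr_ae (Eventually.of_forall fun y => ?_)
    simp only [Real.exp_add]
    ring
  have hcombI : ∀ k l : ℝ, Integrable (fun y => Real.exp (a * Z y ^ 2)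
      * (k * Real.exp (x * Z y) + l * Real.exp (-x * Z y))) μ := by
    intro k l
    refine (((hI x a).const_mul k).add ((hI (-x) a).const_mul l)).congr
      (Eventually.of_forall fun y => ?_)
    simp only [Pi.add_apply, Real.exp_add]
    ring
  -- Cauchy-Schwarz for `exp (x Z)` and its reciprocal under the tilted law, obtained here from `(q
  -- / p) t + (p / q) / t ≥ 2`. It makes the crossing function nonpositive at `0`.
  have hpq : 1 ≤ p * q := by
    have h1 : ∫ y, Real.exp (a * Z y ^ 2) * 2 ∂μ ≤ ∫ y, Real.exp (a * Z y ^ 2)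
        * (q / p * Real.exp (x * Z y) + p / q * Real.exp (-x * Z y)) ∂μ := by
      refine integral_mono (hIa.mul_const _) (hcombI _ _) fun y => ?_
      refine mul_le_mul_of_nonneg_left ?_ (Real.exp_pos _).le
      have e : Real.exp (-x * Z y) = (Real.exp (x * Z y))⁻¹ := by
        rw [← Real.exp_neg]; congr 1; ring
      rw [e]
      set t := Real.exp (x * Z y)
      have ht : 0 < t := Real.exp_pos _
      have : q / p * t + p / q * t⁻¹ - 2 = (q * t - p) ^ 2 / (p * q * t) := by
        field_simp; ring
      have h2 : 0 ≤ (q * t - p) ^ 2 / (p * q * t) := by positivity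
      linarith
    rw [hcomb, integral_mul_const, hf₁p, hf₂q] at h1
    have h2 : q / p * (A * p ^ 2) + p / q * (A * q ^ 2) = A * (2 * (p * q)) := by
      field_simp; ring
    rw [h2] at h1
    have := le_of_mul_le_mul_left h1 hA0
    linarith
  have hφ0 : p⁻¹ + q⁻¹ ≤ p + q := by
    have h1 : p⁻¹ + q⁻¹ = (p + q) / (p * q) := by field_simp; ring
    rw [h1]
    exact div_le_self (by positivity) hpq
  have hmain : g₁ / p + g₂ / q ≤ p + q := by
    have hsumI : Integrable
        (fun y => p⁻¹ * Real.exp (x * Z y) + q⁻¹ * Real.exp (-x * Z y)) μ :=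
      ((hIx x).const_mul _).add ((hIx (-x)).const_mul _)
    have hφint : ∫ y, (p⁻¹ * Real.exp (x * Z y) + q⁻¹ * Real.exp (-x * Z y) - (p + q)) ∂μ
        = g₁ / p + g₂ / q - (p + q) := by
      rw [integral_sub hsumI (integrable_const _),
        integral_add ((hIx x).const_mul _) ((hIx (-x)).const_mul _), integral_const_mul,
        integral_const_mul, integral_const, probReal_univ, one_smul, div_eq_inv_mul,
        div_eq_inv_mul]
    have hφI : Integrable
        (fun y => p⁻¹ * Real.exp (x * Z y) + q⁻¹ * Real.exp (-x * Z y) - (p + q)) μ :=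
      hsumI.sub (integrable_const _)
    rcases exists_sign_change (x := x) (inv_pos.2 hp0).le (inv_pos.2 hq0).le hφ0 with
      hle | ⟨z₀, hz₀, hlt, hgt⟩
    · have : ∫ y, (p⁻¹ * Real.exp (x * Z y) + q⁻¹ * Real.exp (-x * Z y) - (p + q)) ∂μ ≤ 0 := by
        refine integral_nonpos_of_ae ?_
        filter_upwards [hZ] with y hy
        have := hle (Z y) hy
        simp only [Pi.zero_apply]
        linarith
      linarith
    · have hwI : Integrable (fun y => Real.exp (a * Z y ^ 2) * (p⁻¹ * Real.exp (x * Z y)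
          + q⁻¹ * Real.exp (-x * Z y)) - Real.exp (a * Z y ^ 2) * (p + q)) μ :=
        (hcombI _ _).sub (hIa.mul_const _)
      have hw0 : ∫ y, (Real.exp (a * Z y ^ 2) * (p⁻¹ * Real.exp (x * Z y)
          + q⁻¹ * Real.exp (-x * Z y)) - Real.exp (a * Z y ^ 2) * (p + q)) ∂μ = 0 := by
        rw [integral_sub (hcombI _ _) (hIa.mul_const _), hcomb, integral_mul_const, hf₁p, hf₂q]
        field_simp
        ring
      -- Normalised to equal `1` at `z₀`, the increasing weight is at most `1` where the function is
      -- nonpositive and at least `1` where it is nonnegative, so inserting it can only increase the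
      -- integrand.
      have hle : ∫ y, (p⁻¹ * Real.exp (x * Z y) + q⁻¹ * Real.exp (-x * Z y) - (p + q)) ∂μ
          ≤ ∫ y, (Real.exp (a * z₀ ^ 2))⁻¹ * (Real.exp (a * Z y ^ 2) * (p⁻¹ * Real.exp (x * Z y)
          + q⁻¹ * Real.exp (-x * Z y)) - Real.exp (a * Z y ^ 2) * (p + q)) ∂μ := by
        refine integral_mono_ae hφI (hwI.const_mul _) ?_
        filter_upwards [hZ] with y hy
        set d := p⁻¹ * Real.exp (x * Z y) + q⁻¹ * Real.exp (-x * Z y) - (p + q) with hd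
        have e : (Real.exp (a * z₀ ^ 2))⁻¹ * (Real.exp (a * Z y ^ 2) * (p⁻¹ * Real.exp (x * Z y)
            + q⁻¹ * Real.exp (-x * Z y)) - Real.exp (a * Z y ^ 2) * (p + q))
            = Real.exp (a * Z y ^ 2 - a * z₀ ^ 2) * d := by
          rw [Real.exp_sub, hd]; ring
        rw [e]
        rcases lt_trichotomy (Z y) z₀ with h | h | h
        · have h1 : d ≤ 0 := sub_nonpos.2 (hlt _ hy h)
          have h2 : Real.exp (a * Z y ^ 2 - a * z₀ ^ 2) ≤ 1 := by
            rw [Real.exp_le_one_iff, sub_nonpos]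
            exact mul_le_mul_of_nonneg_left (pow_le_pow_left₀ hy h.le 2) ha
          simpa using mul_le_mul_of_nonpos_right h2 h1
        · rw [h]; simp
        · have h1 : 0 ≤ d := sub_nonneg.2 (hgt _ h)
          have h2 : 1 ≤ Real.exp (a * Z y ^ 2 - a * z₀ ^ 2) := by
            rw [Real.one_le_exp_iff, sub_nonneg]
            exact mul_le_mul_of_nonneg_left (pow_le_pow_left₀ hz₀ h.le 2) ha
          exact le_mul_of_one_le_left h1 h2
      rw [integral_const_mul, hw0, mul_zero, hφint] at hle
      linarith
  have hfinal : √g₁ + √g₂ ≤ p + q := by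
    have h1 := sqrt_le_sqrt_add hg₁0 hu₁
    have h2 := sqrt_le_sqrt_add hg₂0 hu₂
    rw [← hp] at h1
    rw [← hq] at h2
    linarith
  calc √A * (√g₁ + √g₂) ≤ √A * (p + q) := mul_le_mul_of_nonneg_left hfinal (Real.sqrt_nonneg _)
    _ = √f₁ + √f₂ := by
      rw [hf₁p, hf₂q, Real.sqrt_mul hA0.le, Real.sqrt_mul hA0.le, Real.sqrt_sq hp0.le,
        Real.sqrt_sq hq0.le]
      ring

/-! ### Wiener integrals -/

theorem eLpNorm_two_eq_ofReal_sqrt {α : Type*} [MeasurableSpace α] {μ : Measure α} {f : α → ℝ}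
    (hf : MemLp f 2 μ) : eLpNorm f 2 μ = ENNReal.ofReal √(∫ x, f x ^ 2 ∂μ) := by
  rw [hf.eLpNorm_eq_integral_rpow_norm two_ne_zero ENNReal.ofNat_ne_top, Real.sqrt_eq_rpow]
  simp

theorem integral_sub_sq {α : Type*} [MeasurableSpace α] {μ : Measure α} {f g : α → ℝ}
    (hf : MemLp f 2 μ) (hg : MemLp g 2 μ) : ∫ x, (f x - g x) ^ 2 ∂μ
      = ∫ x, f x * f x ∂μ - 2 * ∫ x, f x * g x ∂μ + ∫ x, g x * g x ∂μ := by
  have e : ∀ x, (f x - g x) ^ 2 = (f x * f x - 2 * (f x * g x)) + g x * g x := fun x => by ring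
  simp_rw [e]
  have i1 : Integrable (fun x => f x * f x) μ := hf.integrable_mul hf
  have i2 : Integrable (fun x => 2 * (f x * g x)) μ := (hf.integrable_mul hg).const_mul 2
  have i3 : Integrable (fun x => g x * g x) μ := hg.integrable_mul hg
  rw [integral_add (by exact i1.sub i2) i3, integral_sub i1 i2, integral_const_mul]

theorem volume_inter_Ioc {s s' t t' : ℝ} (hs : s ≤ s') (ht : t ≤ t') :
    (volume (Ioc s s' ∩ Ioc t t')).toReal
      = min s' t' - min s' t - min s t' + min s t := by
  rw [Ioc_inter_Ioc, Real.volume_Ioc, ENNReal.toReal_ofReal']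
  simp only [min_def, max_def]
  split_ifs <;> linarith

namespace StepFun

theorem memLp_eval (φ : StepFun) : MemLp φ.eval 2 (volume.restrict (Ioi 0)) := by
  refine memLp_finsetSum _ fun i _ => ?_
  refine (memLp_indicator_const 2 measurableSet_Ioc (φ.a i) (Or.inr ?_)).restrict _
  simp

theorem memLp_integral (φ : StepFun) {P : Measure Ω} {B : ℝ≥0 → Ω → ℝ}
    (hB : IsPreBrownianReal B P) : MemLp (φ.integral B) 2 P := by
  have h : ∀ t, MemLp (B t) 2 P := fun t =>
    (hB.isGaussianProcess.hasGaussianLaw_eval t).memLp_two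
  exact memLp_finsetSum _ fun i _ => ((h _).sub (h _)).const_mul _

theorem integral_eval_mul_eval (φ ψ : StepFun) :
    ∫ u in Ioi (0 : ℝ), φ.eval u * ψ.eval u
      = ∑ i ∈ Finset.range φ.n, ∑ j ∈ Finset.range ψ.n, φ.a i * ψ.a j *
        (min (φ.t (i + 1) : ℝ) (ψ.t (j + 1)) - min (φ.t (i + 1) : ℝ) (ψ.t j)
          - min (φ.t i : ℝ) (ψ.t (j + 1)) + min (φ.t i : ℝ) (ψ.t j)) := by
  have h1 : ∀ u, φ.eval u * ψ.eval u = ∑ i ∈ Finset.range φ.n, ∑ j ∈ Finset.range ψ.n,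
      (Ioc (φ.t i : ℝ) (φ.t (i + 1)) ∩ Ioc (ψ.t j : ℝ) (ψ.t (j + 1))).indicator
        (fun _ => φ.a i * ψ.a j) u := by
    intro u
    rw [StepFun.eval, StepFun.eval, Finset.sum_mul_sum]
    simp_rw [inter_indicator_mul]
  have hfin : ∀ i j, IntegrableOn
      ((Ioc (φ.t i : ℝ) (φ.t (i + 1)) ∩ Ioc (ψ.t j : ℝ) (ψ.t (j + 1))).indicator
        (fun _ => φ.a i * ψ.a j)) (Ioi 0) := by
    intro i j
    refine Integrable.integrableOn ((integrable_indicator_iff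
      (measurableSet_Ioc.inter measurableSet_Ioc)).2 (integrableOn_const ?_))
    exact ((measure_mono inter_subset_left).trans_lt (by simp)).ne
  simp_rw [h1]
  rw [integral_finsetSum _ fun i _ => integrable_finsetSum _ fun j _ => hfin i j]
  refine Finset.sum_congr rfl fun i _ => ?_
  rw [integral_finsetSum _ fun j _ => hfin i j]
  refine Finset.sum_congr rfl fun j _ => ?_
  have hsub : Ioc (φ.t i : ℝ) (φ.t (i + 1)) ∩ Ioc (ψ.t j : ℝ) (ψ.t (j + 1)) ⊆ Ioi 0 :=
    fun u hu => lt_of_le_of_lt (φ.t i).2 hu.1.1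
  rw [setIntegral_indicator (measurableSet_Ioc.inter measurableSet_Ioc),
    inter_eq_self_of_subset_right hsub, setIntegral_const, smul_eq_mul, Measure.real,
    volume_inter_Ioc (NNReal.coe_le_coe.2 (φ.mono (Nat.le_succ i)))
      (NNReal.coe_le_coe.2 (ψ.mono (Nat.le_succ j)))]
  ring

/-- Since `E[B_s B_t] = min s t`, the covariance of two increments is the length of the overlap of
their time intervals. -/
theorem integral_integral_mul_integral (φ ψ : StepFun) {P : Measure Ω} [IsProbabilityMeasure P]
    {B : ℝ≥0 → Ω → ℝ} (hB : IsPreBrownianReal B P) :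
    ∫ ω, φ.integral B ω * ψ.integral B ω ∂P = ∫ u in Ioi (0 : ℝ), φ.eval u * ψ.eval u := by
  have hL : ∀ t, MemLp (B t) 2 P := fun t =>
    (hB.isGaussianProcess.hasGaussianLaw_eval t).memLp_two
  have hI : ∀ s t, Integrable (fun ω => B s ω * B t ω) P := fun s t => (hL s).integrable_mul (hL t)
  have hmin : ∀ s t, ∫ ω, B s ω * B t ω ∂P = min (s : ℝ) t := by
    intro s t
    have h := hB.covariance_eval s t
    rw [covariance_eq_sub (hL s) (hL t), hB.integral_eval, hB.integral_eval, mul_zero,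
      sub_zero] at h
    rw [← NNReal.coe_min, ← h]
    rfl
  have hIΔ : ∀ s s' t t', Integrable (fun ω => (B s' ω - B s ω) * (B t' ω - B t ω)) P :=
    fun s s' t t' => ((hL s').sub (hL s)).integrable_mul ((hL t').sub (hL t))
  have hΔ : ∀ s s' t t', ∫ ω, (B s' ω - B s ω) * (B t' ω - B t ω) ∂P
      = min (s' : ℝ) t' - min (s' : ℝ) t - min (s : ℝ) t' + min (s : ℝ) t := by
    intro s s' t t'
    have e : ∀ ω, (B s' ω - B s ω) * (B t' ω - B t ω)
        = (B s' ω * B t' ω - B s' ω * B t ω) - (B s ω * B t' ω - B s ω * B t ω) :=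
      fun ω => by ring
    simp_rw [e]
    have i1 := (hI s' t').sub (hI s' t)
    have i2 := (hI s t').sub (hI s t)
    rw [integral_sub (by exact i1) (by exact i2), integral_sub (hI _ _) (hI _ _),
      integral_sub (hI _ _) (hI _ _), hmin, hmin, hmin, hmin]
    ring
  rw [integral_eval_mul_eval]
  have h1 : ∀ ω, φ.integral B ω * ψ.integral B ω = ∑ i ∈ Finset.range φ.n,
      ∑ j ∈ Finset.range ψ.n, φ.a i * ψ.a j * ((B (φ.t (i + 1)) ω - B (φ.t i) ω)
        * (B (ψ.t (j + 1)) ω - B (ψ.t j) ω)) := by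
    intro ω
    rw [StepFun.integral, StepFun.integral, Finset.sum_mul_sum]
    exact Finset.sum_congr rfl fun i _ => Finset.sum_congr rfl fun j _ => by ring
  simp_rw [h1]
  rw [integral_finsetSum _ fun i _ => integrable_finsetSum _ fun j _ => (hIΔ _ _ _ _).const_mul _]
  refine Finset.sum_congr rfl fun i _ => ?_
  rw [integral_finsetSum _ fun j _ => (hIΔ _ _ _ _).const_mul _]
  refine Finset.sum_congr rfl fun j _ => ?_
  rw [integral_const_mul, hΔ]

/-- The Itô isometry. -/
theorem eLpNorm_integral_sub (φ ψ : StepFun) {P : Measure Ω} [IsProbabilityMeasure P]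
    {B : ℝ≥0 → Ω → ℝ} (hB : IsPreBrownianReal B P) :
    eLpNorm (fun ω => φ.integral B ω - ψ.integral B ω) 2 P
      = eLpNorm (fun u => φ.eval u - ψ.eval u) 2 (volume.restrict (Ioi 0)) := by
  have hφ := φ.memLp_integral hB
  have hψ := ψ.memLp_integral hB
  rw [eLpNorm_two_eq_ofReal_sqrt (by exact hφ.sub hψ),
    eLpNorm_two_eq_ofReal_sqrt (by exact φ.memLp_eval.sub ψ.memLp_eval)]
  congr 2
  rw [integral_sub_sq hφ hψ, integral_sub_sq φ.memLp_eval ψ.memLp_eval,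
    φ.integral_integral_mul_integral φ hB, φ.integral_integral_mul_integral ψ hB,
    ψ.integral_integral_mul_integral ψ hB]

end StepFun

/-! ### Splitting step functions at a time `S`, and the Gaussian law of their integrals. -/

namespace StepFun

/-- The restriction of a step function to `(0, S]`. -/
def below (φ : StepFun) (S : ℝ≥0) : StepFun :=
  ⟨φ.n, fun i => min (φ.t i) S, fun _ _ h => min_le_min_right S (φ.mono h), φ.a⟩

/-- The restriction of a step function to `(S, ∞)`. -/
def above (φ : StepFun) (S : ℝ≥0) : StepFun :=
  ⟨φ.n, fun i => max (φ.t i) S, fun _ _ h => max_le_max_right S (φ.mono h), φ.a⟩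

theorem eval_below (φ : StepFun) (S : ℝ≥0) :
    (φ.below S).eval = (Iic (S : ℝ)).indicator φ.eval := by
  ext u
  simp only [StepFun.eval, below, NNReal.coe_min]
  by_cases hu : u ≤ S
  · rw [indicator_of_mem (show u ∈ Iic (S : ℝ) from hu)]
    refine Finset.sum_congr rfl fun i _ => ?_
    simp only [indicator, mem_Ioc, le_min_iff, min_lt_iff, hu, and_true, not_lt.2 hu, or_false]
  · rw [indicator_of_notMem (show u ∉ Iic (S : ℝ) from hu)]
    refine Finset.sum_eq_zero fun i _ => indicator_of_notMem ?_ _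
    simp only [mem_Ioc, le_min_iff, hu, and_false, not_false_eq_true]

theorem eval_above (φ : StepFun) (S : ℝ≥0) :
    (φ.above S).eval = (Ioi (S : ℝ)).indicator φ.eval := by
  ext u
  simp only [StepFun.eval, above, NNReal.coe_max]
  by_cases hu : (S : ℝ) < u
  · rw [indicator_of_mem (show u ∈ Ioi (S : ℝ) from hu)]
    refine Finset.sum_congr rfl fun i _ => ?_
    simp only [indicator, mem_Ioc, le_max_iff, max_lt_iff, hu, and_true, not_le.2 hu, or_false]
  · rw [indicator_of_notMem (show u ∉ Ioi (S : ℝ) from hu)]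
    refine Finset.sum_eq_zero fun i _ => indicator_of_notMem ?_ _
    simp only [mem_Ioc, max_lt_iff, hu, and_false, false_and, not_false_eq_true]

theorem integral_below_add_integral_above {Ω : Type*} (φ : StepFun) (S : ℝ≥0) (B : ℝ≥0 → Ω → ℝ)
    (ω : Ω) : (φ.below S).integral B ω + (φ.above S).integral B ω = φ.integral B ω := by
  have h : ∀ t, B (min t S) ω + B (max t S) ω = B t ω + B S ω := by
    intro t
    rcases le_total t S with h | h
    · rw [min_eq_left h, max_eq_right h]
    · rw [min_eq_right h, max_eq_left h, add_comm]
  simp only [StepFun.integral, below, above]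
  rw [← Finset.sum_add_distrib]
  refine Finset.sum_congr rfl fun i _ => ?_
  linear_combination (φ.a i) * h (φ.t (i + 1)) - (φ.a i) * h (φ.t i)

theorem measurable_integral_below {Ω : Type*} (φ : StepFun) (S : ℝ≥0)
    (B : ℝ≥0 → Ω → ℝ) :
    Measurable[pastOf B S] ((φ.below S).integral B) := by
  have h : ∀ t, Measurable[pastOf B S] (B (min t S)) := by
    intro t
    refine Measurable.mono (comap_measurable (B (min t S))) ?_ le_rfl
    exact le_iSup₂_of_le (min t S) (by exact_mod_cast min_le_right t S) le_rfl
  exact Finset.measurable_fun_sum _ fun i _ => ((h _).sub (h _)).const_mul _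

theorem measurable_integral_above {Ω : Type*} (φ : StepFun) (S : ℝ≥0)
    (B : ℝ≥0 → Ω → ℝ) :
    Measurable[MeasurableSpace.comap (fun ω t => B (S + t) ω - B S ω) MeasurableSpace.pi]
      ((φ.above S).integral B) := by
  have h : ∀ t, Measurable[MeasurableSpace.comap (fun ω t => B (S + t) ω - B S ω)
      MeasurableSpace.pi] (fun ω => B (max t S) ω - B S ω) := by
    intro t
    have h1 : max t S = S + (max t S - S) := (add_tsub_cancel_of_le (le_max_right t S)).symm
    rw [h1]
    exact (measurable_pi_apply (max t S - S) : Measurable fun f : ℝ≥0 → ℝ =>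
      f (max t S - S)).comp (comap_measurable _)
  refine Finset.measurable_fun_sum _ fun i _ => Measurable.const_mul ?_ _
  have e : (fun ω => B (max (φ.t (i + 1)) S) ω - B (max (φ.t i) S) ω)
      = fun ω => (B (max (φ.t (i + 1)) S) ω - B S ω) - (B (max (φ.t i) S) ω - B S ω) := by
    ext ω; ring
  exact e ▸ (h (φ.t (i + 1))).sub (h (φ.t i))

/-- The integral is a linear functional of the jointly Gaussian vector of increments; the isometry
gives the variance. -/
theorem hasLaw_integral (φ : StepFun) {P : Measure Ω} [IsProbabilityMeasure P]
    {B : ℝ≥0 → Ω → ℝ} (hB : IsPreBrownianReal B P) :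
    HasLaw (φ.integral B)
      (gaussianReal 0 (∫ u in Ioi (0 : ℝ), φ.eval u ^ 2).toNNReal) P := by
  have h1 := (hB.isGaussianProcess.hasGaussianLaw_increments (n := φ.n)
    (t := fun i => φ.t i)).map_fun
    (∑ i : Fin φ.n, φ.a i • ContinuousLinearMap.proj (R := ℝ) (φ := fun _ : Fin φ.n => ℝ) i)
  have h2 : HasGaussianLaw (φ.integral B) P := by
    have e : φ.integral B = fun ω => (∑ i : Fin φ.n, φ.a i • ContinuousLinearMap.proj (R := ℝ)
        (φ := fun _ : Fin φ.n => ℝ) i) fun i => B (φ.t i.succ) ω - B (φ.t i.castSucc) ω := by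
      ext ω
      simp [StepFun.integral, Finset.sum_range]
    rw [e]
    exact h1
  have hm : P[φ.integral B] = 0 := by
    have hI := hB.integrable_eval
    have hD : ∀ s t, Integrable (fun ω => B s ω - B t ω) P := fun s t => (hI s).sub (hI t)
    simp only [StepFun.integral]
    rw [integral_finsetSum _ fun i _ => (hD _ _).const_mul _]
    refine Finset.sum_eq_zero fun i _ => ?_
    rw [integral_const_mul, integral_sub (hI _) (hI _), hB.integral_eval, hB.integral_eval]
    simp
  have hv : Var[φ.integral B; P] = ∫ u in Ioi (0 : ℝ), φ.eval u ^ 2 := by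
    rw [variance_of_integral_eq_zero h2.aemeasurable hm]
    have := φ.integral_integral_mul_integral φ hB
    simp_rw [sq]
    exact this
  refine ⟨h2.aemeasurable, ?_⟩
  rw [h2.map_eq_gaussianReal, hm, hv]

end StepFun

/-- An `L²` limit of `m`-measurable random variables is almost surely `m`-measurable. -/
theorem exists_measurable_of_tendsto_eLpNorm {Ω : Type*} {m₀ : MeasurableSpace Ω} {P : Measure Ω}
    {X : ℕ → Ω → ℝ} {I : Ω → ℝ} (hI : AEStronglyMeasurable I P)
    (h : Tendsto (fun k => eLpNorm (fun ω => I ω - X k ω) 2 P) atTop (𝓝 0))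
    {m : MeasurableSpace Ω} (hm : m ≤ m₀) (hX : ∀ k, Measurable[m] (X k)) :
    ∃ J : Ω → ℝ, Measurable[m] J ∧ I =ᵐ[P] J := by
  have h' : Tendsto (fun k => eLpNorm (X k - I) 2 P) atTop (𝓝 0) := by
    refine h.congr fun k => ?_
    rw [← eLpNorm_neg]
    congr 1
    ext ω
    simp
  have h2 := tendstoInMeasure_of_tendsto_eLpNorm two_ne_zero
    (fun k => ((hX k).mono hm le_rfl).aestronglyMeasurable) hI h'
  obtain ⟨ns, -, hns⟩ := h2.exists_seq_tendsto_ae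
  refine ⟨fun ω => limsup (fun k => X (ns k) ω) atTop, ?_, ?_⟩
  · exact Measurable.limsup fun k => hX (ns k)
  · filter_upwards [hns] with ω hω
    exact hω.limsup_eq.symm

/-! ### Wiener integrals: choice of the approximation, measurability, restriction to the future. -/

namespace IsWienerIntegral

variable {P : Measure Ω} [IsProbabilityMeasure P] {B : ℝ≥0 → Ω → ℝ} {f : ℝ → ℝ} {I : Ω → ℝ}

/-- By the isometry every approximating sequence of the integrand works, not only the one supplied
by the definition. This permits truncated step functions below. -/
theorem tendsto_integral (h : IsWienerIntegral P B f I) (hB : IsPreBrownianReal B P)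
    {φ : ℕ → StepFun}
    (hφ : Tendsto (fun k => eLpNorm (fun u => f u - (φ k).eval u) 2 (volume.restrict (Ioi 0)))
      atTop (𝓝 0)) :
    Tendsto (fun k => eLpNorm (fun ω => I ω - (φ k).integral B ω) 2 P) atTop (𝓝 0) := by
  obtain ⟨ψ, h1, h2⟩ := h.exists_approx
  have h3 := (h2.add (h1.add hφ))
  simp only [add_zero] at h3
  refine tendsto_of_tendsto_of_tendsto_of_le_of_le tendsto_const_nhds h3 (fun _ => zero_le)
    fun k => ?_
  have hψm := (ψ k).memLp_integral hB
  have hφm := (φ k).memLp_integral hB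
  have hf := h.memLp_integrand
  calc eLpNorm (fun ω => I ω - (φ k).integral B ω) 2 P
      = eLpNorm ((fun ω => I ω - (ψ k).integral B ω)
          + fun ω => (ψ k).integral B ω - (φ k).integral B ω) 2 P := by
        congr 1; ext ω; simp
    _ ≤ eLpNorm (fun ω => I ω - (ψ k).integral B ω) 2 P
        + eLpNorm (fun ω => (ψ k).integral B ω - (φ k).integral B ω) 2 P :=
        eLpNorm_add_le (h.memLp.sub hψm).1 (hψm.sub hφm).1 (by norm_num)
    _ = eLpNorm (fun ω => I ω - (ψ k).integral B ω) 2 P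
        + eLpNorm ((fun u => (ψ k).eval u - f u) + fun u => f u - (φ k).eval u) 2
          (volume.restrict (Ioi 0)) := by
        rw [StepFun.eLpNorm_integral_sub _ _ hB]
        congr 2; ext u; simp
    _ ≤ eLpNorm (fun ω => I ω - (ψ k).integral B ω) 2 P
        + (eLpNorm (fun u => (ψ k).eval u - f u) 2 (volume.restrict (Ioi 0))
          + eLpNorm (fun u => f u - (φ k).eval u) 2 (volume.restrict (Ioi 0))) := by
        gcongr
        exact eLpNorm_add_le ((ψ k).memLp_eval.sub hf).1 (hf.sub (φ k).memLp_eval).1 (by norm_num)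
    _ = _ := by
        congr 2
        rw [← eLpNorm_neg]
        congr 1; ext u; simp

theorem approx_indicator {φ : ℕ → StepFun} {s : Set ℝ}
    (hφ : Tendsto (fun k => eLpNorm (fun u => f u - (φ k).eval u) 2 (volume.restrict (Ioi 0)))
      atTop (𝓝 0)) :
    Tendsto (fun k => eLpNorm (fun u => s.indicator f u - s.indicator (φ k).eval u) 2
      (volume.restrict (Ioi 0))) atTop (𝓝 0) := by
  refine tendsto_of_tendsto_of_tendsto_of_le_of_le tendsto_const_nhds hφ (fun _ => zero_le)
    fun k => ?_
  have : (fun u => s.indicator f u - s.indicator (φ k).eval u)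
      = s.indicator (fun u => f u - (φ k).eval u) := by
    ext u; by_cases hu : u ∈ s <;> simp [hu]
  rw [this]
  exact eLpNorm_indicator_le _

/-- If `f` lives on `(-∞, S]`, cutting its approximating step functions at `S` leaves an
approximation, and the cut integrals use only values of `B` up to `S`. -/
theorem exists_measurable_past (h : IsWienerIntegral P B f I) (hB : IsPreBrownianReal B P)
    (hBm : ∀ t, Measurable (B t)) (S : ℝ≥0) (hf : (Iic (S : ℝ)).indicator f = f) :
    ∃ J : Ω → ℝ, Measurable[pastOf B S] J ∧ I =ᵐ[P] J := by
  obtain ⟨φ, h1, -⟩ := h.exists_approx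
  have h2 := approx_indicator (s := Iic (S : ℝ)) h1
  rw [hf] at h2
  simp_rw [← StepFun.eval_below] at h2
  refine exists_measurable_of_tendsto_eLpNorm h.memLp.1 (h.tendsto_integral hB h2) ?_
    (fun k => (φ k).measurable_integral_below S B)
  exact iSup₂_le fun u _ => (hBm u).comap_le

theorem exists_measurable_future (h : IsWienerIntegral P B f I) (hB : IsPreBrownianReal B P)
    (hBm : ∀ t, Measurable (B t)) (S : ℝ≥0) (hf : (Ioi (S : ℝ)).indicator f = f) :
    ∃ J : Ω → ℝ, Measurable[MeasurableSpace.comap (fun ω t => B (S + t) ω - B S ω)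
      MeasurableSpace.pi] J ∧ I =ᵐ[P] J := by
  obtain ⟨φ, h1, -⟩ := h.exists_approx
  have h2 := approx_indicator (s := Ioi (S : ℝ)) h1
  rw [hf] at h2
  simp_rw [← StepFun.eval_above] at h2
  refine exists_measurable_of_tendsto_eLpNorm h.memLp.1 (h.tendsto_integral hB h2) ?_
    (fun k => (φ k).measurable_integral_above S B)
  have : Measurable fun ω (t : ℝ≥0) => B (S + t) ω - B S ω :=
    measurable_pi_lambda _ fun t => (hBm _).sub (hBm _)
  exact this.comap_le

/-- The part of a Wiener integral after time `S`. -/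
theorem sub_past (h : IsWienerIntegral P B f I) (hB : IsPreBrownianReal B P) (S : ℝ≥0)
    {J : Ω → ℝ} (hJ : IsWienerIntegral P B ((Iic (S : ℝ)).indicator f) J) :
    IsWienerIntegral P B ((Ioi (S : ℝ)).indicator f) (fun ω => I ω - J ω) := by
  obtain ⟨φ, h1, h1'⟩ := h.exists_approx
  have h2 := approx_indicator (s := Iic (S : ℝ)) h1
  have h3 := approx_indicator (s := Ioi (S : ℝ)) h1
  simp_rw [← StepFun.eval_below] at h2
  simp_rw [← StepFun.eval_above] at h3
  have h4 := hJ.tendsto_integral hB h2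
  refine ⟨h.memLp_integrand.indicator measurableSet_Ioi, h.memLp.sub hJ.memLp,
    fun k => (φ k).above S, h3, ?_⟩
  have h5 := h1'.add h4
  simp only [add_zero] at h5
  refine tendsto_of_tendsto_of_tendsto_of_le_of_le tendsto_const_nhds h5 (fun _ => zero_le)
    fun k => ?_
  have e : (fun ω => I ω - J ω - ((φ k).above S).integral B ω)
      = (fun ω => I ω - (φ k).integral B ω) - fun ω => J ω - ((φ k).below S).integral B ω := by
    ext ω
    have := (φ k).integral_below_add_integral_above S B ω
    simp only [Pi.sub_apply]
    linarith
  rw [e]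
  exact eLpNorm_sub_le (h.memLp.sub ((φ k).memLp_integral hB)).1
    (hJ.memLp.sub (((φ k).below S).memLp_integral hB)).1 (by norm_num)

end IsWienerIntegral

theorem tendsto_integral_sq {α : Type*} [MeasurableSpace α] {μ : Measure α} {f : α → ℝ}
    {g : ℕ → α → ℝ} (hf : MemLp f 2 μ) (hg : ∀ k, MemLp (g k) 2 μ)
    (h : Tendsto (fun k => eLpNorm (fun x => f x - g k x) 2 μ) atTop (𝓝 0)) :
    Tendsto (fun k => ∫ x, g k x ^ 2 ∂μ) atTop (𝓝 (∫ x, f x ^ 2 ∂μ)) := by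
  have h1 : Tendsto (fun k => (hg k).toLp (g k)) atTop (𝓝 (hf.toLp f)) := by
    rw [Lp.tendsto_Lp_iff_tendsto_eLpNorm'']
    refine h.congr fun k => ?_
    rw [← eLpNorm_neg]
    congr 1; ext x; simp
  have h2 := h1.norm.pow 2
  have h3 : ∀ {f : α → ℝ} (hf : MemLp f 2 μ), ‖hf.toLp f‖ ^ 2 = ∫ x, f x ^ 2 ∂μ := by
    intro f hf
    rw [Lp.norm_toLp, eLpNorm_two_eq_ofReal_sqrt hf, ENNReal.toReal_ofReal (Real.sqrt_nonneg _),
      Real.sq_sqrt (integral_nonneg fun x => sq_nonneg _)]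
  simpa only [h3] using h2

/-- The Wiener integral of `f` is centered Gaussian with variance `∫ f²`. -/
theorem IsWienerIntegral.hasLaw {P : Measure Ω} [IsProbabilityMeasure P] {B : ℝ≥0 → Ω → ℝ}
    {f : ℝ → ℝ} {I : Ω → ℝ} (h : IsWienerIntegral P B f I) (hB : IsPreBrownianReal B P) :
    HasLaw I (gaussianReal 0 (∫ u in Ioi (0 : ℝ), f u ^ 2).toNNReal) P := by
  have hIm : AEMeasurable I P := h.memLp.1.aemeasurable
  obtain ⟨φ, h1, h2⟩ := h.exists_approx
  have hv := tendsto_integral_sq h.memLp_integrand (fun k => (φ k).memLp_eval) h1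
  have h2' : Tendsto (fun k => eLpNorm ((φ k).integral B - I) 2 P) atTop (𝓝 0) := by
    refine h2.congr fun k => ?_
    rw [← eLpNorm_neg]
    congr 1
    ext ω
    simp
  have hXm := fun k => ((φ k).memLp_integral hB).1
  obtain ⟨ns, hmono, hns⟩ := (tendstoInMeasure_of_tendsto_eLpNorm two_ne_zero hXm
    h.memLp.1 h2').exists_seq_tendsto_ae
  refine ⟨hIm, ?_⟩
  have : IsProbabilityMeasure (P.map I) := Measure.isProbabilityMeasure_map hIm
  refine Measure.ext_of_charFun (funext fun t => ?_)
  have hch : ∀ {X : Ω → ℝ}, AEMeasurable X P → charFun (P.map X) t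
      = ∫ ω, Complex.exp (t * X ω * Complex.I) ∂P := by
    intro X hX
    rw [charFun_apply_real, integral_map hX (by fun_prop)]
  -- Along an almost surely convergent subsequence the characteristic functions have two limits: by
  -- dominated convergence that of `I`, and by convergence of the variances the Gaussian one.
  have hl1 : Tendsto (fun k => charFun (P.map ((φ (ns k)).integral B)) t) atTop
      (𝓝 (charFun (P.map I) t)) := by
    rw [hch hIm]
    simp_rw [hch (hXm _).aemeasurable]
    refine tendsto_integral_of_dominated_convergence (fun _ => 1) (fun k => ?_)
      (integrable_const _) (fun k => Eventually.of_forall fun ω => ?_) ?_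
    · have := (hXm (ns k)).aemeasurable
      exact AEMeasurable.aestronglyMeasurable (by fun_prop)
    · rw [← Complex.ofReal_mul, Complex.norm_exp_ofReal_mul_I]
    · filter_upwards [hns] with ω hω
      have hc : Continuous fun x : ℝ => Complex.exp (t * x * Complex.I) := by fun_prop
      exact (hc.tendsto _).comp hω
  have hl2 : Tendsto (fun k => charFun (P.map ((φ (ns k)).integral B)) t) atTop
      (𝓝 (charFun (gaussianReal 0 (∫ u in Ioi (0 : ℝ), f u ^ 2).toNNReal) t)) := by
    simp_rw [((φ _).hasLaw_integral hB).map_eq, charFun_gaussianReal]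
    simp_rw [Real.coe_toNNReal _ (integral_nonneg fun x : ℝ => sq_nonneg _)]
    have hc : Continuous fun v : ℝ => Complex.exp (t * (0 : ℝ) * Complex.I - v * t ^ 2 / 2) := by
      fun_prop
    exact (hc.tendsto _).comp (hv.comp hmono.tendsto_atTop)
  exact tendsto_nhds_unique hl1 hl2

/-! ### The Volterra kernel -/

theorem rlKernel_sq (H S s u : ℝ) :
    rlKernel H S s u ^ 2 = (Ioc 0 S).indicator (fun u => ((s - u) ^ (H - 1 / 2)) ^ 2) u := by
  rw [rlKernel]
  by_cases hu : u ∈ Ioc 0 S <;> simp [hu]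

theorem integral_Ioc_rpow_sq {H a b s : ℝ} (hH : 0 < H) (hab : a ≤ b) (hbs : b ≤ s) :
    ∫ u in Ioc a b, ((s - u) ^ (H - 1 / 2)) ^ 2
      = ((s - a) ^ (2 * H) - (s - b) ^ (2 * H)) / (2 * H) := by
  have h1 : ∀ u ∈ Ioc a b, ((s - u) ^ (H - 1 / 2)) ^ 2 = (s - u) ^ (2 * H - 1) := by
    intro u hu
    rw [← Real.rpow_natCast, ← Real.rpow_mul (by linarith [hu.2])]
    congr 1; push_cast; ring
  rw [setIntegral_congr_fun measurableSet_Ioc h1, ← intervalIntegral.integral_of_le hab,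
    intervalIntegral.integral_comp_sub_left (fun x => x ^ (2 * H - 1)) s,
    integral_rpow (Or.inl (by linarith))]
  congr 2 <;> ring_nf

theorem indicator_rlKernel_past {H S s : ℝ} (hSs : S ≤ s) :
    (Iic S).indicator (rlKernel H s s) = rlKernel H S s := by
  rw [rlKernel, rlKernel, indicator_indicator]
  congr 1
  ext u
  simp only [mem_inter_iff, mem_Iic, mem_Ioc]
  constructor
  · rintro ⟨h1, h2, -⟩; exact ⟨h2, h1⟩
  · rintro ⟨h1, h2⟩; exact ⟨h2, h1, h2.trans hSs⟩

theorem integral_rlKernel_sq {H S s : ℝ} (hH : 0 < H) (hS : 0 ≤ S) (hSs : S ≤ s) :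
    ∫ u in Ioi (0 : ℝ), rlKernel H S s u ^ 2
      = (s ^ (2 * H) - (s - S) ^ (2 * H)) / (2 * H) := by
  simp_rw [rlKernel_sq]
  rw [setIntegral_indicator measurableSet_Ioc, inter_eq_self_of_subset_right Ioc_subset_Ioi_self,
    integral_Ioc_rpow_sq hH hS hSs, sub_zero]

theorem integral_rlKernel_future_sq {H S s : ℝ} (hH : 0 < H) (hS : 0 ≤ S) (hSs : S ≤ s) :
    ∫ u in Ioi (0 : ℝ), (Ioi S).indicator (rlKernel H s s) u ^ 2
      = (s - S) ^ (2 * H) / (2 * H) := by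
  have h1 : ∀ u, (Ioi S).indicator (rlKernel H s s) u ^ 2
      = (Ioc S s).indicator (fun u => ((s - u) ^ (H - 1 / 2)) ^ 2) u := by
    intro u
    by_cases hu : u ∈ Ioi S
    · rw [indicator_of_mem hu, rlKernel_sq]
      have : u ∈ Ioc 0 s ↔ u ∈ Ioc S s :=
        ⟨fun h => ⟨hu, h.2⟩, fun h => ⟨hS.trans_lt h.1, h.2⟩⟩
      by_cases h2 : u ∈ Ioc S s
      · rw [indicator_of_mem h2, indicator_of_mem (this.2 h2)]
      · rw [indicator_of_notMem h2, indicator_of_notMem (mt this.1 h2)]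
    · rw [indicator_of_notMem hu, indicator_of_notMem (fun h => hu h.1)]
      norm_num
  simp_rw [h1]
  have h2 : Ioc S s ⊆ Ioi 0 := fun u hu => hS.trans_lt hu.1
  rw [setIntegral_indicator measurableSet_Ioc, inter_eq_self_of_subset_right h2,
    integral_Ioc_rpow_sq hH hSs le_rfl,
    sub_self, Real.zero_rpow (by positivity), sub_zero]

/-! ### Independence and conditioning on the past -/

theorem pastOf_le {Ω : Type*} {m₀ : MeasurableSpace Ω} {B : ℝ≥0 → Ω → ℝ}
    {S : ℝ} (hBm : ∀ t, Measurable (B t)) : pastOf B S ≤ m₀ :=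
  iSup₂_le fun u _ => (hBm u).comap_le

theorem pastOf_le_comap_restrict {Ω : Type*} (B : ℝ≥0 → Ω → ℝ) (S : ℝ≥0) :
    pastOf B S ≤ MeasurableSpace.comap (fun ω (t : Iic S) => B t ω) MeasurableSpace.pi := by
  refine iSup₂_le fun u hu => ?_
  have hm : Measurable[MeasurableSpace.comap (fun ω (t : Iic S) => B t ω) MeasurableSpace.pi]
      (B u) :=
    (measurable_pi_apply (⟨u, by exact_mod_cast hu⟩ : Iic S) : Measurable fun f : Iic S → ℝ =>
      f ⟨u, by exact_mod_cast hu⟩).comp (comap_measurable _)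
  exact hm.comap_le

theorem pastOf_le_comap {Ω : Type*} (B : ℝ≥0 → Ω → ℝ) (S : ℝ) :
    pastOf B S ≤ MeasurableSpace.comap (fun ω t => B t ω) MeasurableSpace.pi := by
  refine iSup₂_le fun u _ => ?_
  have hm : Measurable[MeasurableSpace.comap (fun ω t => B t ω) MeasurableSpace.pi] (B u) :=
    (measurable_pi_apply u : Measurable fun f : ℝ≥0 → ℝ => f u).comp (comap_measurable _)
  exact hm.comap_le

theorem comap_shift_le_comap {Ω : Type*} (B : ℝ≥0 → Ω → ℝ) (S : ℝ≥0) :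
    MeasurableSpace.comap (fun ω t => B (S + t) ω - B S ω) MeasurableSpace.pi
      ≤ MeasurableSpace.comap (fun ω t => B t ω) MeasurableSpace.pi := by
  have h : ∀ u, Measurable[MeasurableSpace.comap (fun ω t => B t ω) MeasurableSpace.pi] (B u) :=
    fun u => (measurable_pi_apply u : Measurable fun f : ℝ≥0 → ℝ => f u).comp (comap_measurable _)
  have h2 : Measurable[MeasurableSpace.comap (fun ω t => B t ω) MeasurableSpace.pi]
      (fun ω (t : ℝ≥0) => B (S + t) ω - B S ω) :=
    @measurable_pi_lambda _ _ _ (MeasurableSpace.comap (fun ω t => B t ω) MeasurableSpace.pi) _ _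
      fun t => (h _).sub (h _)
  exact h2.comap_le

section PastFuture

variable {P : Measure Ω} [IsProbabilityMeasure P] {B : ℝ≥0 → Ω → ℝ}

/-- A variable independent of the Brownian motion, the past, and the future increments are jointly
independent. -/
theorem map_prod_past_future {Y : Ω → ℝ} {α : Type*} [MeasurableSpace α]
    (hBm : ∀ t, Measurable (B t)) (hB : IsPreBrownianReal B P) (hYm : AEMeasurable Y P)
    (hY : IndepFun Y (fun ω t => B t ω) P) (S : ℝ≥0) {W : Ω → α} {R : Ω → ℝ}
    (hW : Measurable[pastOf B S] W)
    (hR : Measurable[MeasurableSpace.comap (fun ω t => B (S + t) ω - B S ω)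
      MeasurableSpace.pi] R) :
    P.map (fun ω => (Y ω, (W ω, R ω))) = (P.map Y).prod ((P.map W).prod (P.map R)) := by
  have hpath : Measurable fun ω (t : ℝ≥0) => B t ω := measurable_pi_lambda _ hBm
  have hW' : Measurable[MeasurableSpace.comap (fun ω t => B t ω) MeasurableSpace.pi] W :=
    hW.mono (pastOf_le_comap B S) le_rfl
  have hR' : Measurable[MeasurableSpace.comap (fun ω t => B t ω) MeasurableSpace.pi] R :=
    hR.mono (comap_shift_le_comap B S) le_rfl
  have hWm : Measurable W := hW'.mono hpath.comap_le le_rfl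
  have hRm : Measurable R := hR'.mono hpath.comap_le le_rfl
  have h1 : IndepFun Y (fun ω => (W ω, R ω)) P := by
    rw [IndepFun_iff_Indep] at hY ⊢
    exact indep_of_indep_of_le_right hY (hW'.prodMk hR').comap_le
  have h2 : IndepFun W R P := by
    have h3 := (hB.indepFun_shift S).symm
    rw [IndepFun_iff_Indep] at h3 ⊢
    exact indep_of_indep_of_le_right (indep_of_indep_of_le_left h3
      (hW.comap_le.trans (pastOf_le_comap_restrict B S))) hR.comap_le
  rw [(indepFun_iff_map_prod_eq_prod_map_map hYm (hWm.prodMk hRm).aemeasurable).1 h1,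
    (indepFun_iff_map_prod_eq_prod_map_map hWm.aemeasurable hRm.aemeasurable).1 h2]

/-- The conditional expectation of `exp (θ √Y (x + R))` given `x`, for `R` centered Gaussian with
variance `v` and `Y` independent with M-Wright distribution. -/
def condMGF (β θ v x : ℝ) : ℝ :=
  ∫ y, Real.exp (θ * x * √y + θ ^ 2 * v / 2 * y) ∂(mWrightLaw β)

theorem measurable_condMGF (β θ v : ℝ) [IsProbabilityMeasure (mWrightLaw β)] :
    Measurable (condMGF β θ v) := by
  have : StronglyMeasurable fun x => ∫ y, Real.exp (θ * x * √y + θ ^ 2 * v / 2 * y)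
      ∂(mWrightLaw β) := by
    refine StronglyMeasurable.integral_prod_right
      (f := fun x y : ℝ => Real.exp (θ * x * √y + θ ^ 2 * v / 2 * y)) ?_
    refine Measurable.stronglyMeasurable ?_
    simp only [Function.uncurry_def]
    fun_prop
  exact this.measurable

theorem condMGF_pos {β : ℝ} (hβ : 0 < β) (hβ1 : β ≤ 1) [IsProbabilityMeasure (mWrightLaw β)]
    (θ v x : ℝ) : 0 < condMGF β θ v x :=
  integral_exp_pos (integrable_exp_mWrightLaw hβ hβ1 _ _)

theorem lintegral_exp_gaussianReal (v : ℝ≥0) (t x : ℝ) :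
    ∫⁻ r, ENNReal.ofReal (Real.exp (t * (x + r))) ∂(gaussianReal 0 v)
      = ENNReal.ofReal (Real.exp (t * x + v * t ^ 2 / 2)) := by
  have e : ∀ r, Real.exp (t * (x + r)) = Real.exp (t * x) * Real.exp (t * r) := fun r => by
    rw [mul_add, Real.exp_add]
  have hi := (integrable_exp_mul_gaussianReal (μ := 0) (v := v) t).const_mul (Real.exp (t * x))
  simp_rw [e]
  rw [← ofReal_integral_eq_lintegral_ofReal hi (Eventually.of_forall fun r => by positivity),
    integral_const_mul]
  have := congrFun (mgf_fun_id_gaussianReal (μ := 0) (v := v)) t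
  rw [mgf] at this
  rw [this, ← Real.exp_add, zero_mul, zero_add]

theorem lintegral_condMGF_eq {β : ℝ} (hβ : 0 < β) (hβ1 : β ≤ 1)
    [IsProbabilityMeasure (mWrightLaw β)] (θ x : ℝ) (v : ℝ≥0) :
    ∫⁻ r, ∫⁻ y, ENNReal.ofReal (Real.exp (θ * √y * (x + r))) ∂(mWrightLaw β) ∂(gaussianReal 0 v)
      = ENNReal.ofReal (condMGF β θ v x) := by
  rw [lintegral_lintegral_swap
      (Measurable.aemeasurable (by simp only [Function.uncurry_def]; fun_prop)),
    condMGF, ofReal_integral_eq_lintegral_ofReal (integrable_exp_mWrightLaw hβ hβ1 _ _)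
      (Eventually.of_forall fun y => (Real.exp_pos _).le)]
  refine lintegral_congr_ae ?_
  filter_upwards [mWrightLaw_ae_pos] with y hy
  rw [lintegral_exp_gaussianReal, mul_pow, Real.sq_sqrt hy.le]
  congr 2
  ring

/-- This identifies the conditional expectation weakly, through pairings with a past-measurable `K`.
By joint independence the integral is one over a product measure, where the future and `Y` are
integrated out with the past frozen. -/
theorem lintegral_mul_exp_eq {Y : Ω → ℝ} {β θ : ℝ} (hβ : 0 < β) (hβ1 : β ≤ 1)
    [IsProbabilityMeasure (mWrightLaw β)]
    (hBm : ∀ t, Measurable (B t)) (hB : IsPreBrownianReal B P)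
    (hYlaw : HasLaw Y (mWrightLaw β) P)
    (hY : IndepFun Y (fun ω t => B t ω) P) (S : ℝ≥0) {K X R : Ω → ℝ} {v : ℝ≥0}
    (hK : Measurable[pastOf B S] K) (hX : Measurable[pastOf B S] X)
    (hR : Measurable[MeasurableSpace.comap (fun ω t => B (S + t) ω - B S ω)
      MeasurableSpace.pi] R) (hRlaw : HasLaw R (gaussianReal 0 v) P) :
    ∫⁻ ω, ENNReal.ofReal (K ω) * ENNReal.ofReal (Real.exp (θ * √(Y ω) * (X ω + R ω))) ∂P
      = ∫⁻ ω, ENNReal.ofReal (K ω) * ENNReal.ofReal (condMGF β θ v (X ω)) ∂P := by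
  have hmap := map_prod_past_future hBm hB hYlaw.aemeasurable hY S (hK.prodMk hX) hR
  have hle := pastOf_le (S := S) hBm
  have hKm : Measurable K := hK.mono hle le_rfl
  have hXm : Measurable X := hX.mono hle le_rfl
  rw [hYlaw.map_eq, hRlaw.map_eq] at hmap
  set F : ℝ × ((ℝ × ℝ) × ℝ) → ℝ≥0∞ := fun p => ENNReal.ofReal p.2.1.1
    * ENNReal.ofReal (Real.exp (θ * √p.1 * (p.2.1.2 + p.2.2))) with hF
  have hFm : Measurable F := by simp only [hF]; fun_prop
  have hjm : AEMeasurable (fun ω => (Y ω, ((K ω, X ω), R ω))) P :=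
    hYlaw.aemeasurable.prodMk ((hKm.prodMk hXm).aemeasurable.prodMk hRlaw.aemeasurable)
  have : IsProbabilityMeasure (P.map fun ω => (K ω, X ω)) :=
    Measure.isProbabilityMeasure_map (hKm.prodMk hXm).aemeasurable
  calc ∫⁻ ω, ENNReal.ofReal (K ω) * ENNReal.ofReal (Real.exp (θ * √(Y ω) * (X ω + R ω))) ∂P
      = ∫⁻ p, F p ∂(P.map fun ω => (Y ω, ((K ω, X ω), R ω))) :=
        (lintegral_map' hFm.aemeasurable hjm).symm
    _ = ∫⁻ w, ENNReal.ofReal w.1 * ENNReal.ofReal (condMGF β θ v w.2)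
          ∂(P.map fun ω => (K ω, X ω)) := by
        rw [hmap, lintegral_prod_symm' _ hFm,
          lintegral_prod _ (hFm.lintegral_prod_left').aemeasurable]
        refine lintegral_congr fun w => ?_
        simp only [hF]
        have h1 : ∀ r : ℝ, ∫⁻ y, ENNReal.ofReal w.1
            * ENNReal.ofReal (Real.exp (θ * √y * (w.2 + r))) ∂(mWrightLaw β)
            = ENNReal.ofReal w.1 *
              ∫⁻ y, ENNReal.ofReal (Real.exp (θ * √y * (w.2 + r))) ∂(mWrightLaw β) :=
          fun r => lintegral_const_mul _ (by fun_prop)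
        simp_rw [h1]
        rw [lintegral_const_mul, lintegral_condMGF_eq hβ hβ1]
        refine Measurable.lintegral_prod_right' (f := fun q : ℝ × ℝ =>
          ENNReal.ofReal (Real.exp (θ * √q.2 * (w.2 + q.1)))) ?_
        fun_prop
    _ = _ := by
        rw [lintegral_map _ (hKm.prodMk hXm)]
        have := measurable_condMGF β θ v
        fun_prop

end PastFuture

/-! ### Gaussian averages -/

theorem condMGF_zero {β : ℝ} (hβ : 0 < β) (hβ1 : β ≤ 1) [IsProbabilityMeasure (mWrightLaw β)]
    {θ v : ℝ} (hv : 0 ≤ v) : condMGF β θ v 0 = mittagLeffler β (θ ^ 2 * v / 2) := by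
  rw [condMGF, ← integral_exp_mWrightLaw hβ hβ1 (by positivity)]
  simp

/-- Given `Y`, averaging over the past Gaussian variable adds its variance `v` to the future
variance `w`. -/
theorem lintegral_condMGF_gaussianReal {β : ℝ} (hβ : 0 < β) (hβ1 : β ≤ 1)
    [IsProbabilityMeasure (mWrightLaw β)] (θ : ℝ) (w v : ℝ≥0) :
    ∫⁻ x, ENNReal.ofReal (condMGF β θ w x) ∂(gaussianReal 0 v)
      = ENNReal.ofReal (mittagLeffler β (θ ^ 2 * (w + v) / 2)) := by
  have h1 : ∀ x, ENNReal.ofReal (condMGF β θ w x)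
      = ∫⁻ y, ENNReal.ofReal (Real.exp (θ * x * √y + θ ^ 2 * w / 2 * y)) ∂(mWrightLaw β) :=
    fun x => ofReal_integral_eq_lintegral_ofReal (integrable_exp_mWrightLaw hβ hβ1 _ _)
      (Eventually.of_forall fun y => (Real.exp_pos _).le)
  have h2 := integrable_exp_mWrightLaw hβ hβ1 0 (θ ^ 2 * (w + v) / 2)
  simp only [zero_mul, zero_add] at h2
  simp_rw [h1]
  rw [lintegral_lintegral_swap
    (Measurable.aemeasurable (by simp only [Function.uncurry_def]; fun_prop)),
    ← integral_exp_mWrightLaw hβ hβ1 (by positivity),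
    ofReal_integral_eq_lintegral_ofReal h2 (Eventually.of_forall fun y => (Real.exp_pos _).le)]
  refine lintegral_congr_ae ?_
  filter_upwards [mWrightLaw_ae_pos] with y hy
  have h3 : ∀ x, ENNReal.ofReal (Real.exp (θ * x * √y + θ ^ 2 * w / 2 * y))
      = ENNReal.ofReal (Real.exp (θ ^ 2 * w / 2 * y))
        * ENNReal.ofReal (Real.exp (θ * √y * (0 + x))) := by
    intro x
    rw [← ENNReal.ofReal_mul (Real.exp_pos _).le, ← Real.exp_add]
    congr 2; ring
  simp_rw [h3]
  rw [lintegral_const_mul _ (by fun_prop), lintegral_exp_gaussianReal,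
    ← ENNReal.ofReal_mul (Real.exp_pos _).le, ← Real.exp_add, mul_pow, Real.sq_sqrt hy.le]
  congr 2
  ring

theorem integrable_condMGF {β : ℝ} (hβ : 0 < β) (hβ1 : β ≤ 1)
    [IsProbabilityMeasure (mWrightLaw β)] (θ : ℝ) (w v : ℝ≥0) :
    Integrable (condMGF β θ w) (gaussianReal 0 v) ∧
    ∫ x, condMGF β θ w x ∂(gaussianReal 0 v) = mittagLeffler β (θ ^ 2 * (w + v) / 2) := by
  have hm := measurable_condMGF β θ w
  have h0 : ∀ x, 0 ≤ condMGF β θ w x := fun x => (condMGF_pos hβ hβ1 θ w x).le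
  have h1 := lintegral_condMGF_gaussianReal hβ hβ1 θ w v
  have h2 := one_le_mittagLeffler hβ (by positivity : 0 ≤ θ ^ 2 * ((w : ℝ) + v) / 2)
  refine ⟨⟨hm.aestronglyMeasurable, ?_⟩, ?_⟩
  · rw [hasFiniteIntegral_iff_ofReal (Eventually.of_forall h0), h1]
    exact ENNReal.ofReal_lt_top
  · rw [integral_eq_lintegral_of_nonneg_ae (Eventually.of_forall h0) hm.aestronglyMeasurable, h1,
      ENNReal.toReal_ofReal (by linarith)]

theorem integrable_sqrt {α : Type*} [MeasurableSpace α] {μ : Measure α}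
    [IsFiniteMeasure μ] {f : α → ℝ} (hf : Integrable f μ) : Integrable (fun x => √(f x)) μ := by
  refine Integrable.mono' (hf.norm.add (integrable_const 1))
    (Real.continuous_sqrt.comp_aestronglyMeasurable hf.1) (Eventually.of_forall fun x => ?_)
  rw [Real.norm_of_nonneg (Real.sqrt_nonneg _)]
  simp only [Pi.add_apply, Real.norm_eq_abs]
  rw [Real.sqrt_le_left (by positivity)]
  nlinarith [le_abs_self (f x), abs_nonneg (f x)]

theorem integral_sqrt_le {α : Type*} [MeasurableSpace α] {μ : Measure α} [IsProbabilityMeasure μ]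
    {f : α → ℝ} (hf : Integrable f μ) (h0 : 0 ≤ᵐ[μ] f) : ∫ x, √(f x) ∂μ ≤ √(∫ x, f x ∂μ) :=
  Real.strictConcaveOn_sqrt.concaveOn.le_map_integral Real.continuous_sqrt.continuousOn isClosed_Ici
    h0 hf (integrable_sqrt hf)

theorem integral_sqrt_condMGF_le {β : ℝ} (hβ : 0 < β) (hβ1 : β ≤ 1)
    [IsProbabilityMeasure (mWrightLaw β)] (θ : ℝ) (w v : ℝ≥0) :
    ∫ x, √(condMGF β θ w x) ∂(gaussianReal 0 v)
      ≤ √(mittagLeffler β (θ ^ 2 * (w + v) / 2)) := by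
  obtain ⟨hI, hE⟩ := integrable_condMGF hβ hβ1 θ w v
  rw [← hE]
  exact integral_sqrt_le hI (Eventually.of_forall fun x => (condMGF_pos hβ hβ1 θ w x).le)

/-- Averaged over a centered Gaussian variable, dropping the weight `exp (θ² w Y / 2)` costs at most
its expectation. -/
theorem sqrt_mittagLeffler_mul_integral_le {β : ℝ} (hβ : 0 < β) (hβ1 : β ≤ 1)
    [IsProbabilityMeasure (mWrightLaw β)] (θ : ℝ) (w v : ℝ≥0) :
    √(mittagLeffler β (θ ^ 2 * w / 2)) * ∫ x, √(condMGF β θ 0 x) ∂(gaussianReal 0 v)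
      ≤ ∫ x, √(condMGF β θ w x) ∂(gaussianReal 0 v) := by
  -- The centred Gaussian law is symmetric, so the integrals can be folded and only the sum over `x`
  -- and `-x` has to be compared.
  have hneg : ∀ w' : ℝ≥0, ∫ x, √(condMGF β θ w' (-x)) ∂(gaussianReal 0 v)
      = ∫ x, √(condMGF β θ w' x) ∂(gaussianReal 0 v) := by
    intro w'
    have hm := measurable_condMGF β θ w'
    have h := gaussianReal_map_neg (μ := 0) (v := v)
    rw [neg_zero] at h
    conv_rhs => rw [← h]
    rw [integral_map (by fun_prop) (by fun_prop)]
  have hI : ∀ w' : ℝ≥0, Integrable (fun x => √(condMGF β θ w' x)) (gaussianReal 0 v) :=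
    fun w' => integrable_sqrt (integrable_condMGF hβ hβ1 θ w' v).1
  have hIn : ∀ w' : ℝ≥0, Integrable (fun x => √(condMGF β θ w' (-x))) (gaussianReal 0 v) := by
    intro w'
    have hm := measurable_condMGF β θ w'
    have h := gaussianReal_map_neg (μ := 0) (v := v)
    rw [neg_zero] at h
    have h2 := hI w'
    rw [← h] at h2
    exact (integrable_map_measure (g := fun x => √(condMGF β θ w' x)) (by fun_prop)
      (by fun_prop)).1 h2
  have hpt : ∀ x, √(mittagLeffler β (θ ^ 2 * w / 2)) * (√(condMGF β θ 0 x) + √(condMGF β θ 0 (-x)))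
      ≤ √(condMGF β θ w x) + √(condMGF β θ w (-x)) := by
    intro x
    have hsq : ∀ᵐ y ∂(mWrightLaw β), √y ^ 2 = y := by
      filter_upwards [mWrightLaw_ae_pos] with y hy using Real.sq_sqrt hy.le
    have hcongr : ∀ a b : ℝ, ∫ y, Real.exp (a * √y + b * √y ^ 2) ∂(mWrightLaw β)
        = ∫ y, Real.exp (a * √y + b * y) ∂(mWrightLaw β) := fun a b =>
      integral_congr_ae (by filter_upwards [hsq] with y hy; rw [hy])
    have h := sqrt_integral_exp_tilt (μ := mWrightLaw β) (Z := fun y => √y)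
      (Eventually.of_forall fun y => Real.sqrt_nonneg y)
      (fun a b => (integrable_exp_mWrightLaw hβ hβ1 a b).congr
        (by filter_upwards [hsq] with y hy; rw [hy]))
      (a := θ ^ 2 * w / 2) (by positivity) (θ * x)
    have h0 := hcongr 0 (θ ^ 2 * w / 2)
    simp only [zero_mul, zero_add] at h0
    rw [hcongr, hcongr, h0, integral_exp_mWrightLaw hβ hβ1 (by positivity)] at h
    simpa [condMGF] using h
  have hint := integral_mono (((hI 0).add (hIn 0)).const_mul
    √(mittagLeffler β (θ ^ 2 * w / 2))) ((hI w).add (hIn w))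
    (by intro x; simpa using hpt x)
  simp only [Pi.add_apply] at hint
  rw [integral_const_mul, integral_add (hI 0) (hIn 0), integral_add (hI w) (hIn w), hneg, hneg]
    at hint
  simp only [NNReal.coe_zero] at hint
  linarith

/-! ### The grey Bergomi model -/

/-- The Gaussian ingredients of the grey Bergomi model: a Brownian motion `B`, an independent
M-Wright variable `Y`, and the Riemann–Liouville process `BH` driven by `B`. -/
structure IsGreyModel (P : Measure Ω) (β H : ℝ) (B : ℝ≥0 → Ω → ℝ) (Y : Ω → ℝ)
    (BH : ℝ → Ω → ℝ) : Prop where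
  β_pos : 0 < β
  β_le : β ≤ 1
  H_pos : 0 < H
  measurable_B : ∀ t, Measurable (B t)
  brownian : IsPreBrownianReal B P
  hasLaw : HasLaw Y (mWrightLaw β) P
  indep : IndepFun Y (fun ω t => B t ω) P
  fbm : IsRiemannLiouvilleFBM P B H BH

theorem isWienerIntegral_zero (P : Measure Ω) (B : ℝ≥0 → Ω → ℝ) :
    IsWienerIntegral P B (fun _ => 0) (fun _ => 0) where
  memLp_integrand := MemLp.zero'
  memLp := MemLp.zero'
  exists_approx := by
    refine ⟨fun _ => ⟨0, fun _ => 0, monotone_const, fun _ => 0⟩, ?_, ?_⟩ <;>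
    simp [StepFun.eval, StepFun.integral]

namespace IsGreyModel

variable {P : Measure Ω} {β H : ℝ} {B : ℝ≥0 → Ω → ℝ} {Y : Ω → ℝ}
  {BH : ℝ → Ω → ℝ}

theorem one_le_mittagLeffler_bConst (h : IsGreyModel P β H B Y BH) (η : ℝ) {s : ℝ} (hs : 0 ≤ s) :
    1 ≤ mittagLeffler β (bConst H η * s ^ (2 * H)) := by
  have := h.H_pos
  exact one_le_mittagLeffler h.β_pos (by rw [bConst]; positivity)

theorem aestronglyMeasurable_exp (h : IsGreyModel P β H B Y BH) (η : ℝ) {s : ℝ} (hs : 0 ≤ s) :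
    AEStronglyMeasurable (fun ω => Real.exp (η * (√(Y ω) * BH s ω))) P := by
  have h1 := h.hasLaw.aemeasurable
  have h2 := h.fbm.measurable s hs
  exact AEMeasurable.aestronglyMeasurable (by fun_prop)

variable [IsProbabilityMeasure P]

theorem isProbabilityMeasure (h : IsGreyModel P β H B Y BH) :
    IsProbabilityMeasure (mWrightLaw β) :=
  h.hasLaw.map_eq ▸ Measure.isProbabilityMeasure_map h.hasLaw.aemeasurable

/-- Cut the kernel of `BH s` at `S`. The past piece is the given Volterra integral; the remainder is
a Wiener integral over `(S, s]`, hence a function of the increments after `S`. Exactly measurable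
versions are taken because independence is stated for σ-algebras without null sets. -/
theorem exists_decomposition (h : IsGreyModel P β H B Y BH) (S : ℝ≥0) {s : ℝ} (hs : (S : ℝ) ≤ s)
    {X : Ω → ℝ} (hX : IsVolterraIntegral P B H S s X) :
    ∃ X' R : Ω → ℝ, Measurable[pastOf B S] X' ∧ X =ᵐ[P] X' ∧
      Measurable[MeasurableSpace.comap (fun ω t => B (S + t) ω - B S ω) MeasurableSpace.pi] R ∧
      HasLaw R (gaussianReal 0 ((s - S) ^ (2 * H) / (2 * H)).toNNReal) P ∧
      BH s =ᵐ[P] fun ω => cConst H * (X' ω + R ω) := by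
  obtain ⟨I, hI, hBI⟩ := h.fbm.eq_integral s (S.coe_nonneg.trans hs)
  have hpast := indicator_rlKernel_past (H := H) hs
  obtain ⟨X', hX'm, hXX'⟩ := IsWienerIntegral.exists_measurable_past hX h.brownian h.measurable_B S
    (by rw [← hpast, indicator_indicator, inter_self])
  have hsub := IsWienerIntegral.sub_past hI h.brownian S (J := X) (by rw [hpast]; exact hX)
  obtain ⟨R, hRm, hRR⟩ := hsub.exists_measurable_future h.brownian h.measurable_B S
    (by rw [indicator_indicator, inter_self])
  have hlaw := hsub.hasLaw h.brownian
  rw [integral_rlKernel_future_sq h.H_pos S.coe_nonneg hs] at hlaw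
  refine ⟨X', R, hX'm, hXX', hRm, hlaw.congr hRR.symm, ?_⟩
  filter_upwards [hBI, hXX', hRR] with ω h1 h2 h3
  rw [h1, ← h2, ← h3]
  ring

/-- Conditionally on the past up to time `S`, the exponential of `η √Y BH_s` has expectation
`condMGF`. -/
theorem lintegral_mul_exp (h : IsGreyModel P β H B Y BH) (η : ℝ) (S : ℝ≥0) {s : ℝ}
    (hs : (S : ℝ) ≤ s) {X K : Ω → ℝ} (hX : IsVolterraIntegral P B H S s X)
    (hK : Measurable[pastOf B S] K) :
    ∫⁻ ω, ENNReal.ofReal (K ω) * ENNReal.ofReal (Real.exp (η * (√(Y ω) * BH s ω))) ∂P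
      = ∫⁻ ω, ENNReal.ofReal (K ω) * ENNReal.ofReal
          (condMGF β (η * cConst H) ((s - S) ^ (2 * H) / (2 * H)) (X ω)) ∂P := by
  have := h.isProbabilityMeasure
  obtain ⟨X', R, hX'm, hXX', hRm, hR, hBH⟩ := h.exists_decomposition S hs hX
  have hv : 0 ≤ (s - S) ^ (2 * H) / (2 * H) := by
    have := h.H_pos
    have := Real.rpow_nonneg (sub_nonneg.2 hs) (2 * H)
    positivity
  have key := lintegral_mul_exp_eq (θ := η * cConst H) h.β_pos h.β_le h.measurable_B h.brownian
    h.hasLaw h.indep S hK hX'm hRm hR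
  rw [Real.coe_toNNReal _ hv] at key
  refine (lintegral_congr_ae ?_).trans (key.trans (lintegral_congr_ae ?_))
  · filter_upwards [hBH] with ω hω
    rw [hω]
    congr 3
    ring
  · filter_upwards [hXX'] with ω hω
    rw [hω]

theorem bConst_mul (hH : 0 < H) (η x : ℝ) :
    bConst H η * x = (η * cConst H) ^ 2 * (x / (2 * H)) / 2 := by
  rw [bConst]
  field_simp
  ring

theorem lintegral_exp (h : IsGreyModel P β H B Y BH) (η : ℝ) {s : ℝ} (hs : 0 ≤ s) :
    ∫⁻ ω, ENNReal.ofReal (Real.exp (η * (√(Y ω) * BH s ω))) ∂P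
      = ENNReal.ofReal (mittagLeffler β (bConst H η * s ^ (2 * H))) := by
  have := h.isProbabilityMeasure
  -- At time `0` the past integral is zero, so the unconditional exponential moment is the case `S =
  -- 0`, `K = 1`.
  have hX : IsVolterraIntegral P B H ((0 : ℝ≥0) : ℝ) s (fun _ => 0) := by
    have := isWienerIntegral_zero P B
    rw [IsVolterraIntegral, rlKernel]
    simpa [indicator_empty'] using this
  have key := h.lintegral_mul_exp η 0 (by simpa using hs) hX (K := fun _ => 1) measurable_const
  have hv : 0 ≤ s ^ (2 * H) / (2 * H) := by
    have := h.H_pos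
    positivity
  simpa [condMGF_zero h.β_pos h.β_le hv, bConst_mul h.H_pos] using key

theorem integral_exp (h : IsGreyModel P β H B Y BH) (η : ℝ) {s : ℝ} (hs : 0 ≤ s) :
    ∫ ω, Real.exp (η * (√(Y ω) * BH s ω)) ∂P
      = mittagLeffler β (bConst H η * s ^ (2 * H)) := by
  rw [integral_eq_lintegral_of_nonneg_ae (Eventually.of_forall fun ω => (Real.exp_pos _).le)
    (h.aestronglyMeasurable_exp η hs), h.lintegral_exp η hs,
    ENNReal.toReal_ofReal (by linarith [h.one_le_mittagLeffler_bConst η hs])]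

theorem greyVariance_eq (h : IsGreyModel P β H B Y BH) (ξ₀ : ℝ → ℝ) (η : ℝ) {s : ℝ} (hs : 0 ≤ s)
    (ω : Ω) : greyVariance P ξ₀ η Y BH s ω
      = ξ₀ s / mittagLeffler β (bConst H η * s ^ (2 * H))
        * Real.exp (η * (√(Y ω) * BH s ω)) := by
  have h1 := h.one_le_mittagLeffler_bConst η hs
  rw [greyVariance, normExp, cgf, mgf, h.integral_exp η hs, Real.exp_sub,
    Real.exp_log (by linarith)]
  ring

/-- The pairing of `V_s` with the past. -/
theorem lintegral_mul_greyVariance (h : IsGreyModel P β H B Y BH) {ξ₀ : ℝ → ℝ} (η : ℝ) (S : ℝ≥0)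
    {s : ℝ} (hs : (S : ℝ) ≤ s) (hξ : 0 ≤ ξ₀ s) {X K : Ω → ℝ}
    (hX : IsVolterraIntegral P B H S s X) (hK : Measurable[pastOf B S] K) :
    ∫⁻ ω, ENNReal.ofReal (K ω) * ENNReal.ofReal (greyVariance P ξ₀ η Y BH s ω) ∂P
      = ∫⁻ ω, ENNReal.ofReal (K ω) * ENNReal.ofReal
          (ξ₀ s / mittagLeffler β (bConst H η * s ^ (2 * H)) *
            condMGF β (η * cConst H) ((s - S) ^ (2 * H) / (2 * H)) (X ω)) ∂P := by
  have h0 : 0 ≤ s := S.coe_nonneg.trans hs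
  have h1 := h.one_le_mittagLeffler_bConst η h0
  set c := ξ₀ s / mittagLeffler β (bConst H η * s ^ (2 * H)) with hc
  have hc0 : 0 ≤ c := div_nonneg hξ (by linarith)
  have key := h.lintegral_mul_exp η S hs hX hK
  simp_rw [h.greyVariance_eq ξ₀ η h0, ← hc, ENNReal.ofReal_mul hc0,
    mul_left_comm _ (ENNReal.ofReal c)]
  rw [lintegral_const_mul' _ _ ENNReal.ofReal_ne_top, key,
    lintegral_const_mul' _ _ ENNReal.ofReal_ne_top]

theorem lintegral_greyVariance (h : IsGreyModel P β H B Y BH) {ξ₀ : ℝ → ℝ} (η : ℝ)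
    {s : ℝ} (hs : 0 ≤ s) (hξ : 0 ≤ ξ₀ s) :
    ∫⁻ ω, ENNReal.ofReal (greyVariance P ξ₀ η Y BH s ω) ∂P = ENNReal.ofReal (ξ₀ s) := by
  have h1 := h.one_le_mittagLeffler_bConst η hs
  have hc0 : 0 ≤ ξ₀ s / mittagLeffler β (bConst H η * s ^ (2 * H)) := div_nonneg hξ (by linarith)
  simp_rw [h.greyVariance_eq ξ₀ η hs, ENNReal.ofReal_mul hc0]
  rw [lintegral_const_mul' _ _ ENNReal.ofReal_ne_top, h.lintegral_exp η hs,
    ← ENNReal.ofReal_mul hc0, div_mul_cancel₀ _ (by linarith)]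

end IsGreyModel

/-- A process with almost surely continuous paths on `[0, ∞)` has a jointly measurable version. -/
theorem exists_measurable_modification {P : Measure Ω} {X : ℝ → Ω → ℝ}
    (hm : ∀ t, 0 ≤ t → Measurable (X t)) (hc : ∀ᵐ ω ∂P, ContinuousOn (fun t => X t ω) (Ici 0)) :
    ∃ Z : ℝ → Ω → ℝ, Measurable (Function.uncurry Z) ∧ ∀ᵐ ω ∂P, ∀ t, 0 ≤ t → Z t ω = X t ω := by
  obtain ⟨N, hN, hNm, hN0⟩ := exists_measurable_superset_of_null (ae_iff.1 hc)
  -- Paths are set to zero on a null set and frozen at negative times, which makes every path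
  -- continuous on the whole line.
  refine ⟨fun t => Nᶜ.indicator fun ω => X (max t 0) ω,
    measurable_uncurry_of_continuous_of_measurable (fun ω => ?_)
      fun t => (hm _ (le_max_right _ _)).indicator hNm.compl, ?_⟩
  · by_cases hω : ω ∈ N
    · simpa [hω] using continuous_const
    · have h1 : ContinuousOn (fun t => X t ω) (Ici 0) := by
        by_contra h2
        exact hω (hN h2)
      have h3 : Continuous fun t : ℝ => X (max t 0) ω :=
        h1.comp_continuous (by fun_prop) fun t => le_max_right t 0
      simpa [hω] using h3
  · filter_upwards [compl_mem_ae_iff.2 hN0] with ω hω t ht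
    rw [indicator_of_mem hω, max_eq_left ht]

theorem measurable_condMGF_variance (β θ x : ℝ) [IsProbabilityMeasure (mWrightLaw β)] :
    Measurable fun v => condMGF β θ v x := by
  have : StronglyMeasurable fun v => ∫ y, Real.exp (θ * x * √y + θ ^ 2 * v / 2 * y)
      ∂(mWrightLaw β) := by
    refine StronglyMeasurable.integral_prod_right
      (f := fun v y : ℝ => Real.exp (θ * x * √y + θ ^ 2 * v / 2 * y)) ?_
    refine Measurable.stronglyMeasurable ?_
    simp only [Function.uncurry_def]
    fun_prop
  exact this.measurable

theorem zetaSeries_eq_condMGF {β : ℝ} (hβ : 0 < β) (hβ1 : β ≤ 1)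
    [IsProbabilityMeasure (mWrightLaw β)] (H η x : ℝ) :
    zetaSeries β H η x = condMGF β (η * cConst H) 0 x := by
  rw [zetaSeries_eq_integral hβ hβ1, condMGF]
  simp

theorem greyVariance_nonneg (P : Measure Ω) {ξ₀ : ℝ → ℝ} (η : ℝ) (Y : Ω → ℝ) (BH : ℝ → Ω → ℝ)
    {s : ℝ} (hξ : 0 ≤ ξ₀ s) (ω : Ω) : 0 ≤ greyVariance P ξ₀ η Y BH s ω :=
  mul_nonneg hξ (Real.exp_pos _).le

/-! ### Joint integrability of the variance and the laws of the Volterra integrals. -/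

namespace IsGreyModel

variable {P : Measure Ω} {β H : ℝ} {B : ℝ≥0 → Ω → ℝ} {Y : Ω → ℝ} {BH : ℝ → Ω → ℝ}
  [IsProbabilityMeasure P]

theorem mittagLeffler_bConst_eq (h : IsGreyModel P β H B Y BH) (η : ℝ) {s : ℝ} (hs : 0 ≤ s) :
    mittagLeffler β (bConst H η * s ^ (2 * H))
      = condMGF β (η * cConst H) (s ^ (2 * H) / (2 * H)) 0 := by
  have := h.isProbabilityMeasure
  have := h.H_pos
  rw [condMGF_zero h.β_pos h.β_le (by positivity), bConst_mul h.H_pos]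

/-- Joint measurability comes from a jointly measurable version of `BH`. The Mittag-Leffler
normalisation is rewritten as `condMGF` at `0`, whose measurability in the variance is a
parameter-integral fact. -/
theorem aestronglyMeasurable_greyVariance (h : IsGreyModel P β H B Y BH) {ξ₀ : ℝ → ℝ} (η : ℝ)
    {I : Set ℝ} (hI : MeasurableSet I) (hI0 : ∀ s ∈ I, 0 ≤ s)
    (hξ : AEStronglyMeasurable ξ₀ (volume.restrict I)) :
    AEStronglyMeasurable (Function.uncurry (greyVariance P ξ₀ η Y BH))
      ((volume.restrict I).prod P) := by
  have := h.isProbabilityMeasure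
  obtain ⟨Z, hZm, hZ⟩ := exists_measurable_modification h.fbm.measurable h.fbm.continuous_paths
  have hm := (measurable_condMGF_variance β (η * cConst H) 0).comp
    (by fun_prop : Measurable fun s : ℝ => s ^ (2 * H) / (2 * H))
  have h1 : AEStronglyMeasurable (fun p : ℝ × Ω => ξ₀ p.1
      / condMGF β (η * cConst H) (p.1 ^ (2 * H) / (2 * H)) 0
      * Real.exp (η * (√(Y p.2) * Function.uncurry Z p))) ((volume.restrict I).prod P) := by
    have e1 : AEMeasurable (fun p : ℝ × Ω => ξ₀ p.1) ((volume.restrict I).prod P) :=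
      hξ.aemeasurable.comp_fst
    have e2 : AEMeasurable (fun p : ℝ × Ω => Y p.2) ((volume.restrict I).prod P) :=
      h.hasLaw.aemeasurable.comp_snd
    have e3 : Measurable (fun p : ℝ × Ω =>
      condMGF β (η * cConst H) (p.1 ^ (2 * H) / (2 * H)) 0) := hm.comp measurable_fst
    have e4 : AEMeasurable (fun p : ℝ × Ω => Real.exp (η * (√(Y p.2) * Function.uncurry Z p)))
      ((volume.restrict I).prod P) :=
      Real.measurable_exp.comp_aemeasurable
        ((e2.sqrt.mul hZm.aemeasurable).const_mul η)
    exact ((e1.div e3.aemeasurable).mul e4).aestronglyMeasurable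
  refine h1.congr ?_
  filter_upwards [Measure.quasiMeasurePreserving_fst.ae (ae_restrict_mem hI),
    Measure.quasiMeasurePreserving_snd.ae hZ] with p hp1 hp2
  have hp0 := hI0 _ hp1
  simp only [Function.uncurry_def]
  rw [h.greyVariance_eq ξ₀ η hp0,
    h.mittagLeffler_bConst_eq η hp0, hp2 _ hp0]

theorem integrable_greyVariance (h : IsGreyModel P β H B Y BH) {ξ₀ : ℝ → ℝ} (η : ℝ)
    {s : ℝ} (hs : 0 ≤ s) (hξ : 0 ≤ ξ₀ s) :
    Integrable (greyVariance P ξ₀ η Y BH s) P ∧ ∫ ω, greyVariance P ξ₀ η Y BH s ω ∂P = ξ₀ s := by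
  have h0 : 0 ≤ᵐ[P] greyVariance P ξ₀ η Y BH s :=
    Eventually.of_forall fun ω => greyVariance_nonneg P η Y BH hξ ω
  have hm : AEStronglyMeasurable (greyVariance P ξ₀ η Y BH s) P := by
    rw [funext (h.greyVariance_eq ξ₀ η hs)]
    exact (h.aestronglyMeasurable_exp η hs).const_mul _
  refine ⟨⟨hm, ?_⟩, ?_⟩
  · rw [hasFiniteIntegral_iff_ofReal h0, h.lintegral_greyVariance η hs hξ]
    exact ENNReal.ofReal_lt_top
  · rw [integral_eq_lintegral_of_nonneg_ae h0 hm, h.lintegral_greyVariance η hs hξ,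
      ENNReal.toReal_ofReal hξ]

theorem integrable_uncurry_greyVariance (h : IsGreyModel P β H B Y BH) {ξ₀ : ℝ → ℝ} (η : ℝ)
    {I : Set ℝ} (hI : MeasurableSet I) (hI0 : ∀ s ∈ I, 0 ≤ s) (hξ0 : ∀ s ∈ I, 0 ≤ ξ₀ s)
    (hξ : IntegrableOn ξ₀ I) :
    Integrable (Function.uncurry (greyVariance P ξ₀ η Y BH)) ((volume.restrict I).prod P) := by
  refine (integrable_prod_iff (h.aestronglyMeasurable_greyVariance η hI hI0 hξ.1)).2 ⟨?_, ?_⟩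
  · filter_upwards [ae_restrict_mem hI] with s hs
    exact (h.integrable_greyVariance η (hI0 s hs) (hξ0 s hs)).1
  · refine hξ.congr ?_
    filter_upwards [ae_restrict_mem hI] with s hs
    rw [← (h.integrable_greyVariance η (hI0 s hs) (hξ0 s hs)).2]
    exact integral_congr_ae (Eventually.of_forall fun ω =>
      (Real.norm_of_nonneg (greyVariance_nonneg P η Y BH (hξ0 s hs) ω)).symm)

theorem hasLaw_volterra (h : IsGreyModel P β H B Y BH) {S s : ℝ} (hS : 0 ≤ S) (hs : S ≤ s)
    {X : Ω → ℝ} (hX : IsVolterraIntegral P B H S s X) :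
    HasLaw X (gaussianReal 0 ((s ^ (2 * H) - (s - S) ^ (2 * H)) / (2 * H)).toNNReal) P := by
  rw [← integral_rlKernel_sq h.H_pos hS hs]
  exact IsWienerIntegral.hasLaw hX h.brownian

theorem integrable_condMGF_volterra (h : IsGreyModel P β H B Y BH) (θ : ℝ) {S s : ℝ} (hS : 0 ≤ S)
    (hs : S ≤ s) {X : Ω → ℝ} (hX : IsVolterraIntegral P B H S s X) (w : ℝ≥0) :
    Integrable (fun ω => condMGF β θ w (X ω)) P := by
  have := h.isProbabilityMeasure
  have hlaw := h.hasLaw_volterra hS hs hX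
  have h1 := (integrable_condMGF h.β_pos h.β_le θ w
    ((s ^ (2 * H) - (s - S) ^ (2 * H)) / (2 * H)).toNNReal).1
  rw [← hlaw.map_eq] at h1
  exact (integrable_map_measure h1.1 hlaw.aemeasurable).1 h1

theorem integral_sqrt_condMGF_volterra (h : IsGreyModel P β H B Y BH) (θ : ℝ) {S s : ℝ}
    (hS : 0 ≤ S) (hs : S ≤ s) {X : Ω → ℝ} (hX : IsVolterraIntegral P B H S s X) (w : ℝ) :
    ∫ ω, √(condMGF β θ w (X ω)) ∂P = ∫ x, √(condMGF β θ w x)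
      ∂(gaussianReal 0 ((s ^ (2 * H) - (s - S) ^ (2 * H)) / (2 * H)).toNNReal) := by
  have := h.isProbabilityMeasure
  have hm := measurable_condMGF β θ w
  exact (h.hasLaw_volterra hS hs hX).integral_comp (f := fun x => √(condMGF β θ w x))
    (Measurable.aestronglyMeasurable (by fun_prop))

end IsGreyModel

/-! ### Conditional expectations and square roots -/

/-- Conditioning on the time-zero information gives a constant on the event that `B` starts at
the origin. -/
theorem condExp_pastOf_zero {P : Measure Ω} [IsProbabilityMeasure P] {B : ℝ≥0 → Ω → ℝ}
    (hBm : ∀ t, Measurable (B t)) (hB : IsPreBrownianReal B P) (X : Ω → ℝ) {ω : Ω}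
    (hω : B 0 ω = 0) : (P[X | pastOf B 0]) ω = ∫ ω', X ω' ∂P := by
  have hle := pastOf_le (S := 0) hBm
  -- The time-zero information is generated by `B 0` alone, so the conditional expectation is a
  -- function of `B 0` and is constant where `B 0 = 0`.
  have hcomap : pastOf B 0 ≤ MeasurableSpace.comap (B 0) inferInstance := by
    refine iSup₂_le fun u hu => ?_
    rw [show u = 0 from le_antisymm (by exact_mod_cast hu) zero_le]
  have hf : Measurable[MeasurableSpace.comap (B 0) inferInstance] (P[X | pastOf B 0]) :=
    (stronglyMeasurable_condExp (f := X)).measurable.mono hcomap le_rfl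
  have hc : ∀ ω', B 0 ω' = 0 → (P[X | pastOf B 0]) ω' = (P[X | pastOf B 0]) ω := fun ω' h =>
    hf.factorsThrough (h.trans hω.symm)
  have h1 : ∫ ω', (P[X | pastOf B 0]) ω' ∂P = ∫ _, (P[X | pastOf B 0]) ω ∂P := by
    refine integral_congr_ae ?_
    filter_upwards [hB.eval_zero_ae_eq_zero] with ω' h using hc ω' h
  rw [integral_condExp hle] at h1
  simp [h1]

theorem sqrt_le_add_div {x u : ℝ} (hx : 0 ≤ x) (hu : 0 < u) : √x ≤ (1 / u * x + u) / 2 := by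
  have h1 : √x ≤ (x + u ^ 2) / (2 * u) := by
    rw [le_div_iff₀ (by positivity)]
    nlinarith [sq_nonneg (√x - u), Real.sq_sqrt hx]
  refine h1.trans (le_of_eq ?_)
  field_simp

/-- If `V` and `N` have the same pairing with nonnegative `m`-measurable variables, then the average
over `s` of `E[√N_s]` is at most the expectation of the square root of the conditional
expectation of the average of `V`. -/
theorem average_le_integral_sqrt_condExp {Ω : Type*} {m m₀ : MeasurableSpace Ω} {P : Measure[m₀] Ω}
    [IsProbabilityMeasure P] (hm : m ≤ m₀) {I : Set ℝ} (hI : MeasurableSet I)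
    {c : ℝ} (hc : 0 ≤ c) (hcI : c * volume.real I = 1) {V N : ℝ → Ω → ℝ} {l : ℝ → ℝ}
    (hV : Integrable (Function.uncurry V) ((volume.restrict I).prod P))
    (hV0 : ∀ s ∈ I, ∀ ω, 0 ≤ V s ω) (hN0 : ∀ s ∈ I, ∀ ω, 0 ≤ N s ω)
    (hVm : ∀ s ∈ I, AEStronglyMeasurable (V s) P) (hN : ∀ s ∈ I, Integrable (N s) P)
    (hVN : ∀ s ∈ I, ∀ K : Ω → ℝ, Measurable[m] K →
      ∫⁻ ω, ENNReal.ofReal (K ω) * ENNReal.ofReal (V s ω) ∂P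
        = ∫⁻ ω, ENNReal.ofReal (K ω) * ENNReal.ofReal (N s ω) ∂P)
    (hl : IntegrableOn l I) (hlN : ∀ s ∈ I, l s ≤ ∫ ω, √(N s ω) ∂P) :
    c * ∫ s in I, l s ≤ ∫ ω, √((P[fun ω' => c * ∫ s in I, V s ω' | m]) ω) ∂P := by
  set W : Ω → ℝ := fun ω' => c * ∫ s in I, V s ω' with hWdef
  set g : Ω → ℝ := P[W | m] with hgdef
  have hW : Integrable W P := hV.integral_prod_right.const_mul c
  have hW0 : 0 ≤ᵐ[P] W := Eventually.of_forall fun ω =>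
    mul_nonneg hc (setIntegral_nonneg hI fun s hs => hV0 s hs ω)
  have hg0 : 0 ≤ᵐ[P] g := condExp_nonneg hW0
  have hgi : Integrable g P := integrable_condExp
  have hgm : Measurable[m] g := stronglyMeasurable_condExp.measurable
  have hU : Integrable (fun ω => √(g ω)) P := integrable_sqrt hgi
  refine le_of_forall_pos_le_add fun ε hε => ?_
  -- Linearising `√N_s` by `(K N_s + 1 / K) / 2` is optimal at `K = 1 / √g`; the `ε` keeps `K`
  -- bounded. As `K` is `m`-measurable, `N` can be traded for `V` at each fixed `s`. Hence Fubini is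
  -- applied to `V` only, and no joint measurability of `N` is required.
  set K : Ω → ℝ := fun ω => 1 / (√(g ω) + ε) with hKdef
  have hden : ∀ ω, 0 < √(g ω) + ε := fun ω => by positivity
  have hK0 : ∀ ω, 0 ≤ K ω := fun ω => (one_div_pos.2 (hden ω)).le
  have hKb : ∀ ω, ‖K ω‖ ≤ 1 / ε := fun ω => by
    rw [Real.norm_of_nonneg (hK0 ω)]
    exact one_div_le_one_div_of_le hε (by linarith [Real.sqrt_nonneg (g ω)])
  have hKm : Measurable[m] K := (hgm.sqrt.add_const ε).const_div 1
  have hKm' : Measurable K := hKm.mono hm le_rfl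
  have hKV : Integrable (Function.uncurry fun s ω => K ω * V s ω) ((volume.restrict I).prod P) :=
    hV.bdd_mul (c := 1 / ε) (f := fun p : ℝ × Ω => K p.2)
      (hKm'.comp measurable_snd).aestronglyMeasurable (Eventually.of_forall fun p => hKb p.2)
  have hKN : ∀ s ∈ I, Integrable (fun ω => K ω * N s ω) P := fun s hs =>
    (hN s hs).bdd_mul hKm'.aestronglyMeasurable (Eventually.of_forall hKb)
  have heq : ∀ s ∈ I, ∫ ω, K ω * N s ω ∂P = ∫ ω, K ω * V s ω ∂P := by
    intro s hs
    rw [integral_eq_lintegral_of_nonneg_ae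
        (Eventually.of_forall fun ω => mul_nonneg (hK0 ω) (hN0 s hs ω)) (hKN s hs).1,
      integral_eq_lintegral_of_nonneg_ae
        (Eventually.of_forall fun ω => mul_nonneg (hK0 ω) (hV0 s hs ω))
        (hKm'.aestronglyMeasurable.mul (hVm s hs))]
    simp_rw [ENNReal.ofReal_mul (hK0 _)]
    rw [hVN s hs K hKm]
  set u := ∫ ω, √(g ω) ∂P with hu
  have hUε : ∫ ω, (√(g ω) + ε) ∂P = u + ε := by
    rw [integral_add hU (integrable_const _)]
    simp [hu]
  have hUi : Integrable (fun ω => √(g ω) + ε) P := hU.add (integrable_const _)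
  have hpt : ∀ s ∈ I, l s ≤ (∫ ω, K ω * V s ω ∂P + (u + ε)) / 2 := by
    intro s hs
    refine (hlN s hs).trans ?_
    rw [← heq s hs, ← hUε, ← integral_add (hKN s hs) hUi,
      ← integral_div]
    exact integral_mono (integrable_sqrt (hN s hs))
      (((hKN s hs).add hUi).div_const 2) fun ω =>
      sqrt_le_add_div (hN0 s hs ω) (hden ω)
  have hvol : volume I ≠ ∞ := by
    intro h
    simp [Measure.real, h] at hcI
  have hfin : IsFiniteMeasure (volume.restrict I) := isFiniteMeasure_restrict.2 hvol
  have hi1 : Integrable (fun s => ∫ ω, K ω * V s ω ∂P) (volume.restrict I) :=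
    hKV.integral_prod_left
  have hi2 : Integrable (fun s => (∫ ω, K ω * V s ω ∂P + (u + ε)) / 2) (volume.restrict I) :=
    (hi1.add (integrable_const _)).div_const 2
  have hKW : c * ∫ s in I, ∫ ω, K ω * V s ω ∂P = ∫ ω, K ω * W ω ∂P := by
    rw [integral_integral_swap hKV, ← integral_const_mul]
    refine integral_congr_ae (Eventually.of_forall fun ω => ?_)
    simp only [hWdef]
    rw [integral_const_mul]
    ring
  have hKWi : Integrable (fun ω => K ω * W ω) P :=
    hW.bdd_mul hKm'.aestronglyMeasurable (Eventually.of_forall hKb)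
  have hpull : ∫ ω, K ω * W ω ∂P = ∫ ω, K ω * g ω ∂P := by
    rw [← integral_condExp hm]
    exact integral_congr_ae (condExp_mul_of_stronglyMeasurable_left hKm.stronglyMeasurable hKWi hW)
  -- Pointwise `g / (√g + ε) ≤ √g`.
  have hKg : ∫ ω, K ω * g ω ∂P ≤ u := by
    refine integral_mono_ae (hgi.bdd_mul hKm'.aestronglyMeasurable (Eventually.of_forall hKb)) hU ?_
    filter_upwards [hg0] with ω hω
    have h1 := Real.sq_sqrt hω
    have h2 := Real.sqrt_nonneg (g ω)
    simp only [hKdef]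
    rw [one_div, ← div_eq_inv_mul, div_le_iff₀ (hden ω)]
    nlinarith
  calc c * ∫ s in I, l s
      ≤ c * ∫ s in I, (∫ ω, K ω * V s ω ∂P + (u + ε)) / 2 :=
        mul_le_mul_of_nonneg_left (setIntegral_mono_on hl hi2 hI hpt) hc
    _ = (c * (∫ s in I, ∫ ω, K ω * V s ω ∂P) + c * volume.real I * (u + ε)) / 2 := by
        rw [integral_div, integral_add hi1 (integrable_const _), setIntegral_const, smul_eq_mul]
        ring
    _ ≤ u + ε := by
        rw [hKW, hpull, hcI]
        linarith

/-! ### The two bounds at a fixed time `s`, and integrability of the lower integrand. -/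

namespace IsGreyModel

variable {P : Measure Ω} {β H : ℝ} {B : ℝ≥0 → Ω → ℝ} {Y : Ω → ℝ} {BH : ℝ → Ω → ℝ}
  [IsProbabilityMeasure P]

/-- The Volterra integral is a centred Gaussian variable, so this is the symmetrised tilting
inequality multiplied by the square root of the deterministic prefactor. -/
theorem sqrt_mul_integral_sqrt_le (h : IsGreyModel P β H B Y BH) (η : ℝ) {x S s : ℝ} (hx : 0 ≤ x)
    (hS : 0 ≤ S) (hs : S ≤ s) {X : Ω → ℝ} (hX : IsVolterraIntegral P B H S s X) :
    √(x * mittagLeffler β (bConst H η * (s - S) ^ (2 * H))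
        / mittagLeffler β (bConst H η * s ^ (2 * H)))
      * ∫ ω, √(condMGF β (η * cConst H) 0 (X ω)) ∂P
      ≤ ∫ ω, √(x / mittagLeffler β (bConst H η * s ^ (2 * H))
        * condMGF β (η * cConst H) ((s - S) ^ (2 * H) / (2 * H)) (X ω)) ∂P := by
  have := h.isProbabilityMeasure
  have hH := h.H_pos
  have hE := h.one_le_mittagLeffler_bConst η (hS.trans hs)
  have hv : 0 ≤ (s - S) ^ (2 * H) / (2 * H) := by
    have := Real.rpow_nonneg (sub_nonneg.2 hs) (2 * H)
    positivity
  set E := mittagLeffler β (bConst H η * s ^ (2 * H))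
  have hxE : 0 ≤ x / E := div_nonneg hx (by linarith)
  have key := sqrt_mittagLeffler_mul_integral_le h.β_pos h.β_le (η * cConst H)
    ((s - S) ^ (2 * H) / (2 * H)).toNNReal
    ((s ^ (2 * H) - (s - S) ^ (2 * H)) / (2 * H)).toNNReal
  rw [Real.coe_toNNReal _ hv, ← bConst_mul hH, ← h.integral_sqrt_condMGF_volterra _ hS hs hX,
    ← h.integral_sqrt_condMGF_volterra _ hS hs hX] at key
  simp_rw [Real.sqrt_mul hxE]
  rw [integral_const_mul, mul_div_right_comm, Real.sqrt_mul hxE, mul_assoc]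
  exact mul_le_mul_of_nonneg_left key (Real.sqrt_nonneg _)

/-- Jensen: the past and future variances add up to `s^(2H) / (2H)`, so the Mittag-Leffler
normalisation cancels. It serves to dominate the lower integrand by `√ξ₀`. -/
theorem integral_sqrt_mul_le (h : IsGreyModel P β H B Y BH) (η : ℝ) {x S s : ℝ} (hx : 0 ≤ x)
    (hS : 0 ≤ S) (hs : S ≤ s) {X : Ω → ℝ} (hX : IsVolterraIntegral P B H S s X) :
    ∫ ω, √(x / mittagLeffler β (bConst H η * s ^ (2 * H))
        * condMGF β (η * cConst H) ((s - S) ^ (2 * H) / (2 * H)) (X ω)) ∂P ≤ √x := by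
  have := h.isProbabilityMeasure
  have hH := h.H_pos
  have hE := h.one_le_mittagLeffler_bConst η (hS.trans hs)
  have hv : 0 ≤ (s - S) ^ (2 * H) / (2 * H) := by
    have := Real.rpow_nonneg (sub_nonneg.2 hs) (2 * H)
    positivity
  have hv' : 0 ≤ (s ^ (2 * H) - (s - S) ^ (2 * H)) / (2 * H) := by
    have := Real.rpow_le_rpow (sub_nonneg.2 hs) (by linarith : s - S ≤ s)
      (by positivity : 0 ≤ 2 * H)
    exact div_nonneg (sub_nonneg.2 this) (by positivity)
  have key := integral_sqrt_condMGF_le h.β_pos h.β_le (η * cConst H)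
    ((s - S) ^ (2 * H) / (2 * H)).toNNReal
    ((s ^ (2 * H) - (s - S) ^ (2 * H)) / (2 * H)).toNNReal
  rw [Real.coe_toNNReal _ hv, Real.coe_toNNReal _ hv', ← add_div, add_sub_cancel, ← bConst_mul hH,
    ← h.integral_sqrt_condMGF_volterra _ hS hs hX] at key
  set E := mittagLeffler β (bConst H η * s ^ (2 * H))
  have hxE : 0 ≤ x / E := div_nonneg hx (by linarith)
  simp_rw [Real.sqrt_mul hxE]
  rw [integral_const_mul]
  calc _ ≤ √(x / E) * √E := mul_le_mul_of_nonneg_left key (Real.sqrt_nonneg _)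
    _ = √x := by rw [← Real.sqrt_mul hxE, div_mul_cancel₀ _ (by linarith)]

theorem measurable_integral_sqrt_condMGF (h : IsGreyModel P β H B Y BH) (θ : ℝ) {v : ℝ → ℝ}
    (hv : Measurable v) :
    Measurable fun s => ∫ x, √(condMGF β θ 0 x) ∂(gaussianReal 0 (v s).toNNReal) := by
  have := h.isProbabilityMeasure
  have hm := measurable_condMGF β θ 0
  have h1 : Measurable fun s => gaussianReal 0 (v s).toNNReal :=
    measurable_gaussianReal.comp (measurable_const.prodMk hv.real_toNNReal)
  have h2 := (Measure.measurable_lintegral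
    (f := fun x => ENNReal.ofReal √(condMGF β θ 0 x)) (by fun_prop)).comp h1
  convert h2.ennreal_toReal using 1
  funext s
  rw [integral_eq_lintegral_of_nonneg_ae (Eventually.of_forall fun x => Real.sqrt_nonneg _)
    (Measurable.aestronglyMeasurable (by fun_prop))]
  rfl

/-- The family `X s` is given separately for each `s`, with no joint measurability. The expectation
is therefore rewritten through the Gaussian law of `X s`, which depends measurably on `s`. -/
theorem integrableOn_lower (h : IsGreyModel P β H B Y BH) {ξ₀ : ℝ → ℝ} (η : ℝ) {S : ℝ} (hS : 0 ≤ S)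
    {I : Set ℝ} (hI : MeasurableSet I) (hvol : volume I ≠ ∞) (hI0 : ∀ s ∈ I, S ≤ s)
    (hξ0 : ∀ s ∈ I, 0 ≤ ξ₀ s) (hξ : IntegrableOn ξ₀ I) {X : ℝ → Ω → ℝ}
    (hX : ∀ s ∈ I, IsVolterraIntegral P B H S s (X s)) :
    IntegrableOn (fun s => √(ξ₀ s * mittagLeffler β (bConst H η * (s - S) ^ (2 * H))
        / mittagLeffler β (bConst H η * s ^ (2 * H)))
      * ∫ ω, √(condMGF β (η * cConst H) 0 (X s ω)) ∂P) I := by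
  have := h.isProbabilityMeasure
  have hfin : IsFiniteMeasure (volume.restrict I) := isFiniteMeasure_restrict.2 hvol
  refine Integrable.mono' (integrable_sqrt hξ) ?_ ?_
  · have hξm := hξ.1.aemeasurable
    have hm := measurable_condMGF_variance β (η * cConst H) 0
    have h1 := hm.comp (by fun_prop : Measurable fun s : ℝ => (s - S) ^ (2 * H) / (2 * H))
    have h2 := hm.comp (by fun_prop : Measurable fun s : ℝ => s ^ (2 * H) / (2 * H))
    have h3 := h.measurable_integral_sqrt_condMGF (η * cConst H)
      (by fun_prop : Measurable fun s : ℝ => (s ^ (2 * H) - (s - S) ^ (2 * H)) / (2 * H))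
    refine (((hξm.mul h1.aemeasurable).div h2.aemeasurable).sqrt.mul
      h3.aemeasurable).aestronglyMeasurable.congr ?_
    filter_upwards [ae_restrict_mem hI] with s hs
    have hs' := hI0 s hs
    rw [h.mittagLeffler_bConst_eq η (hS.trans hs'),
      h.mittagLeffler_bConst_eq η (sub_nonneg.2 hs'),
      h.integral_sqrt_condMGF_volterra _ hS hs' (hX s hs)]
    rfl
  · filter_upwards [ae_restrict_mem hI] with s hs
    rw [Real.norm_of_nonneg (mul_nonneg (Real.sqrt_nonneg _)
      (integral_nonneg fun ω => Real.sqrt_nonneg _))]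
    exact (h.sqrt_mul_integral_sqrt_le η (hξ0 s hs) hS (hI0 s hs) (hX s hs)).trans
      (h.integral_sqrt_mul_le η (hξ0 s hs) hS (hI0 s hs) (hX s hs))

end IsGreyModel

end GreyBergomi

end

/-! ### Assembly of the two bounds. -/

theorem proposition2p8
    {Ω : Type*} [MeasurableSpace Ω] (P : MeasureTheory.Measure Ω)
    [MeasureTheory.IsProbabilityMeasure P]
    -- parameters
    (β H η T Δ : ℝ) (hβ : 0 < β) (hβ_le : β ≤ 1) (hH : 0 < H) (hH_lt : H < 1) (hη : 0 < η)
    (hT : 0 ≤ T) (hΔ : 0 < Δ)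
    -- initial forward variance curve
    (ξ₀ : ℝ → ℝ) (hξ_pos : ∀ t, 0 ≤ t → 0 < ξ₀ t)
    (hξ_int : IntervalIntegrable ξ₀ MeasureTheory.volume T (T + Δ))
    -- Brownian motion
    (B : ℝ≥0 → Ω → ℝ) (hB_meas : ∀ t, Measurable (B t))
    (hB : ProbabilityTheory.IsBrownianReal B P)
    -- independent M-Wright variable
    (Y : Ω → ℝ) (hY_law : ProbabilityTheory.HasLaw Y (GreyBergomi.mWrightLaw β) P)
    (hY_indep : ProbabilityTheory.IndepFun Y (fun ω t => B t ω) P)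
    -- Riemann-Liouville fractional Brownian motion
    (BH : ℝ → Ω → ℝ) (hBH : GreyBergomi.IsRiemannLiouvilleFBM P B H BH)
    -- the Volterra integrals up to time `T`
    (𝒱 : ℝ → Ω → ℝ)
    (h𝒱 : ∀ s ∈ Set.Icc T (T + Δ), GreyBergomi.IsVolterraIntegral P B H T s (𝒱 s)) :
    let V : ℝ → Ω → ℝ := GreyBergomi.greyVariance P ξ₀ η Y BH
    let ζ : ℝ → Ω → ℝ := fun s ω => GreyBergomi.zetaSeries β H η (𝒱 s ω)
    let b : ℝ := GreyBergomi.bConst H η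
    let E : ℝ → ℝ := GreyBergomi.mittagLeffler β
    let lower : ℝ → Ω → ℝ := fun s ω =>
      √(ξ₀ s * E (b * (s - T) ^ (2 * H)) / E (b * s ^ (2 * H)))
        * (P[fun ω' => √(ζ s ω') | GreyBergomi.pastOf B 0]) ω
    -- all integrals and conditional expectations below are genuine
    MeasureTheory.Integrable (Function.uncurry V)
      ((MeasureTheory.volume.restrict (Set.Ioc T (T + Δ))).prod P) ∧
    MeasureTheory.Integrable (GreyBergomi.vix P B V Δ T) P ∧
    (∀ s ∈ Set.Icc T (T + Δ), MeasureTheory.Integrable (fun ω => √(ζ s ω)) P) ∧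
    (∀ᵐ ω ∂P, IntervalIntegrable (fun s => lower s ω) MeasureTheory.volume T (T + Δ)) ∧
    -- the two bounds
    (∀ᵐ ω ∂P,
      1 / Δ * (∫ s in T..(T + Δ), lower s ω) ≤ GreyBergomi.vixFuture P B V Δ T ω) ∧
    (∀ᵐ ω ∂P,
      GreyBergomi.vixFuture P B V Δ T ω ≤ √(1 / Δ * (∫ s in T..(T + Δ), ξ₀ s))) := by
  intro V ζ b E lower
  have h : GreyBergomi.IsGreyModel P β H B Y BH :=
    ⟨hβ, hβ_le, hH, hB_meas, hB.toIsPreBrownianReal, hY_law, hY_indep, hBH⟩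
  have hprob := h.isProbabilityMeasure
  have hle : T ≤ T + Δ := by linarith
  have hsub : Ioc T (T + Δ) ⊆ Icc T (T + Δ) := Ioc_subset_Icc_self
  have hTI : ∀ s ∈ Ioc T (T + Δ), T ≤ s := fun s hs => hs.1.le
  have hI0 : ∀ s ∈ Ioc T (T + Δ), 0 ≤ s := fun s hs => hT.trans hs.1.le
  have hξ0 : ∀ s ∈ Ioc T (T + Δ), 0 ≤ ξ₀ s := fun s hs => (hξ_pos s (hI0 s hs)).le
  have hξ : IntegrableOn ξ₀ (Ioc T (T + Δ)) :=
    (intervalIntegrable_iff_integrableOn_Ioc_of_le hle).1 hξ_int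
  have hm := GreyBergomi.pastOf_le (S := T) hB_meas
  have hV : Integrable (Function.uncurry V) ((volume.restrict (Ioc T (T + Δ))).prod P) :=
    h.integrable_uncurry_greyVariance η measurableSet_Ioc hI0 hξ0 hξ
  have hVs : ∀ s ∈ Ioc T (T + Δ), Integrable (V s) P ∧ ∫ ω, V s ω ∂P = ξ₀ s := fun s hs =>
    h.integrable_greyVariance η (hI0 s hs) (hξ0 s hs)
  have hV0 : ∀ s ∈ Ioc T (T + Δ), ∀ ω, 0 ≤ V s ω := fun s hs ω =>
    GreyBergomi.greyVariance_nonneg P η Y BH (hξ0 s hs) ω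
  set W : Ω → ℝ := fun ω => 1 / Δ * ∫ s in Ioc T (T + Δ), V s ω with hW
  have hWi : Integrable W P := hV.integral_prod_right.const_mul _
  have hW0 : 0 ≤ᵐ[P] W := Eventually.of_forall fun ω =>
    mul_nonneg (one_div_pos.2 hΔ).le (setIntegral_nonneg measurableSet_Ioc fun s hs => hV0 s hs ω)
  have hWE : ∫ ω, W ω ∂P = 1 / Δ * ∫ s in T..(T + Δ), ξ₀ s := by
    rw [integral_const_mul, ← integral_integral_swap hV, intervalIntegral.integral_of_le hle,
      setIntegral_congr_fun measurableSet_Ioc fun s hs => (hVs s hs).2]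
  have hvix : GreyBergomi.vix P B V Δ T = fun ω => √((P[W | GreyBergomi.pastOf B T]) ω) := by
    funext ω
    simp only [GreyBergomi.vix, intervalIntegral.integral_of_le hle, hW]
  have hvixi : Integrable (GreyBergomi.vix P B V Δ T) P := by
    rw [hvix]
    exact GreyBergomi.integrable_sqrt integrable_condExp
  have hζ : ∀ s ω, ζ s ω = GreyBergomi.condMGF β (η * GreyBergomi.cConst H) 0 (𝒱 s ω) := fun s ω =>
    GreyBergomi.zetaSeries_eq_condMGF hβ hβ_le H η _
  -- On the single event `B 0 = 0` the conditional expectations become constants simultaneously for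
  -- all `s`, so no uncountable union of null sets arises.
  have hlow : ∀ ω, B 0 ω = 0 → (fun s => lower s ω) = fun s =>
      √(ξ₀ s * E (b * (s - T) ^ (2 * H)) / E (b * s ^ (2 * H)))
        * ∫ ω, √(GreyBergomi.condMGF β (η * GreyBergomi.cConst H) 0 (𝒱 s ω)) ∂P := by
    intro ω hω
    funext s
    simp only [lower]
    rw [GreyBergomi.condExp_pastOf_zero hB_meas h.brownian _ hω]
    simp only [hζ]
  have hlowi := h.integrableOn_lower η hT measurableSet_Ioc measure_Ioc_lt_top.ne hTI hξ0 hξ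
    fun s hs => h𝒱 s (hsub hs)
  refine ⟨hV, hvixi, fun s hs => ?_, ?_, ?_, ?_⟩
  · simp only [hζ]
    have := h.integrable_condMGF_volterra (η * GreyBergomi.cConst H) hT hs.1 (h𝒱 s hs) 0
    exact GreyBergomi.integrable_sqrt (by simpa using this)
  · filter_upwards [h.brownian.eval_zero_ae_eq_zero] with ω hω
    rw [hlow ω hω]
    exact (intervalIntegrable_iff_integrableOn_Ioc_of_le hle).2 hlowi
  · filter_upwards [h.brownian.eval_zero_ae_eq_zero] with ω hω
    rw [hlow ω hω, GreyBergomi.vixFuture,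
      GreyBergomi.condExp_pastOf_zero hB_meas h.brownian _ hω, hvix,
      intervalIntegral.integral_of_le hle]
    -- The chosen `N_s` represents the conditional expectation of `V_s` given the past up to `T`.
    refine GreyBergomi.average_le_integral_sqrt_condExp (N := fun s ω => ξ₀ s / E (b * s ^ (2 * H))
        * GreyBergomi.condMGF β (η * GreyBergomi.cConst H) ((s - T) ^ (2 * H) / (2 * H)) (𝒱 s ω))
      hm measurableSet_Ioc (one_div_pos.2 hΔ).le ?_ hV hV0 (fun s hs ω => ?_)
      (fun s hs => (hVs s hs).1.1) (fun s hs => ?_) (fun s hs K hK => ?_) hlowi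
      fun s hs => h.sqrt_mul_integral_sqrt_le η (hξ0 s hs) hT (hTI s hs) (h𝒱 s (hsub hs))
    · simp [Measure.real, hΔ.le, hΔ.ne']
    · exact mul_nonneg (div_nonneg (hξ0 s hs)
        (by linarith [h.one_le_mittagLeffler_bConst η (hI0 s hs)]))
        (GreyBergomi.condMGF_pos hβ hβ_le _ _ _).le
    · have hv : 0 ≤ (s - T) ^ (2 * H) / (2 * H) :=
        div_nonneg (Real.rpow_nonneg (sub_nonneg.2 (hTI s hs)) _) (by linarith)
      have := h.integrable_condMGF_volterra (η * GreyBergomi.cConst H) hT (hTI s hs)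
        (h𝒱 s (hsub hs)) ⟨_, hv⟩
      exact this.const_mul _
    · exact h.lintegral_mul_greyVariance η ⟨T, hT⟩ (hTI s hs) (hξ0 s hs) (h𝒱 s (hsub hs)) hK
  · filter_upwards [h.brownian.eval_zero_ae_eq_zero] with ω hω
    -- After the conditional expectation is averaged out, the right side is `√(E W)` written as
    -- `√(E[E[W | F_T]])`, and Jensen applies.
    rw [GreyBergomi.vixFuture, GreyBergomi.condExp_pastOf_zero hB_meas h.brownian _ hω, hvix,
      ← hWE, ← integral_condExp (f := W) hm]
    exact GreyBergomi.integral_sqrt_le integrable_condExp (condExp_nonneg hW0)
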